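/- Let $(M,g)$ be a smooth ($C^\infty$, Hausdorff, second countable), time-oriented, globally hyperbolic Lorentzian manifold of dimension $d\ge 2$ with signature $(-,+,\dots,+)$. A \emph{future horizon} is a closed achronal topological hypersurface $\mathcal H\subset M$ such that every $p\in\mathcal H$ lies on a future-inextendible null geodesic contained in $\mathcal H$; such geodesics, taken to extend as far to the past within $\mathcal H$ as possible, are the \emph{generators} of $\mathcal H$, and $\mathcal H_{\rm end}\subset\mathcal H$ denotes the set of past endpoints of generators. Let $\mathcal H$ be a connected future horizon, and let $\Sigma_\star$ be a smooth spacelike Cauchy surface lying to the future of $\mathcal H_{\rm end}$ (that is, $\mathcal H_{\rm end}\subset I^-(\Sigma_\star)$) such that $H_\star=\Sigma_\star\cap\mathcal H$ is a smooth compact connected submanifold of codimension $2$ and $\mathcal H$ is a smooth hypersurface in a neighbourhood of $H_\star$. The \emph{generators of the big wavefront} $\mathcal W$ are the null geodesics obtained by extending the generators of $\mathcal H$ as far as possible to the past as geodesics of $M$. For a past-directed null geodesic $\gamma:[0,a)\to M$ starting on $H_\star$ and orthogonal to $H_\star$, the point $\gamma(t_0)$ is a \emph{null cut point of $H_\star$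 along $\gamma$} if for $0\le t\le t_0$ there is no past-directed timelike curve from $H_\star$ to $\gamma(t)$, whereas for every $t>t_0$ there is one. The \emph{past null cut locus} of $H_\star$ is the set of null cut points along all such $\gamma$. Then: (a) $\mathcal H_{\rm end}$ is equal to the set of null cut points of $H_\star$ along the generators of $\mathcal W$ (followed to the past from $H_\star$). (b) At each $u\in H_\star$ there are, up to positive multiples, exactly two past-directed null vectors $\ell,k$ orthogonal to $H_\star$, and of the past-directed null geodesics starting at $u$ orthogonally to $H_\star$ exactly those with initial velocity a positive multiple of $\ell$ (for a suitable labelling of the two) run along generators of $\mathcal W$. (c) $\mathcal H_{\rm end}$ is a subset of the past null cut locus of $H_\star$, and the points of the past null cut locus that are not in $\mathcal H_{\rm end}$ are exactly the null cut points of $H_\star$ along the geodesics of the other family, i.e. the past-directed null geodesics orthogonal to $H_\star$ that do not run along generators of $\mathcal W$. In particular the inclusion is proper if and only if the other family has a null cut point. -/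

import Mathlib

open Set Filter Topology
open scoped Manifold ContDiff

noncomputable section

/-- The model space of a spacetime of dimension `d = n + 2`. -/
abbrev Model (n : ℕ) : Type := EuclideanSpace ℝ (Fin (n + 2))

/-- The tangent space of `M` at `x`. -/
abbrev TSp (n : ℕ) {M : Type*} [TopologicalSpace M] [ChartedSpace (Model n) M] (x : M) : Type :=
  TangentSpace 𝓘(ℝ, Model n) x

/-- The components, in the preferred chart around `x₀` and at the coordinate point `y`, of a field
of bilinear forms on the tangent spaces of `M`. -/
def coordForm {n : ℕ} {M : Type*} [TopologicalSpace M] [ChartedSpace (Model n) M]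
    (g : ∀ x : M, TSp n x →L[ℝ] TSp n x →L[ℝ] ℝ) (x₀ : M) (y u v : Model n) : ℝ :=
  g ((extChartAt 𝓘(ℝ, Model n) x₀).symm y)
    (mfderiv 𝓘(ℝ, Model n) 𝓘(ℝ, Model n) (extChartAt 𝓘(ℝ, Model n) x₀).symm y u)
    (mfderiv 𝓘(ℝ, Model n) 𝓘(ℝ, Model n) (extChartAt 𝓘(ℝ, Model n) x₀).symm y v)

/-- A smooth Lorentzian metric of signature `(-,+,...,+)` together with a time orientation, given
by a continuous timelike vector field. -/
structure Spacetime (n : ℕ) (M : Type*) [TopologicalSpace M] [ChartedSpace (Model n) M]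
    [IsManifold 𝓘(ℝ, Model n) ∞ M] where
  /-- the metric -/
  g : ∀ x : M, TSp n x →L[ℝ] TSp n x →L[ℝ] ℝ
  symm : ∀ (x : M) (u v : TSp n x), g x u v = g x v u
  smooth : ∀ (x₀ : M) (u v : Model n),
    ContDiffOn ℝ ∞ (fun y => coordForm g x₀ y u v) (extChartAt 𝓘(ℝ, Model n) x₀).target
  lorentzian : ∀ x : M, ∃ e : TSp n x, g x e e < 0 ∧
    ∀ v : TSp n x, g x e v = 0 → v ≠ 0 → 0 < g x v v
  /-- the vector field that defines the future -/
  timeField : ∀ x : M, TSp n x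
  continuous_timeField :
    Continuous (fun x => (⟨x, timeField x⟩ : TangentBundle 𝓘(ℝ, Model n) M))
  timelike_timeField : ∀ x : M, g x (timeField x) (timeField x) < 0

namespace Spacetime

variable {n : ℕ} {M : Type*} [TopologicalSpace M] [ChartedSpace (Model n) M]
  [IsManifold 𝓘(ℝ, Model n) ∞ M]

/-! ### Causal character of tangent vectors -/

def FutureTimelike (𝔤 : Spacetime n M) (x : M) (v : TSp n x) : Prop :=
  𝔤.g x v v < 0 ∧ 𝔤.g x (𝔤.timeField x) v < 0

def FutureCausal (𝔤 : Spacetime n M) (x : M) (v : TSp n x) : Prop :=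
  v ≠ 0 ∧ 𝔤.g x v v ≤ 0 ∧ 𝔤.g x (𝔤.timeField x) v < 0

def FutureNull (𝔤 : Spacetime n M) (x : M) (v : TSp n x) : Prop :=
  v ≠ 0 ∧ 𝔤.g x v v = 0 ∧ 𝔤.g x (𝔤.timeField x) v < 0

def PastNull (𝔤 : Spacetime n M) (x : M) (v : TSp n x) : Prop :=
  v ≠ 0 ∧ 𝔤.g x v v = 0 ∧ 0 < 𝔤.g x (𝔤.timeField x) v

/-! ### Timelike and causal curves -/

/-- `c` restricted to `[a, b]` is a `C¹` future-directed timelike curve. -/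
def TimelikeSegment (𝔤 : Spacetime n M) (c : ℝ → M) (a b : ℝ) : Prop :=
  a < b ∧ ContMDiffOn 𝓘(ℝ, ℝ) 𝓘(ℝ, Model n) 1 c (Icc a b) ∧
    ∀ t ∈ Icc a b, 𝔤.FutureTimelike (c t)
      (mfderivWithin 𝓘(ℝ, ℝ) 𝓘(ℝ, Model n) c (Icc a b) t (1 : ℝ))

/-- `c` restricted to `[a, b]` is a `C¹` future-directed causal curve. -/
def CausalSegment (𝔤 : Spacetime n M) (c : ℝ → M) (a b : ℝ) : Prop :=
  a < b ∧ ContMDiffOn 𝓘(ℝ, ℝ) 𝓘(ℝ, Model n) 1 c (Icc a b) ∧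
    ∀ t ∈ Icc a b, 𝔤.FutureCausal (c t)
      (mfderivWithin 𝓘(ℝ, ℝ) 𝓘(ℝ, Model n) c (Icc a b) t (1 : ℝ))

/-- `p ≪ q`: there is a piecewise `C¹` future-directed timelike curve from `p` to `q`, that is, a
finite nonempty chain of `C¹` segments. -/
def Chron (𝔤 : Spacetime n M) : M → M → Prop :=
  Relation.TransGen fun p q => ∃ (c : ℝ → M) (a b : ℝ),
    𝔤.TimelikeSegment c a b ∧ c a = p ∧ c b = q

/-- `p ≤ q`: `p = q`, or there is a piecewise `C¹` future-directed causal curve from `p` to `q`. -/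
def CausalLE (𝔤 : Spacetime n M) : M → M → Prop :=
  Relation.ReflTransGen fun p q => ∃ (c : ℝ → M) (a b : ℝ),
    𝔤.CausalSegment c a b ∧ c a = p ∧ c b = q

/-- The chronological past `I⁻(S)`: the points joined to a point of `S` by a timelike curve that
is past-directed when it is traversed starting from `S`. -/
def chronPast (𝔤 : Spacetime n M) (S : Set M) : Set M := {p | ∃ s ∈ S, 𝔤.Chron p s}

def Achronal (𝔤 : Spacetime n M) (S : Set M) : Prop := ∀ p ∈ S, ∀ q ∈ S, ¬ 𝔤.Chron p q

/-- An inextendible future-directed piecewise `C¹` causal curve, parametrised by `ℝ`. -/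
def InextendibleCausalCurve (𝔤 : Spacetime n M) (c : ℝ → M) : Prop :=
  (∀ t : ℝ, ∃ ε > 0, 𝔤.CausalSegment c (t - ε) t ∧ 𝔤.CausalSegment c t (t + ε)) ∧
    (¬ ∃ q, Tendsto c atTop (𝓝 q)) ∧ (¬ ∃ q, Tendsto c atBot (𝓝 q))

/-- Every inextendible causal curve meets `S` exactly once. -/
def IsCauchySurface (𝔤 : Spacetime n M) (S : Set M) : Prop :=
  ∀ c : ℝ → M, 𝔤.InextendibleCausalCurve c → ∃! t : ℝ, c t ∈ S

/-- Every neighbourhood `U` of a point contains a neighbourhood `V` of it such that a causal curve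
with endpoints in `V` stays in `U`. -/
def StronglyCausal (𝔤 : Spacetime n M) : Prop :=
  ∀ p : M, ∀ U ∈ 𝓝 p, ∃ V ∈ 𝓝 p, V ⊆ U ∧
    ∀ x ∈ V, ∀ y ∈ V, ∀ z, 𝔤.CausalLE x z → 𝔤.CausalLE z y → z ∈ U

def GloballyHyperbolic (𝔤 : Spacetime n M) : Prop :=
  𝔤.StronglyCausal ∧ ∀ p q : M, IsCompact {z | 𝔤.CausalLE p z ∧ 𝔤.CausalLE z q}

/-! ### Geodesics -/

/-- The velocity of a curve. -/
def velocity (n : ℕ) {M : Type*} [TopologicalSpace M] [ChartedSpace (Model n) M]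
    (c : ℝ → M) (t : ℝ) : TSp n (c t) :=
  mfderiv 𝓘(ℝ, ℝ) 𝓘(ℝ, Model n) c t (1 : ℝ)

/-- The Christoffel symbol of the first kind
`½ (∂ᵤ g(v, w) + ∂ᵥ g(u, w) - ∂_w g(u, v))` in the preferred chart around `x₀`. -/
def christoffel (𝔤 : Spacetime n M) (x₀ : M) (y u v w : Model n) : ℝ :=
  (1 / 2 : ℝ) * (fderiv ℝ (fun z => coordForm 𝔤.g x₀ z v w) y u
    + fderiv ℝ (fun z => coordForm 𝔤.g x₀ z u w) y v
    - fderiv ℝ (fun z => coordForm 𝔤.g x₀ z u v) y w)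

/-- The geodesic equation at the parameter `t`, with its free index lowered, in the preferred chart
around `γ t`. -/
def GeodesicEqAt (𝔤 : Spacetime n M) (γ : ℝ → M) (t : ℝ) : Prop :=
  let x : ℝ → Model n := fun s => extChartAt 𝓘(ℝ, Model n) (γ t) (γ s)
  ∀ w : Model n, coordForm 𝔤.g (γ t) (x t) (deriv (deriv x) t) w
    + 𝔤.christoffel (γ t) (x t) (deriv x t) (deriv x t) w = 0

/-- `γ`, restricted to the nonempty open interval `J`, is an affinely parametrised geodesic. -/
def IsGeodesic (𝔤 : Spacetime n M) (γ : ℝ → M) (J : Set ℝ) : Prop :=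
  IsOpen J ∧ J.OrdConnected ∧ J.Nonempty ∧
    ContMDiffOn 𝓘(ℝ, ℝ) 𝓘(ℝ, Model n) ∞ γ J ∧ ∀ t ∈ J, 𝔤.GeodesicEqAt γ t

/-- A future-directed null geodesic that cannot be extended, in either direction. -/
def IsMaximalFutureNullGeodesic (𝔤 : Spacetime n M) (γ : ℝ → M) (J : Set ℝ) : Prop :=
  𝔤.IsGeodesic γ J ∧ (∀ t ∈ J, 𝔤.FutureNull (γ t) (velocity n γ t)) ∧
    ∀ (γ' : ℝ → M) (J' : Set ℝ), 𝔤.IsGeodesic γ' J' → J ⊆ J' → EqOn γ γ' J → J' = J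

/-! ### Submanifolds -/

/-- An embedded topological hypersurface. -/
def IsTopHypersurface (n : ℕ) {M : Type*} [TopologicalSpace M] [ChartedSpace (Model n) M]
    (S : Set M) : Prop :=
  ∀ p ∈ S, ∃ φ : OpenPartialHomeomorph M (Model n), p ∈ φ.source ∧
    ∀ q ∈ φ.source, q ∈ S ↔ φ q 0 = 0

/-- An embedded smooth submanifold of codimension `k` (used for `k ≤ n + 2`). -/
def IsSmoothSubmanifold (n : ℕ) {M : Type*} [TopologicalSpace M] [ChartedSpace (Model n) M]
    (k : ℕ) (S : Set M) : Prop :=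
  ∀ p ∈ S, ∃ φ ∈ IsManifold.maximalAtlas 𝓘(ℝ, Model n) ∞ M, p ∈ φ.source ∧
    ∀ q ∈ φ.source, q ∈ S ↔ ∀ i : Fin (n + 2), i.val < k → φ q i = 0

/-- `v` is the velocity at `p` of a smooth curve that lies in `S`. (The velocity is compared with
`v` in the model space, which is what the tangent space at the point `c 0 = p` is by definition.) -/
def TangentTo (n : ℕ) {M : Type*} [TopologicalSpace M] [ChartedSpace (Model n) M]
    (S : Set M) (p : M) (v : TSp n p) : Prop :=
  ∃ c : ℝ → M, ContMDiffAt 𝓘(ℝ, ℝ) 𝓘(ℝ, Model n) ∞ c 0 ∧ (∀ᶠ t in 𝓝 (0 : ℝ), c t ∈ S) ∧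
    c 0 = p ∧ (velocity n c 0 : Model n) = v

/-- All nonzero vectors tangent to `S` are spacelike. -/
def IsSpacelike (𝔤 : Spacetime n M) (S : Set M) : Prop :=
  ∀ p ∈ S, ∀ v : TSp n p, TangentTo n S p v → v ≠ 0 → 0 < 𝔤.g p v v

/-- `v` is orthogonal to `S` at `p`. -/
def OrthogonalTo (𝔤 : Spacetime n M) (S : Set M) (p : M) (v : TSp n p) : Prop :=
  ∀ w : TSp n p, TangentTo n S p w → 𝔤.g p v w = 0

/-! ### Horizons -/

/-- The part of the maximal null geodesic `γ` with parameter at least `t₀` is a future-inextendible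
null geodesic contained in `H`. -/
def IsRulingFrom (𝔤 : Spacetime n M) (H : Set M) (γ : ℝ → M) (J : Set ℝ) (t₀ : ℝ) : Prop :=
  𝔤.IsMaximalFutureNullGeodesic γ J ∧ t₀ ∈ J ∧ ∀ t ∈ J, t₀ ≤ t → γ t ∈ H

/-- A future horizon: an achronal, closed, future null geodesically ruled topological
hypersurface. -/
def IsFutureHorizon (𝔤 : Spacetime n M) (H : Set M) : Prop :=
  𝔤.Achronal H ∧ IsClosed H ∧ IsTopHypersurface n H ∧
    ∀ p ∈ H, ∃ (γ : ℝ → M) (J : Set ℝ) (t₀ : ℝ), 𝔤.IsRulingFrom H γ J t₀ ∧ γ t₀ = p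

/-- The set of past endpoints of the generators of `H`: the points `γ t₀` such that `γ` lies in `H`
from `t₀` onwards, but not from any earlier parameter onwards. -/
def horizonEnd (𝔤 : Spacetime n M) (H : Set M) : Set M :=
  {p | ∃ (γ : ℝ → M) (J : Set ℝ) (t₀ : ℝ), 𝔤.IsRulingFrom H γ J t₀ ∧ γ t₀ = p ∧
    ∀ t₁ < t₀, ¬ 𝔤.IsRulingFrom H γ J t₁}

/-- A generator of the big wavefront: a generator of `H`, extended as far as possible. -/
def IsWavefrontGenerator (𝔤 : Spacetime n M) (H : Set M) (η : ℝ → M) (K : Set ℝ) : Prop :=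
  ∃ t₀ : ℝ, 𝔤.IsRulingFrom H η K t₀

/-! ### Null cut points -/

/-- A past-directed null geodesic that starts, at parameter `0`, on `S` and orthogonally to `S`. -/
def IsPastNormalNullGeodesic (𝔤 : Spacetime n M) (S : Set M) (γ : ℝ → M) (J : Set ℝ) : Prop :=
  𝔤.IsGeodesic γ J ∧ (∀ t ∈ J, 𝔤.PastNull (γ t) (velocity n γ t)) ∧
    (0 : ℝ) ∈ J ∧ γ 0 ∈ S ∧ 𝔤.OrthogonalTo S (γ 0) (velocity n γ 0)

/-- `p` is a null cut point of `S` along the past-directed normal null geodesic `γ`. -/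
def IsNullCutPoint (𝔤 : Spacetime n M) (S : Set M) (γ : ℝ → M) (J : Set ℝ) (p : M) : Prop :=
  𝔤.IsPastNormalNullGeodesic S γ J ∧ ∃ t₀ ∈ J, 0 ≤ t₀ ∧ γ t₀ = p ∧
    (∀ t ∈ J, 0 ≤ t → t ≤ t₀ → γ t ∉ 𝔤.chronPast S) ∧
    (∀ t ∈ J, t₀ < t → γ t ∈ 𝔤.chronPast S)

/-- The past null cut locus of `S`. -/
def pastNullCutLocus (𝔤 : Spacetime n M) (S : Set M) : Set M :=
  {p | ∃ (γ : ℝ → M) (J : Set ℝ), 𝔤.IsNullCutPoint S γ J p}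

/-- `γ` runs, towards the past, along a generator of the big wavefront of `H`. -/
def AlongWavefront (𝔤 : Spacetime n M) (H : Set M) (γ : ℝ → M) (J : Set ℝ) : Prop :=
  ∃ (η : ℝ → M) (K : Set ℝ), 𝔤.IsWavefrontGenerator H η K ∧
    ∃ s c : ℝ, 0 < c ∧ ∀ t ∈ J, s - c * t ∈ K ∧ γ t = η (s - c * t)

/-- The null cut points of `S` along the generators of the big wavefront of `H`. -/
def wavefrontCutPoints (𝔤 : Spacetime n M) (H S : Set M) : Set M :=
  {p | ∃ (γ : ℝ → M) (J : Set ℝ), 𝔤.IsNullCutPoint S γ J p ∧ 𝔤.AlongWavefront H γ J}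

/-- The null cut points of `S` along the past-directed normal null geodesics that do not belong to
the big wavefront of `H`. -/
def otherCutPoints (𝔤 : Spacetime n M) (H S : Set M) : Set M :=
  {p | ∃ (γ : ℝ → M) (J : Set ℝ), 𝔤.IsNullCutPoint S γ J p ∧ ¬ 𝔤.AlongWavefront H γ J}

end Spacetime

end

/-! The heart of the matter is achronality. On the horizon a generator cannot enter the
chronological past of the section `S ∩ H`, because `H` is achronal and contains the section. So
there is no cut before the past endpoint, and it remains to see that the cut comes at once beyond
it.

Let `p` be the past endpoint of a generator. Arbitrarily close to `p` on its past side the extended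
generator has points `q` off `H`. An achronal topological hypersurface is locally two-sided, so `q`
is chronologically before or after some `h ∈ H` near `p` (`exists_nhds_chron_of_notMem`). If `h ≪
q`, then `h ≪ p`, against achronality. Hence `q ≪ h`. Since `p` lies in the open set `I⁻(S)`, so
does `h`; the generator through `h` must cross the Cauchy surface after `h`, and does so inside `H`.
Thus `q` is in the chronological past of the section, and by push-up so is everything before `q` on
the extended generator (`mem_chronPast_of_lt_end`).

For the normal directions, achronality makes the metric positive semidefinite on the tangent spaces
of the smooth part of `H`. A null tangent vector therefore lies in the radical: it is orthogonal to
`H`, and unique up to scale. The generator direction is thus one of the two null normals of the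
section, which exist because the normal space of a spacelike codimension-two subspace is a
Lorentzian plane (`exists_null_pair`). Uniqueness and maximality of geodesics turn equality of
directions into running along a generator.

Finally, the cut points of the two families are disjoint. If a normal null geodesic reaches a point
of `H`, achronality and two-sidedness force the whole segment into `H` (`mem_of_mem`). Its initial
velocity is then tangent to `H`, so the geodesic runs along a generator.

The causal theory behind this is obtained in charts, without normal neighbourhoods: openness of the
chronology relation by perturbing straight segments, push-up by an exponential displacement along a
timelike vector, and acausality of Cauchy surfaces by building inextendible curves. The latter needs
maximal causal geodesics to have no endpoints, which comes from a bound of the acceleration by the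
square of the speed. -/

noncomputable section

/-! ### Lorentzian bilinear forms -/

/-- A symmetric bilinear form of signature `(-,+,...,+)`. -/
structure IsLorentzForm {V : Type*} [NormedAddCommGroup V] [NormedSpace ℝ V]
    (B : V →L[ℝ] V →L[ℝ] ℝ) : Prop where
  symm : ∀ u v, B u v = B v u
  exists_timelike : ∃ e, B e e < 0 ∧ ∀ v, B e v = 0 → v ≠ 0 → 0 < B v v

namespace IsLorentzForm

variable {V : Type*} [NormedAddCommGroup V] [NormedSpace ℝ V] {B : V →L[ℝ] V →L[ℝ] ℝ}

/-- If `B v v ≤ 0`, then `B` is nonpositive on the span of `T` and `v`. The combination `w` in that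
span is orthogonal to `e`, where `B` is positive definite, so `w = 0`; pairing `w` with `T` and
using `B e T ≠ 0` then forces `v = 0`. -/
theorem pos_of_orthogonal (hB : IsLorentzForm B) {T v : V} (hT : B T T < 0) (h : B T v = 0)
    (hv : v ≠ 0) : 0 < B v v := by
  by_contra! hvv
  obtain ⟨e, -, hpos⟩ := hB.exists_timelike
  have hT0 : T ≠ 0 := by rintro rfl; simp at hT
  have heT : B e T ≠ 0 := fun h0 => absurd (hpos T h0 hT0) (by linarith)
  set w := (B e v) • T - (B e T) • v with hw
  have hew : B e w = 0 := by simp [hw]; ring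
  have hvT : B v T = 0 := by rw [hB.symm, h]
  have hww : B w w ≤ 0 := by
    have : B w w = (B e v) ^ 2 * B T T + (B e T) ^ 2 * B v v := by
      simp [hw, h, hvT]; ring
    rw [this]
    nlinarith [sq_nonneg (B e v), sq_nonneg (B e T)]
  have hw0 : w = 0 := by
    by_contra h0
    exact absurd (hpos w hew h0) (by linarith)
  have h1 : B T w = B e v * B T T := by simp [hw, h]
  rw [hw0] at h1
  have h2 : B e v = 0 := by
    have : B e v * B T T = 0 := by simpa using h1.symm
    rcases mul_eq_zero.1 this with h | h
    · exact h
    · linarith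
  have : (B e T) • v = 0 := by
    have := hw0
    rw [hw, h2] at this
    simpa using this
  rcases smul_eq_zero.1 this with h | h
  · exact heT h
  · exact hv h

theorem apply_ne_zero (hB : IsLorentzForm B) {T v : V} (hT : B T T < 0) (hv : v ≠ 0)
    (hvv : B v v ≤ 0) : B T v ≠ 0 := fun h =>
  absurd (hB.pos_of_orthogonal hT h hv) (by linarith)

theorem eq_zero_of_forall (hB : IsLorentzForm B) {u : V} (h : ∀ v, B u v = 0) : u = 0 := by
  obtain ⟨e, -, hpos⟩ := hB.exists_timelike
  by_contra hu
  have := hpos u (by rw [hB.symm, h]) hu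
  rw [h] at this
  exact lt_irrefl _ this

/-- Two future causal vectors have negative product, unless they are proportional. -/
theorem apply_neg_of_ne (hB : IsLorentzForm B) {T u v : V} (hT : B T T < 0) (hu : B u u ≤ 0)
    (hv : B v v ≤ 0) (hTu : B T u < 0) (hTv : B T v < 0)
    (hne : (B T v) • u ≠ (B T u) • v) : B u v < 0 := by
  -- This combination is orthogonal to `T`, hence spacelike. Expanding its square leaves `-2 (B T u)
  -- (B T v) B u v` as the only term that can be positive.
  have hw := hB.pos_of_orthogonal hT (v := (B T v) • u - (B T u) • v)
    (by simp; ring) (sub_ne_zero.2 hne)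
  have hs := hB.symm v u
  simp only [map_sub, map_smul, sub_apply, smul_apply,
    smul_eq_mul, hs] at hw
  have h1 := mul_pos_of_neg_of_neg hTu hTv
  by_contra! h
  have := mul_nonneg h1.le h
  nlinarith [mul_nonneg (sq_nonneg (B T v)) (neg_nonneg.2 hu),
    mul_nonneg (sq_nonneg (B T u)) (neg_nonneg.2 hv)]

theorem apply_neg_of_timelike (hB : IsLorentzForm B) {T u v : V} (hT : B T T < 0) (hu : B u u ≤ 0)
    (hv : B v v < 0) (hTu : B T u < 0) (hTv : B T v < 0) : B u v < 0 := by
  by_cases hne : (B T v) • u = (B T u) • v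
  · have h1 : B ((B T v) • u) v = B ((B T u) • v) v := by rw [hne]
    simp only [map_smul, smul_apply, smul_eq_mul] at h1
    have := mul_pos_of_neg_of_neg hTu hv
    by_contra! h
    nlinarith
  · exact hB.apply_neg_of_ne hT hu hv.le hTu hTv hne

end IsLorentzForm
end

noncomputable section

namespace Spacetime

variable {n : ℕ} {M : Type*} [TopologicalSpace M] [ChartedSpace (Model n) M]
  [IsManifold 𝓘(ℝ, Model n) ∞ M]

/-! ### The metric in a chart -/

/-- The derivative of the inverse of the preferred chart. -/
def chartVec (n : ℕ) {M : Type*} [TopologicalSpace M] [ChartedSpace (Model n) M] (x₀ : M)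
    (y : Model n) : Model n →L[ℝ] Model n :=
  mfderiv 𝓘(ℝ, Model n) 𝓘(ℝ, Model n) (extChartAt 𝓘(ℝ, Model n) x₀).symm y

/-- The derivative of the preferred chart. -/
def chartDeriv (n : ℕ) {M : Type*} [TopologicalSpace M] [ChartedSpace (Model n) M] (x₀ : M)
    (x : M) : Model n →L[ℝ] Model n :=
  mfderiv 𝓘(ℝ, Model n) 𝓘(ℝ, Model n) (extChartAt 𝓘(ℝ, Model n) x₀) x

/-- The metric at a point, as a bilinear form on the model space. -/
def form (𝔤 : Spacetime n M) (x : M) : Model n →L[ℝ] Model n →L[ℝ] ℝ := 𝔤.g x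

/-- The time orientation at a point, as a vector of the model space. -/
def timeVec (𝔤 : Spacetime n M) (x : M) : Model n := 𝔤.timeField x

/-- The metric in the preferred chart around `x₀`. -/
def chartForm (𝔤 : Spacetime n M) (x₀ : M) (y : Model n) : Model n →L[ℝ] Model n →L[ℝ] ℝ :=
  (𝔤.form ((extChartAt 𝓘(ℝ, Model n) x₀).symm y)).bilinearComp (chartVec n x₀ y) (chartVec n x₀ y)

theorem coordForm_eq (𝔤 : Spacetime n M) (x₀ : M) (y u v : Model n) :
    coordForm 𝔤.g x₀ y u v = 𝔤.chartForm x₀ y u v := rfl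

/-- The time orientation in the preferred chart around `x₀`. -/
def chartTimeVec (𝔤 : Spacetime n M) (x₀ : M) (y : Model n) : Model n :=
  chartDeriv n x₀ ((extChartAt 𝓘(ℝ, Model n) x₀).symm y)
    (𝔤.timeVec ((extChartAt 𝓘(ℝ, Model n) x₀).symm y))

theorem isLorentzForm_form (𝔤 : Spacetime n M) (x : M) : IsLorentzForm (𝔤.form x) :=
  ⟨𝔤.symm x, 𝔤.lorentzian x⟩

theorem form_timeVec (𝔤 : Spacetime n M) (x : M) : 𝔤.form x (𝔤.timeVec x) (𝔤.timeVec x) < 0 :=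
  𝔤.timelike_timeField x

theorem chartVec_chartDeriv {x₀ x : M} (hx : x ∈ (extChartAt 𝓘(ℝ, Model n) x₀).source)
    (v : Model n) : chartVec n x₀ (extChartAt 𝓘(ℝ, Model n) x₀ x) (chartDeriv n x₀ x v) = v := by
  have : IsManifold 𝓘(ℝ, Model n) 1 M := IsManifold.of_le (n := ∞) (by simp)
  have h := mfderivWithin_extChartAt_symm_comp_mfderiv_extChartAt' (I := 𝓘(ℝ, Model n)) hx
  have h2 : (range 𝓘(ℝ, Model n)) = univ := by simp
  rw [h2, mfderivWithin_univ] at h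
  exact DFunLike.congr_fun h v

theorem chartDeriv_chartVec {x₀ : M} {y : Model n}
    (hy : y ∈ (extChartAt 𝓘(ℝ, Model n) x₀).target)
    (v : Model n) :
    chartDeriv n x₀ ((extChartAt 𝓘(ℝ, Model n) x₀).symm y) (chartVec n x₀ y v) = v := by
  have : IsManifold 𝓘(ℝ, Model n) 1 M := IsManifold.of_le (n := ∞) (by simp)
  have h := mfderiv_extChartAt_comp_mfderivWithin_extChartAt_symm (I := 𝓘(ℝ, Model n)) hy
  have h2 : (range 𝓘(ℝ, Model n)) = univ := by simp
  rw [h2, mfderivWithin_univ] at h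
  exact DFunLike.congr_fun h v

theorem chartDeriv_self (x : M) : chartDeriv n x x = ContinuousLinearMap.id ℝ (Model n) := by
  have : IsManifold 𝓘(ℝ, Model n) 1 M := IsManifold.of_le (n := ∞) (by simp)
  exact mfderiv_extChartAt_self (I := 𝓘(ℝ, Model n)) (x := x)

theorem chartForm_chartDeriv (𝔤 : Spacetime n M) {x₀ x : M}
    (hx : x ∈ (extChartAt 𝓘(ℝ, Model n) x₀).source) (u v : Model n) :
    𝔤.chartForm x₀ (extChartAt 𝓘(ℝ, Model n) x₀ x) (chartDeriv n x₀ x u) (chartDeriv n x₀ x v)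
      = 𝔤.form x u v := by
  simp only [chartForm, ContinuousLinearMap.bilinearComp_apply, chartVec_chartDeriv hx]
  rw [(extChartAt 𝓘(ℝ, Model n) x₀).left_inv hx]

theorem chartTimeVec_apply (𝔤 : Spacetime n M) {x₀ x : M}
    (hx : x ∈ (extChartAt 𝓘(ℝ, Model n) x₀).source) :
    𝔤.chartTimeVec x₀ (extChartAt 𝓘(ℝ, Model n) x₀ x) = chartDeriv n x₀ x (𝔤.timeVec x) := by
  rw [chartTimeVec, (extChartAt 𝓘(ℝ, Model n) x₀).left_inv hx]

theorem isLorentzForm_chartForm (𝔤 : Spacetime n M) (x₀ : M) {y : Model n}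
    (hy : y ∈ (extChartAt 𝓘(ℝ, Model n) x₀).target) : IsLorentzForm (𝔤.chartForm x₀ y) := by
  have hs := (extChartAt 𝓘(ℝ, Model n) x₀).map_target hy
  have hr := (extChartAt 𝓘(ℝ, Model n) x₀).right_inv hy
  set x := (extChartAt 𝓘(ℝ, Model n) x₀).symm y with hx
  have key := 𝔤.chartForm_chartDeriv hs
  rw [hr] at key
  have hsurj : ∀ u, chartDeriv n x₀ x (chartVec n x₀ y u) = u := fun u => chartDeriv_chartVec hy u
  have hB := 𝔤.isLorentzForm_form x
  refine ⟨fun u v => ?_, ?_⟩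
  · rw [← hsurj u, ← hsurj v, key, key, hB.symm]
  · obtain ⟨e, he, hpos⟩ := hB.exists_timelike
    refine ⟨chartDeriv n x₀ x e, by rw [key]; exact he, fun v hv hv0 => ?_⟩
    rw [← hsurj v, key] at hv ⊢
    refine hpos _ hv fun h => hv0 ?_
    rw [← hsurj v, h, map_zero]

theorem chartForm_chartTimeVec (𝔤 : Spacetime n M) (x₀ : M) {y : Model n}
    (hy : y ∈ (extChartAt 𝓘(ℝ, Model n) x₀).target) :
    𝔤.chartForm x₀ y (𝔤.chartTimeVec x₀ y) (𝔤.chartTimeVec x₀ y) < 0 := by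
  have hs := (extChartAt 𝓘(ℝ, Model n) x₀).map_target hy
  have := 𝔤.chartForm_chartDeriv hs
  rw [(extChartAt 𝓘(ℝ, Model n) x₀).right_inv hy] at this
  rw [chartTimeVec, this]
  exact 𝔤.form_timeVec _

theorem contDiffOn_chartForm (𝔤 : Spacetime n M) (x₀ : M) :
    ContDiffOn ℝ ∞ (𝔤.chartForm x₀) (extChartAt 𝓘(ℝ, Model n) x₀).target := by
  rw [contDiffOn_clm_apply]
  intro u
  rw [contDiffOn_clm_apply]
  exact fun v => 𝔤.smooth x₀ u v

/-- On fibres the trivialisation of the tangent bundle at `x₀` is the derivative of the chart, so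
continuity into the bundle is continuity of the chart components. -/
theorem continuousOn_chartTimeVec (𝔤 : Spacetime n M) (x₀ : M) :
    ContinuousOn (𝔤.chartTimeVec x₀) (extChartAt 𝓘(ℝ, Model n) x₀).target := by
  have : IsManifold 𝓘(ℝ, Model n) 1 M := IsManifold.of_le (n := ∞) (by simp)
  have h1 : ContinuousOn (fun x => (trivializationAt (Model n)
      (TangentSpace 𝓘(ℝ, Model n) (M := M)) x₀ ⟨x, 𝔤.timeField x⟩).2)
      (extChartAt 𝓘(ℝ, Model n) x₀).source := by
    refine continuous_snd.comp_continuousOn (ContinuousOn.comp (t := (trivializationAt (Model n)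
      (TangentSpace 𝓘(ℝ, Model n) (M := M)) x₀).source) (Bundle.Trivialization.continuousOn _)
      𝔤.continuous_timeField.continuousOn ?_)
    intro x hx
    rw [Bundle.Trivialization.mem_source]
    simpa using hx
  refine (h1.comp (continuousOn_extChartAt_symm (I := 𝓘(ℝ, Model n)) x₀)
    (extChartAt 𝓘(ℝ, Model n) x₀).mapsTo_symm).congr fun y hy => ?_
  have hs := (extChartAt 𝓘(ℝ, Model n) x₀).map_target hy
  have hs' := hs
  rw [extChartAt_source] at hs'
  have := TangentBundle.continuousLinearMapAt_trivializationAt (I := 𝓘(ℝ, Model n)) hs'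
  rw [chartTimeVec, chartDeriv, ← this]
  have h3 := congrFun (Bundle.Trivialization.continuousLinearMapAt_apply ℝ
    (trivializationAt (Model n) (TangentSpace 𝓘(ℝ, Model n) (M := M)) x₀)
    ((extChartAt 𝓘(ℝ, Model n) x₀).symm y)) (𝔤.timeField _)
  rw [Bundle.Trivialization.linearMapAt_apply, if_pos (by simpa using hs')] at h3
  exact h3

/-! ### Causal curves in a chart -/

local notation "φ[" x₀ "]" => extChartAt (modelWithCornersSelf ℝ (Model n)) x₀

/-- `u` is a future timelike vector at the point `y` of the preferred chart around `x₀`. -/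
def ChartTimelike (𝔤 : Spacetime n M) (x₀ : M) (y u : Model n) : Prop :=
  𝔤.chartForm x₀ y u u < 0 ∧ 𝔤.chartForm x₀ y (𝔤.chartTimeVec x₀ y) u < 0

/-- `u` is a future causal vector at the point `y` of the preferred chart around `x₀`. -/
def ChartCausal (𝔤 : Spacetime n M) (x₀ : M) (y u : Model n) : Prop :=
  u ≠ 0 ∧ 𝔤.chartForm x₀ y u u ≤ 0 ∧ 𝔤.chartForm x₀ y (𝔤.chartTimeVec x₀ y) u < 0

theorem futureTimelike_iff_chart (𝔤 : Spacetime n M) {x₀ x : M} (hx : x ∈ (φ[x₀]).source)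
    (v : Model n) :
    𝔤.FutureTimelike x v ↔ 𝔤.ChartTimelike x₀ (φ[x₀] x) (chartDeriv n x₀ x v) := by
  rw [ChartTimelike, chartTimeVec_apply _ hx, chartForm_chartDeriv _ hx, chartForm_chartDeriv _ hx]
  rfl

theorem chartDeriv_eq_zero {x₀ x : M} (hx : x ∈ (φ[x₀]).source) {v : Model n} :
    chartDeriv n x₀ x v = 0 ↔ v = 0 := by
  refine ⟨fun h => ?_, fun h => by rw [h, map_zero]⟩
  rw [← chartVec_chartDeriv hx v, h, map_zero]

theorem futureCausal_iff_chart (𝔤 : Spacetime n M) {x₀ x : M} (hx : x ∈ (φ[x₀]).source)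
    (v : Model n) :
    𝔤.FutureCausal x v ↔ 𝔤.ChartCausal x₀ (φ[x₀] x) (chartDeriv n x₀ x v) := by
  rw [ChartCausal, chartTimeVec_apply _ hx, chartForm_chartDeriv _ hx, chartForm_chartDeriv _ hx,
    Ne, chartDeriv_eq_zero hx]
  rfl

/-- The velocity of a curve on a set of parameters, as a vector of the model space. -/
def velWithin (n : ℕ) {M : Type*} [TopologicalSpace M] [ChartedSpace (Model n) M]
    (c : ℝ → M) (s : Set ℝ) (t : ℝ) : Model n :=
  mfderivWithin 𝓘(ℝ, ℝ) 𝓘(ℝ, Model n) c s t (1 : ℝ)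

/-- The velocity of a curve, as a vector of the model space. -/
def vel (n : ℕ) {M : Type*} [TopologicalSpace M] [ChartedSpace (Model n) M]
    (c : ℝ → M) (t : ℝ) : Model n := velocity n c t

theorem derivWithin_chart {x₀ : M} {c : ℝ → M} {s : Set ℝ} {t : ℝ}
    (hc : MDifferentiableWithinAt 𝓘(ℝ, ℝ) 𝓘(ℝ, Model n) c s t) (hs : UniqueDiffWithinAt ℝ s t)
    (ht : c t ∈ (φ[x₀]).source) :
    derivWithin (fun r => φ[x₀] (c r)) s t = chartDeriv n x₀ (c t) (velWithin n c s t) := by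
  have : IsManifold 𝓘(ℝ, Model n) 1 M := IsManifold.of_le (n := ∞) (by simp)
  have hφ : MDifferentiableAt 𝓘(ℝ, Model n) 𝓘(ℝ, Model n) (φ[x₀]) (c t) :=
    mdifferentiableAt_extChartAt (by rwa [extChartAt_source] at ht)
  have h := mfderiv_comp_mfderivWithin t hφ hc hs.uniqueMDiffWithinAt
  rw [mfderivWithin_eq_fderivWithin] at h
  have h2 := DFunLike.congr_fun h (1 : ℝ)
  exact h2

theorem deriv_chart {x₀ : M} {c : ℝ → M} {t : ℝ}
    (hc : MDifferentiableAt 𝓘(ℝ, ℝ) 𝓘(ℝ, Model n) c t)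
    (ht : c t ∈ (φ[x₀]).source) :
    deriv (fun r => φ[x₀] (c r)) t = chartDeriv n x₀ (c t) (vel n c t) := by
  have := derivWithin_chart (s := univ) (mdifferentiableWithinAt_univ.2 hc) uniqueDiffWithinAt_univ
    ht
  rwa [derivWithin_univ, velWithin, mfderivWithin_univ] at this

theorem contMDiffOn_chart_comp {x₀ : M} {c : ℝ → M} {s : Set ℝ} {k : WithTop ℕ∞} (hk : k ≤ ∞)
    (hc : ContMDiffOn 𝓘(ℝ, ℝ) 𝓘(ℝ, Model n) k c s) (hs : MapsTo c s (φ[x₀]).source) :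
    ContDiffOn ℝ k (fun r => φ[x₀] (c r)) s := by
  rw [← contMDiffOn_iff_contDiffOn]
  have h : ContMDiffOn 𝓘(ℝ, Model n) 𝓘(ℝ, Model n) k (φ[x₀]) (φ[x₀]).source := by
    rw [extChartAt_source]
    exact (contMDiffOn_extChartAt (n := ∞)).of_le hk
  exact h.comp hc hs

theorem contMDiffOn_chart_symm_comp {x₀ : M} {x : ℝ → Model n} {s : Set ℝ} {k : WithTop ℕ∞}
    (hk : k ≤ ∞) (hx : ContDiffOn ℝ k x s) (hs : MapsTo x s (φ[x₀]).target) :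
    ContMDiffOn 𝓘(ℝ, ℝ) 𝓘(ℝ, Model n) k (fun r => (φ[x₀]).symm (x r)) s :=
  ((contMDiffOn_extChartAt_symm (n := ∞) x₀).of_le hk).comp hx.contMDiffOn hs

/-- Transfers the timelike condition to the model space, where straight segments and explicit
displacements can be tested. -/
theorem timelikeSegment_iff_chart (𝔤 : Spacetime n M) {x₀ : M} {c : ℝ → M} {a b : ℝ} (hab : a < b)
    (hs : MapsTo c (Icc a b) (φ[x₀]).source) :
    𝔤.TimelikeSegment c a b ↔ ContDiffOn ℝ 1 (fun r => φ[x₀] (c r)) (Icc a b) ∧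
      ∀ t ∈ Icc a b, 𝔤.ChartTimelike x₀ (φ[x₀] (c t))
        (derivWithin (fun r => φ[x₀] (c r)) (Icc a b) t) := by
  have hc : ContMDiffOn 𝓘(ℝ, ℝ) 𝓘(ℝ, Model n) 1 c (Icc a b) ↔
      ContDiffOn ℝ 1 (fun r => φ[x₀] (c r)) (Icc a b) := by
    refine ⟨fun h => contMDiffOn_chart_comp (by simp) h hs, fun h => ?_⟩
    refine (contMDiffOn_chart_symm_comp (by simp) h fun t ht => (φ[x₀]).map_source (hs ht)).congr
      fun t ht => ((φ[x₀]).left_inv (hs ht)).symm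
  rw [TimelikeSegment, ← hc]
  refine ⟨fun h => ⟨h.2.1, fun t ht => ?_⟩, fun h => ⟨hab, h.1, fun t ht => ?_⟩⟩
  · rw [derivWithin_chart ((h.2.1 t ht).mdifferentiableWithinAt (by simp))
      (uniqueDiffOn_Icc hab t ht) (hs ht)]
    exact (futureTimelike_iff_chart _ (hs ht) _).1 (h.2.2 t ht)
  · refine (futureTimelike_iff_chart _ (hs ht) (velWithin n c (Icc a b) t)).2 ?_
    have := h.2 t ht
    rwa [derivWithin_chart ((h.1 t ht).mdifferentiableWithinAt (by simp))
      (uniqueDiffOn_Icc hab t ht) (hs ht)] at this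

theorem CausalSegment.contDiffOn_chart {𝔤 : Spacetime n M} {x₀ : M} {c : ℝ → M} {a b : ℝ}
    (h : 𝔤.CausalSegment c a b) (hs : MapsTo c (Icc a b) (φ[x₀]).source) :
    ContDiffOn ℝ 1 (fun r => φ[x₀] (c r)) (Icc a b) :=
  contMDiffOn_chart_comp (by simp) h.2.1 hs

theorem CausalSegment.chartCausal {𝔤 : Spacetime n M} {x₀ : M} {c : ℝ → M} {a b : ℝ}
    (h : 𝔤.CausalSegment c a b) (hs : MapsTo c (Icc a b) (φ[x₀]).source) {t : ℝ}
    (ht : t ∈ Icc a b) :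
    𝔤.ChartCausal x₀ (φ[x₀] (c t)) (derivWithin (fun r => φ[x₀] (c r)) (Icc a b) t) := by
  rw [derivWithin_chart ((h.2.1 t ht).mdifferentiableWithinAt (by simp))
      (uniqueDiffOn_Icc h.1 t ht) (hs ht)]
  exact (futureCausal_iff_chart _ (hs ht) _).1 (h.2.2 t ht)

theorem TimelikeSegment.causalSegment {𝔤 : Spacetime n M} {c : ℝ → M} {a b : ℝ}
    (h : 𝔤.TimelikeSegment c a b) : 𝔤.CausalSegment c a b := by
  refine ⟨h.1, h.2.1, fun t ht => ⟨fun h0 => ?_, (h.2.2 t ht).1.le, (h.2.2 t ht).2⟩⟩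
  have := (h.2.2 t ht).1
  rw [h0] at this
  simp at this

omit [IsManifold 𝓘(ℝ, Model n) ∞ M] in
theorem mfderivWithin_Icc_subinterval {c : ℝ → M} {a b a' b' t : ℝ}
    (hc : ContMDiffOn 𝓘(ℝ, ℝ) 𝓘(ℝ, Model n) 1 c (Icc a b)) (ha : a ≤ a') (hb : b' ≤ b)
    (hab : a' < b') (ht : t ∈ Icc a' b') :
    mfderivWithin 𝓘(ℝ, ℝ) 𝓘(ℝ, Model n) c (Icc a' b') t =
      mfderivWithin 𝓘(ℝ, ℝ) 𝓘(ℝ, Model n) c (Icc a b) t :=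
  mfderivWithin_subset (Icc_subset_Icc ha hb) (uniqueDiffOn_Icc hab t ht).uniqueMDiffWithinAt
    ((hc t (Icc_subset_Icc ha hb ht)).mdifferentiableWithinAt (by simp))

theorem TimelikeSegment.mono {𝔤 : Spacetime n M} {c : ℝ → M} {a b a' b' : ℝ}
    (h : 𝔤.TimelikeSegment c a b) (ha : a ≤ a') (hb : b' ≤ b) (hab : a' < b') :
    𝔤.TimelikeSegment c a' b' := by
  refine ⟨hab, h.2.1.mono (Icc_subset_Icc ha hb), fun t ht => ?_⟩
  rw [mfderivWithin_Icc_subinterval h.2.1 ha hb hab ht]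
  exact h.2.2 t (Icc_subset_Icc ha hb ht)

theorem CausalSegment.mono {𝔤 : Spacetime n M} {c : ℝ → M} {a b a' b' : ℝ}
    (h : 𝔤.CausalSegment c a b) (ha : a ≤ a') (hb : b' ≤ b) (hab : a' < b') :
    𝔤.CausalSegment c a' b' := by
  refine ⟨hab, h.2.1.mono (Icc_subset_Icc ha hb), fun t ht => ?_⟩
  rw [mfderivWithin_Icc_subinterval h.2.1 ha hb hab ht]
  exact h.2.2 t (Icc_subset_Icc ha hb ht)

theorem CausalSegment.congr {𝔤 : Spacetime n M} {c c' : ℝ → M} {a b : ℝ}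
    (h : 𝔤.CausalSegment c a b) (hc : EqOn c' c (Icc a b)) : 𝔤.CausalSegment c' a b := by
  refine ⟨h.1, h.2.1.congr hc, fun t ht => ?_⟩
  have h1 := h.2.2 t ht
  have h2 := mfderivWithin_congr (I := 𝓘(ℝ, ℝ)) (I' := 𝓘(ℝ, Model n)) hc (hc ht)
  -- `form` and `timeVec` take values in types that do not depend on the base point, so the base
  -- point can be rewritten.
  have h3 : 𝔤.form (c' t) = 𝔤.form (c t) := by rw [hc ht]
  have h4 : 𝔤.timeVec (c' t) = 𝔤.timeVec (c t) := by rw [hc ht]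
  rw [FutureCausal, h2]
  change _ ≠ (0 : Model n) ∧ 𝔤.form (c' t) _ _ ≤ 0 ∧ 𝔤.form (c' t) (𝔤.timeVec (c' t)) _ < 0
  rw [h3, h4]
  exact h1

end Spacetime
end

noncomputable section

namespace Spacetime

variable {n : ℕ} {M : Type*} [TopologicalSpace M] [ChartedSpace (Model n) M]
  [IsManifold 𝓘(ℝ, Model n) ∞ M]

local notation "φ[" x₀ "]" => extChartAt (modelWithCornersSelf ℝ (Model n)) x₀

/-! ### Stability of timelike and causal vectors in a chart -/

omit [IsManifold 𝓘(ℝ, Model n) ∞ M] in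
theorem target_mem_nhds {x₀ : M} {y : Model n} (hy : y ∈ (φ[x₀]).target) :
    (φ[x₀]).target ∈ 𝓝 y := (isOpen_extChartAt_target x₀).mem_nhds hy

theorem continuousAt_chartForm (𝔤 : Spacetime n M) {x₀ : M} {y : Model n}
    (hy : y ∈ (φ[x₀]).target) : ContinuousAt (𝔤.chartForm x₀) y :=
  (𝔤.contDiffOn_chartForm x₀).continuousOn.continuousAt (target_mem_nhds hy)

theorem continuousAt_chartTimeVec (𝔤 : Spacetime n M) {x₀ : M} {y : Model n}
    (hy : y ∈ (φ[x₀]).target) : ContinuousAt (𝔤.chartTimeVec x₀) y :=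
  (𝔤.continuousOn_chartTimeVec x₀).continuousAt (target_mem_nhds hy)

theorem ChartTimelike.smul {𝔤 : Spacetime n M} {x₀ : M} {y u : Model n}
    (h : 𝔤.ChartTimelike x₀ y u) {s : ℝ} (hs : 0 < s) : 𝔤.ChartTimelike x₀ y (s • u) := by
  refine ⟨?_, ?_⟩
  · simp only [map_smul, smul_apply, smul_eq_mul]
    have := mul_pos hs hs
    nlinarith [h.1]
  · simp only [map_smul, smul_eq_mul]
    nlinarith [h.2]

theorem ChartTimelike.eventually {𝔤 : Spacetime n M} {x₀ : M} {y u : Model n}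
    (hy : y ∈ (φ[x₀]).target) (h : 𝔤.ChartTimelike x₀ y u) :
    ∀ᶠ z : Model n × Model n in 𝓝 (y, u), 𝔤.ChartTimelike x₀ z.1 z.2 := by
  have h1 : ContinuousAt (fun z : Model n × Model n => 𝔤.chartForm x₀ z.1) (y, u) :=
    (𝔤.continuousAt_chartForm hy).comp (x := (y, u)) (f := Prod.fst) continuousAt_fst
  have h2 : ContinuousAt (fun z : Model n × Model n => 𝔤.chartTimeVec x₀ z.1) (y, u) :=
    (𝔤.continuousAt_chartTimeVec hy).comp (x := (y, u)) (f := Prod.fst) continuousAt_fst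
  have h3 : ContinuousAt (fun z : Model n × Model n => z.2) (y, u) := continuousAt_snd
  exact (((h1.clm_apply h3).clm_apply h3).eventually_lt_const h.1).and
    (((h1.clm_apply h2).clm_apply h3).eventually_lt_const h.2)

theorem chartTimelike_chartTimeVec (𝔤 : Spacetime n M) {x₀ : M} {y : Model n}
    (hy : y ∈ (φ[x₀]).target) : 𝔤.ChartTimelike x₀ y (𝔤.chartTimeVec x₀ y) :=
  ⟨𝔤.chartForm_chartTimeVec x₀ hy, 𝔤.chartForm_chartTimeVec x₀ hy⟩

/-- Future causal vectors near `y₀` have a uniformly negative product with the time orientation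
at `y₀`. -/
theorem exists_causal_bound (𝔤 : Spacetime n M) {x₀ : M} {y₀ : Model n}
    (hy₀ : y₀ ∈ (φ[x₀]).target) : ∃ κ > 0, ∀ᶠ z : Model n × Model n in 𝓝 (y₀, y₀),
      ∀ u, 𝔤.ChartCausal x₀ z.1 u →
        𝔤.chartForm x₀ z.2 (𝔤.chartTimeVec x₀ y₀) u ≤ -(κ * ‖u‖) := by
  set e := 𝔤.chartTimeVec x₀ y₀
  -- Positivity of `F z u` says that `u` is spacelike at `z.1`, or not future-directed there, or has
  -- negative product with `e` at `z.2`. For nonzero `u` at the centre one of these always holds; a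
  -- causal `u` excludes the first two, so a positive lower bound on the unit sphere falls on the
  -- third.
  let F : (Model n × Model n) → Model n → ℝ := fun z u =>
    max (𝔤.chartForm x₀ z.1 u u) (max (𝔤.chartForm x₀ z.1 (𝔤.chartTimeVec x₀ z.1) u)
      (-(𝔤.chartForm x₀ z.2 e u)))
  have hF : ∀ u, ContinuousAt (fun q : (Model n × Model n) × Model n => F q.1 q.2)
      ((y₀, y₀), u) := by
    intro u
    have a1 : ContinuousAt (fun q : (Model n × Model n) × Model n => 𝔤.chartForm x₀ q.1.1)
        ((y₀, y₀), u) := (𝔤.continuousAt_chartForm hy₀).comp (x := ((y₀, y₀), u))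
        (f := fun q : (Model n × Model n) × Model n => q.1.1) (by fun_prop)
    have a2 : ContinuousAt (fun q : (Model n × Model n) × Model n => 𝔤.chartForm x₀ q.1.2)
        ((y₀, y₀), u) := (𝔤.continuousAt_chartForm hy₀).comp (x := ((y₀, y₀), u))
        (f := fun q : (Model n × Model n) × Model n => q.1.2) (by fun_prop)
    have a3 : ContinuousAt (fun q : (Model n × Model n) × Model n => 𝔤.chartTimeVec x₀ q.1.1)
        ((y₀, y₀), u) := (𝔤.continuousAt_chartTimeVec hy₀).comp (x := ((y₀, y₀), u))
        (f := fun q : (Model n × Model n) × Model n => q.1.1) (by fun_prop)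
    have a4 : ContinuousAt (fun q : (Model n × Model n) × Model n => q.2) ((y₀, y₀), u) :=
      continuousAt_snd
    exact ((a1.clm_apply a4).clm_apply a4).max (((a1.clm_apply a3).clm_apply a4).max
      ((a2.clm_apply continuousAt_const).clm_apply a4).neg)
  have hB := 𝔤.isLorentzForm_chartForm x₀ hy₀
  have hpos : ∀ u ∈ Metric.sphere (0 : Model n) 1, 0 < F (y₀, y₀) u := by
    intro u hu
    have hu0 : u ≠ 0 := by
      rintro rfl
      simp at hu
    by_cases h : 0 < 𝔤.chartForm x₀ y₀ u u
    · exact lt_max_of_lt_left h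
    · have := hB.apply_ne_zero (𝔤.chartForm_chartTimeVec x₀ hy₀) hu0 (not_lt.1 h)
      rcases lt_or_gt_of_ne this with h' | h'
      · exact lt_max_of_lt_right (lt_max_of_lt_right (by simpa using h'))
      · exact lt_max_of_lt_right (lt_max_of_lt_left h')
  have hK := isCompact_sphere (0 : Model n) 1
  obtain ⟨κ, hκ, hκF⟩ : ∃ κ > 0, ∀ u ∈ Metric.sphere (0 : Model n) 1, κ < F (y₀, y₀) u := by
    have hcont : ContinuousOn (F (y₀, y₀)) (Metric.sphere (0 : Model n) 1) := fun u _ =>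
      ((hF u).comp (x := u) (f := fun u => ((y₀, y₀), u)) (by fun_prop)).continuousWithinAt
    rcases (Metric.sphere (0 : Model n) 1).eq_empty_or_nonempty with h | h
    · exact ⟨1, one_pos, by simp [h]⟩
    · obtain ⟨u, hu, hmin⟩ := hK.exists_isMinOn h hcont
      exact ⟨F (y₀, y₀) u / 2, half_pos (hpos u hu), fun v hv =>
        (half_lt_self (hpos u hu)).trans_le (hmin hv)⟩
  refine ⟨κ, hκ, ?_⟩
  -- Compactness of the sphere keeps the bound uniform in the direction; homogeneity then extends it
  -- to all vectors.
  have := hK.eventually_forall_of_forall_eventually (x₀ := (y₀, y₀))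
    (P := fun z u => κ < F z u) fun u hu => (hF u).eventually_const_lt (hκF u hu)
  filter_upwards [this] with z hz u hu
  have hu0 : 0 < ‖u‖ := norm_pos_iff.2 hu.1
  have h1 := hz (‖u‖⁻¹ • u) (by simp [norm_smul, hu0.ne'])
  have hi : 0 < ‖u‖⁻¹ := inv_pos.2 hu0
  rcases lt_max_iff.1 h1 with h | h
  · simp only [map_smul, smul_apply, smul_eq_mul] at h
    have := mul_pos hi hi
    nlinarith [hu.2.1]
  rcases lt_max_iff.1 h with h | h
  · simp only [map_smul, smul_eq_mul] at h
    nlinarith [hu.2.2]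
  · simp only [map_smul, smul_eq_mul] at h
    have h2 : ‖u‖⁻¹ * ‖u‖ = 1 := inv_mul_cancel₀ hu0.ne'
    nlinarith

/-- A future causal vector at `y` becomes timelike at a nearby point `z` when a sufficiently large
multiple of the time orientation is added. -/
theorem exists_chartTimelike_add (𝔤 : Spacetime n M) {x₀ : M} {y₀ : Model n}
    (hy₀ : y₀ ∈ (φ[x₀]).target) : ∃ K > 0, ∃ δ > 0, Metric.ball y₀ δ ⊆ (φ[x₀]).target ∧
      ∀ y ∈ Metric.ball y₀ δ, ∀ z ∈ Metric.ball y₀ δ, ∀ u, 𝔤.ChartCausal x₀ y u →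
        ∀ r > 0, K * ‖z - y‖ * ‖u‖ ≤ r →
          𝔤.ChartTimelike x₀ z (u + r • 𝔤.chartTimeVec x₀ y₀) := by
  obtain ⟨κ, hκ, hκe⟩ := 𝔤.exists_causal_bound hy₀
  set e := 𝔤.chartTimeVec x₀ y₀
  have hC1 : ContDiffAt ℝ 1 (𝔤.chartForm x₀) y₀ :=
    ((𝔤.contDiffOn_chartForm x₀).contDiffAt (target_mem_nhds hy₀)).of_le (by simp)
  obtain ⟨C, s, hs, hLip⟩ := hC1.exists_lipschitzOnWith
  have he := (𝔤.chartTimelike_chartTimeVec hy₀).eventually hy₀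
  have he' : ∀ᶠ z in 𝓝 y₀, 𝔤.ChartTimelike x₀ z e :=
    (Continuous.tendsto (f := fun z : Model n => (z, e)) (by fun_prop) y₀).eventually he
  rw [nhds_prod_eq] at hκe
  obtain ⟨p, hp, q, hq, hpq⟩ := Filter.eventually_prod_iff.1 hκe
  obtain ⟨δ, hδ, hball⟩ := Metric.eventually_nhds_iff_ball.1
    (hp.and (hq.and (he'.and ((eventually_mem_set.2 (target_mem_nhds hy₀)).and
      (eventually_mem_set.2 hs)))))
  -- In the square of `u + r • e` at `z`, the term of `u` is at most `C ‖z - y‖ ‖u‖²` by the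
  -- Lipschitz bound, and the cross term is at most `-2 r κ ‖u‖`. The latter wins for `r ≥ K ‖z - y‖
  -- ‖u‖`; the summand `1` keeps `K` positive.
  refine ⟨(C + 1) / (2 * κ), by positivity, δ, hδ, fun y hy => (hball y hy).2.2.2.1, ?_⟩
  intro y hy z hz u hu r hr hKr
  obtain ⟨hpy, -, -, -, hys⟩ := hball y hy
  obtain ⟨-, hqz, hez, hzt, hzs⟩ := hball z hz
  have h1 := hpq hpy hqz u hu
  simp only at h1
  have hB := 𝔤.isLorentzForm_chartForm x₀ hzt
  have hlip : 𝔤.chartForm x₀ z u u ≤ C * ‖z - y‖ * ‖u‖ * ‖u‖ := by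
    have h2 : ‖𝔤.chartForm x₀ z - 𝔤.chartForm x₀ y‖ ≤ C * ‖z - y‖ := hLip.norm_sub_le hzs hys
    have h3 : (𝔤.chartForm x₀ z - 𝔤.chartForm x₀ y) u u ≤
        ‖𝔤.chartForm x₀ z - 𝔤.chartForm x₀ y‖ * ‖u‖ * ‖u‖ :=
      (Real.le_norm_self _).trans
        (ContinuousLinearMap.le_opNorm₂ (𝔤.chartForm x₀ z - 𝔤.chartForm x₀ y) u u)
    have h4 : ‖𝔤.chartForm x₀ z - 𝔤.chartForm x₀ y‖ * ‖u‖ * ‖u‖ ≤ C * ‖z - y‖ * ‖u‖ * ‖u‖ := by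
      gcongr
    simp only [sub_apply] at h3
    linarith [hu.2.1]
  have hu0 : 0 < ‖u‖ := norm_pos_iff.2 hu.1
  have h5 : (C + 1) * ‖z - y‖ * ‖u‖ ≤ 2 * κ * r := by
    have := mul_le_mul_of_nonneg_left hKr (by positivity : (0:ℝ) ≤ 2 * κ)
    have h6 : 2 * κ * ((C + 1) / (2 * κ) * ‖z - y‖ * ‖u‖) = (C + 1) * ‖z - y‖ * ‖u‖ := by
      field_simp
    linarith
  have hee := hez.1
  have hsum : 𝔤.chartForm x₀ z (u + r • e) (u + r • e) < 0 := by
    have hexp : 𝔤.chartForm x₀ z (u + r • e) (u + r • e) = 𝔤.chartForm x₀ z u u +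
        2 * r * 𝔤.chartForm x₀ z e u + r * r * 𝔤.chartForm x₀ z e e := by
      simp only [map_add, map_smul, add_apply, smul_apply, smul_eq_mul]
      rw [hB.symm u e]; ring
    rw [hexp]
    have h7 : r * r * 𝔤.chartForm x₀ z e e < 0 := mul_neg_of_pos_of_neg (mul_pos hr hr) hee
    have h8 : 2 * r * 𝔤.chartForm x₀ z e u ≤ 2 * r * -(κ * ‖u‖) :=
      mul_le_mul_of_nonneg_left h1 (by positivity)
    have h9 := mul_le_mul_of_nonneg_right h5 hu0.le
    have h10 : 0 ≤ ‖z - y‖ * ‖u‖ * ‖u‖ := by positivity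
    nlinarith
  have hew : 𝔤.chartForm x₀ z e (u + r • e) < 0 := by
    simp only [map_add, map_smul, smul_eq_mul]
    have := mul_neg_of_pos_of_neg hr hee
    nlinarith [mul_pos hκ hu0]
  refine ⟨hsum, ?_⟩
  -- Future-directedness was tested against `e`, the time orientation at the centre. It passes to
  -- the time orientation at `z` because both are timelike and in the same cone.
  refine hB.apply_neg_of_timelike (T := e) hee (𝔤.chartForm_chartTimeVec x₀ hzt).le hsum ?_ hew
  rw [hB.symm]
  exact hez.2

/-! ### The chronology relation near a point -/

theorem TimelikeSegment.chron {𝔤 : Spacetime n M} {c : ℝ → M} {a b : ℝ}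
    (h : 𝔤.TimelikeSegment c a b) : 𝔤.Chron (c a) (c b) :=
  Relation.TransGen.single ⟨c, a, b, h, rfl, rfl⟩

theorem CausalSegment.causalLE {𝔤 : Spacetime n M} {c : ℝ → M} {a b : ℝ}
    (h : 𝔤.CausalSegment c a b) : 𝔤.CausalLE (c a) (c b) :=
  Relation.ReflTransGen.single ⟨c, a, b, h, rfl, rfl⟩

theorem timelikeSegment_of_chart (𝔤 : Spacetime n M) {x₀ : M} {x x' : ℝ → Model n} {a b : ℝ}
    (hab : a < b) (hx : ContDiffOn ℝ 1 x (Icc a b)) (ht : MapsTo x (Icc a b) (φ[x₀]).target)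
    (hx' : ∀ t ∈ Icc a b, HasDerivWithinAt x (x' t) (Icc a b) t)
    (h : ∀ t ∈ Icc a b, 𝔤.ChartTimelike x₀ (x t) (x' t)) :
    𝔤.TimelikeSegment (fun t => (φ[x₀]).symm (x t)) a b := by
  have heq : EqOn (fun t => φ[x₀] ((φ[x₀]).symm (x t))) x (Icc a b) := fun t h =>
    (φ[x₀]).right_inv (ht h)
  rw [timelikeSegment_iff_chart _ (x₀ := x₀) hab fun t h => (φ[x₀]).map_target (ht h)]
  refine ⟨hx.congr heq, fun t htt => ?_⟩
  rw [derivWithin_congr heq (heq htt), (hx' t htt).derivWithin (uniqueDiffOn_Icc hab t htt)]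
  simp only [(φ[x₀]).right_inv (ht htt)]
  exact h t htt

/-- Near `p`, chart segments whose direction is close to a given timelike vector are timelike. -/
theorem exists_ball_timelike (𝔤 : Spacetime n M) {x₀ : M} {y₀ v : Model n}
    (hy₀ : y₀ ∈ (φ[x₀]).target) (hv : 𝔤.ChartTimelike x₀ y₀ v) {U : Set M}
    (hU : U ∈ 𝓝 ((φ[x₀]).symm y₀)) :
    ∃ δ > 0, (∀ y ∈ Metric.ball y₀ δ, y ∈ (φ[x₀]).target ∧ (φ[x₀]).symm y ∈ U) ∧
      ∀ y ∈ Metric.ball y₀ δ, ∀ y' ∈ Metric.ball y₀ δ, ∀ s > (0 : ℝ), ∀ w ∈ Metric.ball v δ,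
        y' = y + s • w → ∃ c : ℝ → M, 𝔤.TimelikeSegment c 0 1 ∧ c 0 = (φ[x₀]).symm y ∧
          c 1 = (φ[x₀]).symm y' ∧ ∀ t ∈ Icc (0 : ℝ) 1, c t ∈ U := by
  have hcont : ContinuousAt (φ[x₀]).symm y₀ :=
    (continuousOn_extChartAt_symm x₀).continuousAt (target_mem_nhds hy₀)
  have h1 := hv.eventually hy₀
  rw [nhds_prod_eq] at h1
  obtain ⟨p, hp, q, hq, hpq⟩ := Filter.eventually_prod_iff.1 h1
  obtain ⟨δ₁, hδ₁, hball₁⟩ := Metric.eventually_nhds_iff_ball.1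
    (hp.and ((eventually_mem_set.2 (target_mem_nhds hy₀)).and
      (hcont.eventually_mem hU)))
  obtain ⟨δ₂, hδ₂, hball₂⟩ := Metric.eventually_nhds_iff_ball.1 hq
  refine ⟨min δ₁ δ₂, lt_min hδ₁ hδ₂, fun y hy => ?_, ?_⟩
  · exact (hball₁ y (Metric.ball_subset_ball (min_le_left _ _) hy)).2
  intro y hy y' hy' s hs w hw hyy
  have hmem : ∀ t ∈ Icc (0 : ℝ) 1, y + t • (s • w) ∈ Metric.ball y₀ δ₁ := by
    intro t ht
    have := (convex_ball y₀ (min δ₁ δ₂)).add_smul_sub_mem hy hy' ht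
    rw [hyy, add_sub_cancel_left] at this
    exact Metric.ball_subset_ball (min_le_left _ _) this
  refine ⟨fun t => (φ[x₀]).symm (y + t • (s • w)), ?_, by simp, by simp [hyy], fun t ht =>
    (hball₁ _ (hmem t ht)).2.2⟩
  refine 𝔤.timelikeSegment_of_chart zero_lt_one (by fun_prop)
    (fun t ht => (hball₁ _ (hmem t ht)).2.1) (x' := fun _ => s • w) (fun t _ => ?_) fun t ht => ?_
  · have := ((hasDerivAt_id t).smul_const (s • w)).const_add y
    simpa using this.hasDerivWithinAt
  · exact (hpq (hball₁ _ (hmem t ht)).1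
      (hball₂ w (Metric.ball_subset_ball (min_le_right _ _) hw))).smul hs

omit [IsManifold 𝓘(ℝ, Model n) ∞ M] in
theorem chart_preimage_mem_nhds {x₀ x : M} (hx : x ∈ (φ[x₀]).source) {N : Set (Model n)}
    (hN : N ∈ 𝓝 (φ[x₀] x)) : {z | z ∈ (φ[x₀]).source ∧ φ[x₀] z ∈ N} ∈ 𝓝 x :=
  inter_mem ((isOpen_extChartAt_source x₀).mem_nhds hx)
    (((continuousOn_extChartAt x₀).continuousAt
      ((isOpen_extChartAt_source x₀).mem_nhds hx)).preimage_mem_nhds hN)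

/-- Every neighbourhood of `p` contains points `p⁻ ≪ p ≪ p⁺` such that all points near `p` are
joined to them by timelike curves in that neighbourhood. -/
theorem exists_diamond (𝔤 : Spacetime n M) (p : M) {U : Set M} (hU : U ∈ 𝓝 p) :
    ∃ p₁ p₂ : M, ∃ V ∈ 𝓝 p, ∀ z ∈ V,
      (∃ c : ℝ → M, 𝔤.TimelikeSegment c 0 1 ∧ c 0 = p₁ ∧ c 1 = z ∧ ∀ t ∈ Icc (0 : ℝ) 1, c t ∈ U) ∧
      (∃ c : ℝ → M, 𝔤.TimelikeSegment c 0 1 ∧ c 0 = z ∧ c 1 = p₂ ∧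
        ∀ t ∈ Icc (0 : ℝ) 1, c t ∈ U) := by
  have hps := mem_extChartAt_source (I := 𝓘(ℝ, Model n)) p
  have hpt := mem_extChartAt_target (I := 𝓘(ℝ, Model n)) p
  set y₀ := φ[p] p with hy₀
  have hU' : U ∈ 𝓝 ((φ[p]).symm y₀) := by rwa [hy₀, (φ[p]).left_inv hps]
  obtain ⟨δ, hδ, hball, hseg⟩ :=
    𝔤.exists_ball_timelike hpt (𝔤.chartTimelike_chartTimeVec hpt) hU'
  set v := 𝔤.chartTimeVec p y₀
  obtain ⟨ε, hε, hεv⟩ : ∃ ε > 0, ε * ‖v‖ < δ := by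
    refine ⟨δ / (‖v‖ + 1), by positivity, ?_⟩
    rw [div_mul_eq_mul_div, div_lt_iff₀ (by positivity)]
    nlinarith [norm_nonneg v]
  have hv1 : y₀ - ε • v ∈ Metric.ball y₀ δ := by
    simp [norm_smul, abs_of_pos hε, hεv]
  have hv2 : y₀ + ε • v ∈ Metric.ball y₀ δ := by
    simp [norm_smul, abs_of_pos hε, hεv]
  -- With radius `ε * δ`, the chord between `y₀ ∓ ε • v` and a nearby point is `ε` times a direction
  -- within `δ` of `v`.
  refine ⟨(φ[p]).symm (y₀ - ε • v), (φ[p]).symm (y₀ + ε • v), _,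
    chart_preimage_mem_nhds hps (Metric.ball_mem_nhds y₀ (lt_min hδ (mul_pos hε hδ))),
    fun z hz => ?_⟩
  obtain ⟨hzs, hzb⟩ := hz
  have hz1 := Metric.ball_subset_ball (min_le_left _ _) hzb
  have hz2 := Metric.ball_subset_ball (min_le_right _ _) hzb
  rw [mem_ball_iff_norm] at hz2
  have hsmall : ∀ w : Model n, ‖w‖ < ε * δ → ‖ε⁻¹ • w‖ < δ := by
    intro w hw
    rw [norm_smul, norm_inv, Real.norm_of_nonneg hε.le, inv_mul_lt_iff₀ hε]
    exact hw
  constructor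
  · obtain ⟨c, h1, h2, h3, h4⟩ := hseg _ hv1 _ hz1 ε hε (v + ε⁻¹ • (φ[p] z - y₀))
      (by rw [mem_ball_iff_norm, add_sub_cancel_left]; exact hsmall _ hz2)
      (by rw [smul_add, smul_smul, mul_inv_cancel₀ hε.ne', one_smul]; abel)
    exact ⟨c, h1, h2, by rw [h3, (φ[p]).left_inv hzs], h4⟩
  · obtain ⟨c, h1, h2, h3, h4⟩ := hseg _ hz1 _ hv2 ε hε (v + ε⁻¹ • (y₀ - φ[p] z))
      (by rw [mem_ball_iff_norm, add_sub_cancel_left]; exact hsmall _ (by rwa [norm_sub_rev]))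
      (by rw [smul_add, smul_smul, mul_inv_cancel₀ hε.ne', one_smul]; abel)
    exact ⟨c, h1, by rw [h2, (φ[p]).left_inv hzs], h3, h4⟩

end Spacetime
end

noncomputable section

namespace Spacetime

variable {n : ℕ} {M : Type*} [TopologicalSpace M] [ChartedSpace (Model n) M]
  [IsManifold 𝓘(ℝ, Model n) ∞ M]

local notation "φ[" x₀ "]" => extChartAt (modelWithCornersSelf ℝ (Model n)) x₀

/-! ### Openness of the chronology relation -/

/-- The beginning of the curve is replaced by a straight chart segment. A difference quotient at `a`
is within `δ / 2` of the velocity, and moving the initial point by less than `(t - a) * (δ / 2)`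
changes the quotient by less than `δ / 2`. -/
theorem TimelikeSegment.eventually_chron_right {𝔤 : Spacetime n M} {c : ℝ → M} {a b : ℝ}
    (h : 𝔤.TimelikeSegment c a b) : ∀ᶠ p in 𝓝 (c a), 𝔤.Chron p (c b) := by
  have hps := mem_extChartAt_source (I := 𝓘(ℝ, Model n)) (c a)
  have hpt := mem_extChartAt_target (I := 𝓘(ℝ, Model n)) (c a)
  set x : ℝ → Model n := fun t => φ[c a] (c t) with hx
  have ha : a ∈ Icc a b := ⟨le_rfl, h.1.le⟩
  have hcca : ContinuousWithinAt c (Icc a b) a := h.2.1.continuousOn a ha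
  have hd := derivWithin_chart (x₀ := c a)
    ((h.2.1 a ha).mdifferentiableWithinAt (by simp)) (uniqueDiffOn_Icc h.1 a ha) hps
  have hv := (𝔤.futureTimelike_iff_chart hps _).1 (h.2.2 a ha)
  change 𝔤.ChartTimelike _ _ (chartDeriv n (c a) (c a) (velWithin n c (Icc a b) a)) at hv
  rw [← hd] at hv
  set v := derivWithin x (Icc a b) a with hvdef
  obtain ⟨δ, hδ, hball, hseg⟩ := 𝔤.exists_ball_timelike hpt hv (U := univ) univ_mem
  have hxd : HasDerivWithinAt x v (Icc a b) a := by
    refine DifferentiableWithinAt.hasDerivWithinAt ?_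
    have : IsManifold 𝓘(ℝ, Model n) 1 M := IsManifold.of_le (n := ∞) (by simp)
    have hφ : MDifferentiableAt 𝓘(ℝ, Model n) 𝓘(ℝ, Model n) (φ[c a]) (c a) :=
      mdifferentiableAt_extChartAt (by simp)
    exact (hφ.comp_mdifferentiableWithinAt a
      ((h.2.1 a ha).mdifferentiableWithinAt (by simp))).differentiableWithinAt
  have hslope := hasDerivWithinAt_iff_tendsto_slope.1 hxd
  have hnb : (𝓝[Icc a b \ {a}] a).NeBot := by
    rw [Icc_sdiff_left]
    exact left_nhdsWithin_Ioc_neBot h.1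
  have e1 := hslope.eventually_mem (Metric.ball_mem_nhds v (half_pos hδ))
  have e2 : ∀ᶠ t in 𝓝[Icc a b \ {a}] a, x t ∈ Metric.ball (x a) δ :=
    (hxd.continuousWithinAt.mono sdiff_subset).eventually_mem (Metric.ball_mem_nhds _ hδ)
  have e2' : ∀ᶠ t in 𝓝[Icc a b \ {a}] a, c t ∈ (φ[c a]).source :=
    (hcca.mono sdiff_subset).eventually_mem (extChartAt_source_mem_nhds (c a))
  have e3 : ∀ᶠ t in 𝓝[Icc a b \ {a}] a, t ∈ Icc a b \ {a} := self_mem_nhdsWithin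
  obtain ⟨t, ht1, ht2, ht2', ht3⟩ := (e1.and (e2.and (e2'.and e3))).exists
  have hat : a < t := lt_of_le_of_ne ht3.1.1 (Ne.symm ht3.2)
  have hta : 0 < t - a := sub_pos.2 hat
  filter_upwards [chart_preimage_mem_nhds hps
    (Metric.ball_mem_nhds (x a) (lt_min hδ (mul_pos hta (half_pos hδ))))] with p hp
  have hp1 := Metric.ball_subset_ball (min_le_left _ _) hp.2
  have hp2 := Metric.ball_subset_ball (min_le_right _ _) hp.2
  rw [mem_ball_iff_norm] at hp2 ht1
  obtain ⟨c', h1, h2, h3, -⟩ := hseg _ hp1 _ ht2 (t - a) hta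
    (slope x a t + (t - a)⁻¹ • (x a - φ[c a] p)) (by
      rw [mem_ball_iff_norm]
      have h5 : ‖(t - a)⁻¹ • (x a - φ[c a] p)‖ < δ / 2 := by
        rw [norm_smul, norm_inv, Real.norm_of_nonneg hta.le, inv_mul_lt_iff₀ hta, norm_sub_rev]
        exact hp2
      calc _ = ‖(slope x a t - v) + (t - a)⁻¹ • (x a - φ[c a] p)‖ := by congr 1; abel
        _ ≤ ‖slope x a t - v‖ + ‖(t - a)⁻¹ • (x a - φ[c a] p)‖ := norm_add_le _ _
        _ < δ := by linarith) (by
      rw [smul_add, smul_smul, mul_inv_cancel₀ hta.ne', one_smul, sub_smul_slope, vsub_eq_sub]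
      abel)
  have hpc : 𝔤.Chron p (c t) := by
    have := h1.chron
    rwa [h2, h3, (φ[c a]).left_inv hp.1, (φ[c a]).left_inv ht2'] at this
  rcases eq_or_lt_of_le ht3.1.2 with htb | htb
  · rwa [← htb]
  · exact hpc.trans (h.mono ht3.1.1 le_rfl htb).chron

/-- Mirror image of the argument at the initial endpoint, with difference quotients at `b` taken
from the left. -/
theorem TimelikeSegment.eventually_chron_left {𝔤 : Spacetime n M} {c : ℝ → M} {a b : ℝ}
    (h : 𝔤.TimelikeSegment c a b) : ∀ᶠ p in 𝓝 (c b), 𝔤.Chron (c a) p := by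
  have hps := mem_extChartAt_source (I := 𝓘(ℝ, Model n)) (c b)
  have hpt := mem_extChartAt_target (I := 𝓘(ℝ, Model n)) (c b)
  set x : ℝ → Model n := fun t => φ[c b] (c t) with hx
  have ha : b ∈ Icc a b := ⟨h.1.le, le_rfl⟩
  have hcca : ContinuousWithinAt c (Icc a b) b := h.2.1.continuousOn b ha
  have hd := derivWithin_chart (x₀ := c b)
    ((h.2.1 b ha).mdifferentiableWithinAt (by simp)) (uniqueDiffOn_Icc h.1 b ha) hps
  have hv := (𝔤.futureTimelike_iff_chart hps _).1 (h.2.2 b ha)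
  change 𝔤.ChartTimelike _ _ (chartDeriv n (c b) (c b) (velWithin n c (Icc a b) b)) at hv
  rw [← hd] at hv
  set v := derivWithin x (Icc a b) b with hvdef
  obtain ⟨δ, hδ, hball, hseg⟩ := 𝔤.exists_ball_timelike hpt hv (U := univ) univ_mem
  have hxd : HasDerivWithinAt x v (Icc a b) b := by
    refine DifferentiableWithinAt.hasDerivWithinAt ?_
    have : IsManifold 𝓘(ℝ, Model n) 1 M := IsManifold.of_le (n := ∞) (by simp)
    have hφ : MDifferentiableAt 𝓘(ℝ, Model n) 𝓘(ℝ, Model n) (φ[c b]) (c b) :=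
      mdifferentiableAt_extChartAt (by simp)
    exact (hφ.comp_mdifferentiableWithinAt b
      ((h.2.1 b ha).mdifferentiableWithinAt (by simp))).differentiableWithinAt
  have hslope := hasDerivWithinAt_iff_tendsto_slope.1 hxd
  have hnb : (𝓝[Icc a b \ {b}] b).NeBot := by
    rw [Icc_sdiff_right]
    exact right_nhdsWithin_Ico_neBot h.1
  have e1 := hslope.eventually_mem (Metric.ball_mem_nhds v (half_pos hδ))
  have e2 : ∀ᶠ t in 𝓝[Icc a b \ {b}] b, x t ∈ Metric.ball (x b) δ :=
    (hxd.continuousWithinAt.mono sdiff_subset).eventually_mem (Metric.ball_mem_nhds _ hδ)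
  have e2' : ∀ᶠ t in 𝓝[Icc a b \ {b}] b, c t ∈ (φ[c b]).source :=
    (hcca.mono sdiff_subset).eventually_mem (extChartAt_source_mem_nhds (c b))
  have e3 : ∀ᶠ t in 𝓝[Icc a b \ {b}] b, t ∈ Icc a b \ {b} := self_mem_nhdsWithin
  obtain ⟨t, ht1, ht2, ht2', ht3⟩ := (e1.and (e2.and (e2'.and e3))).exists
  have hat : t < b := lt_of_le_of_ne ht3.1.2 ht3.2
  have hta : 0 < b - t := sub_pos.2 hat
  filter_upwards [chart_preimage_mem_nhds hps
    (Metric.ball_mem_nhds (x b) (lt_min hδ (mul_pos hta (half_pos hδ))))] with p hp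
  have hp1 := Metric.ball_subset_ball (min_le_left _ _) hp.2
  have hp2 := Metric.ball_subset_ball (min_le_right _ _) hp.2
  rw [mem_ball_iff_norm] at hp2 ht1
  obtain ⟨c', h1, h2, h3, -⟩ := hseg _ ht2 _ hp1 (b - t) hta
    (slope x b t + (b - t)⁻¹ • (φ[c b] p - x b)) (by
      rw [mem_ball_iff_norm]
      have h5 : ‖(b - t)⁻¹ • (φ[c b] p - x b)‖ < δ / 2 := by
        rw [norm_smul, norm_inv, Real.norm_of_nonneg hta.le, inv_mul_lt_iff₀ hta]
        exact hp2
      calc _ = ‖(slope x b t - v) + (b - t)⁻¹ • (φ[c b] p - x b)‖ := by congr 1; abel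
        _ ≤ ‖slope x b t - v‖ + ‖(b - t)⁻¹ • (φ[c b] p - x b)‖ := norm_add_le _ _
        _ < δ := by linarith) (by
      rw [smul_add, smul_smul, mul_inv_cancel₀ hta.ne', one_smul, slope_comm, sub_smul_slope,
        vsub_eq_sub]
      abel)
  have hpc : 𝔤.Chron (c t) p := by
    have := h1.chron
    rwa [h2, h3, (φ[c b]).left_inv hp.1, (φ[c b]).left_inv ht2'] at this
  rcases eq_or_lt_of_le ht3.1.1 with htb | htb
  · rwa [htb]
  · exact (h.mono le_rfl ht3.1.2 htb).chron.trans hpc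

theorem Chron.eventually_left {𝔤 : Spacetime n M} {p q : M} (h : 𝔤.Chron p q) :
    ∀ᶠ p' in 𝓝 p, 𝔤.Chron p' q := by
  rcases Relation.TransGen.head'_iff.1 h with ⟨r, ⟨c, a, b, hc, rfl, rfl⟩, hr⟩
  filter_upwards [hc.eventually_chron_right] with p' hp'
  exact Relation.TransGen.trans_left hp' hr

theorem Chron.eventually_right {𝔤 : Spacetime n M} {p q : M} (h : 𝔤.Chron p q) :
    ∀ᶠ q' in 𝓝 q, 𝔤.Chron p q' := by
  rcases Relation.TransGen.tail'_iff.1 h with ⟨r, hr, ⟨c, a, b, hc, rfl, rfl⟩⟩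
  filter_upwards [hc.eventually_chron_left] with p' hp'
  exact Relation.TransGen.trans_right hr hp'

theorem isOpen_chronPast (𝔤 : Spacetime n M) (S : Set M) : IsOpen (𝔤.chronPast S) := by
  refine isOpen_iff_mem_nhds.2 fun p ⟨s, hs, hps⟩ => ?_
  filter_upwards [hps.eventually_left] with p' hlt
  exact ⟨s, hs, hlt⟩

/-! ### The push-up lemmas -/

/-- Short causal curves can be deformed into timelike ones, fixing either endpoint. -/
theorem exists_nhds_push_up (𝔤 : Spacetime n M) (p : M) : ∃ W : Set M, IsOpen W ∧ p ∈ W ∧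
    ∀ (c : ℝ → M) (a b : ℝ), 𝔤.CausalSegment c a b → MapsTo c (Icc a b) W →
      (∀ N ∈ 𝓝 (c b), ∃ q ∈ N, 𝔤.Chron (c a) q) ∧ (∀ N ∈ 𝓝 (c a), ∃ q ∈ N, 𝔤.Chron q (c b)) := by
  have hps := mem_extChartAt_source (I := 𝓘(ℝ, Model n)) p
  have hpt := mem_extChartAt_target (I := 𝓘(ℝ, Model n)) p
  obtain ⟨K, hK, δ, hδ, hball, hadd⟩ := 𝔤.exists_chartTimelike_add hpt
  set e := 𝔤.chartTimeVec p (φ[p] p)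
  refine ⟨(φ[p]).source ∩ φ[p] ⁻¹' Metric.ball (φ[p] p) δ,
    (continuousOn_extChartAt p).isOpen_inter_preimage (isOpen_extChartAt_source p)
      Metric.isOpen_ball, ⟨hps, Metric.mem_ball_self hδ⟩, ?_⟩
  intro c a b hc hcW
  have hcs : MapsTo c (Icc a b) (φ[p]).source := fun t ht => (hcW ht).1
  set x : ℝ → Model n := fun t => φ[p] (c t) with hx
  have hxb : ∀ t ∈ Icc a b, x t ∈ Metric.ball (φ[p] p) δ := fun t ht => (hcW ht).2
  have hx1 : ContDiffOn ℝ 1 x (Icc a b) := hc.contDiffOn_chart hcs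
  have hxd : ∀ t ∈ Icc a b, HasDerivWithinAt x (derivWithin x (Icc a b) t) (Icc a b) t :=
    fun t ht => (hx1.differentiableOn (by simp) t ht).hasDerivWithinAt
  obtain ⟨L, hL⟩ := isCompact_Icc.exists_bound_of_continuousOn
    (hx1.continuousOn_derivWithin (uniqueDiffOn_Icc hc.1) (by simp))
  have hL0 : 0 ≤ L := (norm_nonneg _).trans (hL a ⟨le_rfl, hc.1.le⟩)
  obtain ⟨η, hη, hηball⟩ := (isCompact_Icc.image_of_continuousOn
    hx1.continuousOn).exists_thickening_subset_open Metric.isOpen_ball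
      (image_subset_iff.2 hxb)
  -- Displacing the curve by `f t • e` requires the added velocity `f' t • e` to satisfy `f' ≥ K ‖e‖
  -- L |f|`, where `L` bounds the speed. The inequality `f' ≥ K' |f|` guarantees this and is solved
  -- by exponentials.
  set K' := K * ‖e‖ * L + 1 with hK'
  have hK'0 : 0 < K' := by positivity
  have key : ∀ f f' : ℝ → ℝ, ContDiff ℝ 1 f → (∀ t, HasDerivAt f (f' t) t) →
      (∀ t ∈ Icc a b, 0 < f' t) → (∀ t ∈ Icc a b, K' * |f t| ≤ f' t) →
      (∀ t ∈ Icc a b, |f t| * ‖e‖ < η) →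
      𝔤.TimelikeSegment (fun t => (φ[p]).symm (x t + f t • e)) a b := by
    intro f f' hf hf' hpos hge hsmall
    have hmem : ∀ t ∈ Icc a b, x t + f t • e ∈ Metric.ball (φ[p] p) δ := by
      intro t ht
      refine hηball (Metric.mem_thickening_iff.2 ⟨x t, mem_image_of_mem _ ht, ?_⟩)
      rw [dist_eq_norm, add_sub_cancel_left, norm_smul]
      exact hsmall t ht
    refine 𝔤.timelikeSegment_of_chart hc.1 (x' := fun t => derivWithin x (Icc a b) t + f' t • e)
      (hx1.add (hf.contDiffOn.smul contDiffOn_const)) (fun t ht => hball (hmem t ht))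
      (fun t ht => (hxd t ht).add ((hf' t).hasDerivWithinAt.smul_const e)) fun t ht => ?_
    refine hadd _ (hxb t ht) _ (hmem t ht) _ (hc.chartCausal hcs ht) _ (hpos t ht) ?_
    rw [add_sub_cancel_left, norm_smul]
    calc K * (‖f t‖ * ‖e‖) * ‖derivWithin x (Icc a b) t‖ ≤ K * (‖f t‖ * ‖e‖) * L := by
          gcongr; exact hL t ht
      _ = (K * ‖e‖ * L) * |f t| := by rw [Real.norm_eq_abs]; ring
      _ ≤ K' * |f t| := by gcongr; rw [hK']; linarith
      _ ≤ f' t := hge t ht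
  have hexp : ∀ s ∈ Icc 0 (b - a), 0 ≤ Real.exp (K' * s) - 1 ∧
      Real.exp (K' * s) - 1 ≤ Real.exp (K' * (b - a)) - 1 := by
    intro s hs
    have := hK'0.le
    refine ⟨by simpa using mul_nonneg this hs.1, ?_⟩
    gcongr
    exact hs.2
  set C := (Real.exp (K' * (b - a)) - 1) * ‖e‖ with hC
  have hC0 : 0 ≤ C := mul_nonneg (hexp _ ⟨by linarith [hc.1], le_rfl⟩).1 (norm_nonneg _)
  have hsmallC : ∀ ε > 0, ε * (C + 1) < η → ∀ s ∈ Icc 0 (b - a),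
      |ε * (Real.exp (K' * s) - 1)| * ‖e‖ < η := by
    intro ε hε hεη s hs
    rw [abs_of_nonneg (mul_nonneg hε.le (hexp s hs).1)]
    calc _ = ε * ((Real.exp (K' * s) - 1) * ‖e‖) := by ring
      _ ≤ ε * C := by rw [hC]; gcongr; exact hs.2
      _ ≤ ε * (C + 1) := by gcongr; linarith
      _ < η := hεη
  have hsymm : ∀ t ∈ Icc a b, ContinuousAt (φ[p]).symm (x t) := fun t ht =>
    (continuousOn_extChartAt_symm p).continuousAt
      (target_mem_nhds ((φ[p]).map_source (hcs ht)))
  have hε_ev : ∀ᶠ ε : ℝ in 𝓝[>] 0, ε * (C + 1) < η := by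
    refine ((Continuous.tendsto' (by fun_prop) 0 0 (by simp)).mono_left
      nhdsWithin_le_nhds).eventually_lt_const hη
  have hfinal : ∀ t ∈ Icc a b, ∀ r : ℝ, ∀ N ∈ 𝓝 (c t), ∀ᶠ ε : ℝ in 𝓝[>] 0,
      (φ[p]).symm (x t + (ε * r) • e) ∈ N := by
    intro t ht r N hN
    have hN' : N ∈ 𝓝 ((φ[p]).symm (x t)) := by rwa [hx, (φ[p]).left_inv (hcs ht)]
    have h1 : Tendsto (fun ε : ℝ => x t + (ε * r) • e) (𝓝[>] 0) (𝓝 (x t)) :=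
      (Continuous.tendsto' (by fun_prop) 0 _ (by simp)).mono_left nhdsWithin_le_nhds
    exact (((hsymm t ht).tendsto.comp h1).eventually_mem hN')
  have ha : a ∈ Icc a b := ⟨le_rfl, hc.1.le⟩
  have hb : b ∈ Icc a b := ⟨hc.1.le, le_rfl⟩
  constructor
  · intro N hN
    obtain ⟨ε, hε1, hε2, hε3⟩ := (hε_ev.and ((hfinal b hb (Real.exp (K' * (b - a)) - 1) N hN).and
      self_mem_nhdsWithin)).exists
    -- The displacement vanishes at `a`, which keeps the initial point, and moves the endpoint by an
    -- amount proportional to `ε`.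
    have := (key (fun t => ε * (Real.exp (K' * (t - a)) - 1))
      (fun t => ε * (Real.exp (K' * (t - a)) * K')) (by fun_prop) (fun t => ?_) (fun t ht => ?_)
      (fun t ht => ?_) (fun t ht => hsmallC ε hε3 hε1 _ ⟨by linarith [ht.1], by linarith [ht.2]⟩)).chron
    · refine ⟨_, hε2, ?_⟩
      have h0 : (φ[p]).symm (x a + (ε * (Real.exp (K' * (a - a)) - 1)) • e) = c a := by
        rw [sub_self, mul_zero, Real.exp_zero, sub_self, mul_zero, zero_smul, add_zero]
        exact (φ[p]).left_inv (hcs ha)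
      rw [← h0]
      exact this
    · have h1 : HasDerivAt (fun t : ℝ => K' * (t - a)) K' t := by
        simpa using ((hasDerivAt_id t).sub_const a).const_mul K'
      exact (h1.exp.sub_const 1).const_mul ε
    · positivity
    · have h1 := (hexp (t - a) ⟨by linarith [ht.1], by linarith [ht.2]⟩).1
      rw [abs_of_nonneg (mul_nonneg hε3.le h1)]
      have := mul_pos hε3 hK'0
      nlinarith
  · intro N hN
    obtain ⟨ε, hε1, hε2, hε3⟩ := (hε_ev.and ((hfinal a ha (-(Real.exp (K' * (b - a)) - 1)) N
      hN).and self_mem_nhdsWithin)).exists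
    -- This displacement vanishes at `b`. It is negative but increasing, so the added velocity is
    -- again future-directed.
    have := (key (fun t => -(ε * (Real.exp (K' * (b - t)) - 1)))
      (fun t => ε * (Real.exp (K' * (b - t)) * K')) (by fun_prop) (fun t => ?_) (fun t ht => ?_)
      (fun t ht => ?_) (fun t ht => by
        rw [abs_neg]
        exact hsmallC ε hε3 hε1 _ ⟨by linarith [ht.2], by linarith [ht.1]⟩)).chron
    · refine ⟨_, hε2, ?_⟩
      have h0 : (φ[p]).symm (x b + (-(ε * (Real.exp (K' * (b - b)) - 1))) • e) = c b := by
        rw [sub_self, mul_zero, Real.exp_zero, sub_self, mul_zero, neg_zero, zero_smul, add_zero]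
        exact (φ[p]).left_inv (hcs hb)
      rw [← h0, mul_neg]
      exact this
    · have h1 : HasDerivAt (fun t : ℝ => K' * (b - t)) (-K') t := by
        simpa using ((hasDerivAt_id t).const_sub b).const_mul K'
      have := ((h1.exp.sub_const 1).const_mul ε).neg
      rwa [mul_neg, mul_neg, neg_neg] at this
    · positivity
    · have h1 := (hexp (b - t) ⟨by linarith [ht.2], by linarith [ht.1]⟩).1
      rw [abs_neg, abs_of_nonneg (mul_nonneg hε3.le h1)]
      have := mul_pos hε3 hK'0
      nlinarith

/-- A causal segment can be cut into finitely many short causal segments. -/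
theorem CausalSegment.induction_on_subsegments {𝔤 : Spacetime n M} {c : ℝ → M} {a b : ℝ}
    (h : 𝔤.CausalSegment c a b) {W : M → Set M} (hW : ∀ p, IsOpen (W p)) (hmem : ∀ p, p ∈ W p)
    {P : ℝ → ℝ → Prop} (hrefl : ∀ t, P t t)
    (hloc : ∀ s t p, 𝔤.CausalSegment c s t → MapsTo c (Icc s t) (W p) → P s t)
    (htrans : ∀ r s t, P r s → P s t → P r t) : P a b := by
  have hcont : Continuous ((Icc a b).domRestrict c) :=
    continuousOn_iff_continuous_domRestrict.1 h.2.1.continuousOn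
  obtain ⟨t, h0, hmono, ⟨m, hm⟩, hsub⟩ := exists_monotone_Icc_subset_open_cover_Icc h.1.le
    (c := fun p => (Icc a b).domRestrict c ⁻¹' W p) (fun p => (hW p).preimage hcont)
    (fun s _ => mem_iUnion.2 ⟨c s, hmem _⟩)
  have hstep : ∀ k, P a (t k) := by
    intro k
    induction k with
    | zero => rw [h0]; exact hrefl a
    | succ k ih =>
      refine htrans _ _ _ ih ?_
      obtain ⟨p, hp⟩ := hsub k
      have hle : (t k : ℝ) ≤ t (k + 1) := hmono k.le_succ
      rcases eq_or_lt_of_le hle with heq | hlt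
      · rw [heq]; exact hrefl _
      · refine hloc _ _ p (h.mono (t k).2.1 (t (k + 1)).2.2 hlt) fun s hs => ?_
        have hs' : s ∈ Icc a b := ⟨(t k).2.1.trans hs.1, hs.2.trans (t (k + 1)).2.2⟩
        have hmem' : (⟨s, hs'⟩ : Icc a b) ∈ Icc (t k) (t (k + 1)) := ⟨hs.1, hs.2⟩
        exact hp hmem'
  have := hstep m
  rwa [hm m le_rfl] at this

/-- A short piece can be deformed into a timelike curve ending arbitrarily near its endpoint, hence
in the open set of points preceding `r`. Iterating over short pieces carries the relation back to
the start. -/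
theorem CausalSegment.chron_of_chron {𝔤 : Spacetime n M} {c : ℝ → M} {a b : ℝ}
    (h : 𝔤.CausalSegment c a b) {r : M} (hr : 𝔤.Chron (c b) r) : 𝔤.Chron (c a) r := by
  choose W hW hmem hpush using 𝔤.exists_nhds_push_up
  refine h.induction_on_subsegments hW hmem (P := fun s t => 𝔤.Chron (c t) r → 𝔤.Chron (c s) r)
    (fun _ h => h) (fun s t p hst hmaps hr => ?_) (fun _ _ _ h1 h2 h => h1 (h2 h)) hr
  obtain ⟨q, hq, hsq⟩ := (hpush p c s t hst hmaps).1 _ hr.eventually_left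
  exact hsq.trans hq

theorem CausalSegment.chron_of_chron' {𝔤 : Spacetime n M} {c : ℝ → M} {a b : ℝ}
    (h : 𝔤.CausalSegment c a b) {r : M} (hr : 𝔤.Chron r (c a)) : 𝔤.Chron r (c b) := by
  choose W hW hmem hpush using 𝔤.exists_nhds_push_up
  refine h.induction_on_subsegments hW hmem (P := fun s t => 𝔤.Chron r (c s) → 𝔤.Chron r (c t))
    (fun _ h => h) (fun s t p hst hmaps hr => ?_) (fun _ _ _ h1 h2 h => h2 (h1 h)) hr
  obtain ⟨q, hq, hsq⟩ := (hpush p c s t hst hmaps).2 _ hr.eventually_right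
  exact Relation.TransGen.trans hq hsq

theorem CausalLE.chron_of_chron {𝔤 : Spacetime n M} {p q r : M} (h : 𝔤.CausalLE p q)
    (hqr : 𝔤.Chron q r) : 𝔤.Chron p r := by
  induction h using Relation.ReflTransGen.head_induction_on with
  | refl => exact hqr
  | head h _ ih =>
    obtain ⟨c, a, b, hc, rfl, rfl⟩ := h
    exact hc.chron_of_chron ih

theorem Chron.of_causalLE {𝔤 : Spacetime n M} {p q r : M} (hpq : 𝔤.Chron p q)
    (h : 𝔤.CausalLE q r) : 𝔤.Chron p r := by
  induction h with
  | refl => exact hpq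
  | tail _ h ih =>
    obtain ⟨c, a, b, hc, rfl, rfl⟩ := h
    have hchron := hc.chron_of_chron' ih
    exact hchron

/-! ### Achronal hypersurfaces are locally two-sided -/

/-- A point close to a point of an achronal topological hypersurface `H` lies on `H`, or in the
past or the future of a nearby point of `H`. -/
theorem exists_nhds_chron_of_notMem {𝔤 : Spacetime n M} {H : Set M} (hach : 𝔤.Achronal H)
    (htop : IsTopHypersurface n H) {p : M} (hp : p ∈ H) {W : Set M} (hW : W ∈ 𝓝 p) :
    ∃ V ∈ 𝓝 p, ∀ q ∈ V, q ∉ H →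
      (∃ h ∈ H ∩ W, 𝔤.Chron q h) ∨ (∃ h ∈ H ∩ W, 𝔤.Chron h q) := by
  obtain ⟨ψ, hpψ, hψ⟩ := htop p hp
  have hU : W ∩ ψ.source ∈ 𝓝 p := inter_mem hW (ψ.open_source.mem_nhds hpψ)
  obtain ⟨p₁, p₂, V, hV, hVc⟩ := 𝔤.exists_diamond p hU
  have hVU : V ∩ ψ.source ∈ 𝓝 p := inter_mem hV (ψ.open_source.mem_nhds hpψ)
  -- The zeroth coordinate of `ψ` distinguishes the two sides of `H`, so a timelike curve between
  -- opposite sides crosses `H` at an interior parameter.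
  have cross : ∀ (c : ℝ → M) (x y : M), 𝔤.TimelikeSegment c 0 1 → c 0 = x → c 1 = y →
      (∀ t ∈ Icc (0 : ℝ) 1, c t ∈ W ∩ ψ.source) → ψ x 0 * ψ y 0 < 0 →
      ∃ h ∈ H ∩ W, 𝔤.Chron x h ∧ 𝔤.Chron h y := by
    rintro c x y hc rfl rfl hcU hxy
    have hcont : ContinuousOn (fun t => ψ (c t) 0) (Icc (0 : ℝ) 1) := by
      have h1 : ContinuousOn (fun t => ψ (c t)) (Icc (0 : ℝ) 1) :=
        ψ.continuousOn.comp hc.2.1.continuousOn fun t ht => (hcU t ht).2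
      exact (EuclideanSpace.proj (𝕜 := ℝ) (0 : Fin (n + 2))).continuous.comp_continuousOn h1
    have h0 : (0 : ℝ) ∈ (fun t => ψ (c t) 0) '' Icc (0 : ℝ) 1 := by
      rcases mul_neg_iff.1 hxy with h | h
      · exact intermediate_value_Icc' zero_le_one hcont ⟨h.2.le, h.1.le⟩
      · exact intermediate_value_Icc zero_le_one hcont ⟨h.1.le, h.2.le⟩
    obtain ⟨t, ht, ht0⟩ := h0
    have hne0 : t ≠ 0 := by
      rintro rfl
      simp only at ht0
      rw [ht0] at hxy
      simp at hxy
    have hne1 : t ≠ 1 := by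
      rintro rfl
      simp only at ht0
      rw [ht0] at hxy
      simp at hxy
    refine ⟨c t, ⟨(hψ _ (hcU t ht).2).2 ht0, (hcU t ht).1⟩, ?_, ?_⟩
    · exact (hc.mono le_rfl ht.2 (lt_of_le_of_ne ht.1 hne0.symm)).chron
    · exact (hc.mono ht.1 le_rfl (lt_of_le_of_ne ht.2 hne1)).chron
  have up : ∀ z ∈ V, ψ z 0 * ψ p₂ 0 < 0 → ∃ h ∈ H ∩ W, 𝔤.Chron z h ∧ 𝔤.Chron h p₂ := by
    intro z hz hneg
    obtain ⟨c, h1, h2, h3, h4⟩ := (hVc z hz).2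
    exact cross c z p₂ h1 h2 h3 h4 hneg
  have down : ∀ z ∈ V, ψ p₁ 0 * ψ z 0 < 0 → ∃ h ∈ H ∩ W, 𝔤.Chron p₁ h ∧ 𝔤.Chron h z := by
    intro z hz hneg
    obtain ⟨c, h1, h2, h3, h4⟩ := (hVc z hz).1
    exact cross c p₁ z h1 h2 h3 h4 hneg
  have hpV := mem_of_mem_nhds hV
  obtain ⟨c₁, hc₁, hc₁0, hc₁1, hc₁U⟩ := (hVc p hpV).1
  obtain ⟨c₂, hc₂, hc₂0, hc₂1, hc₂U⟩ := (hVc p hpV).2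
  have hp₁ : ψ p₁ 0 ≠ 0 := by
    intro h0
    have hs : p₁ ∈ ψ.source := hc₁0 ▸ (hc₁U 0 (by simp)).2
    have := hc₁.chron
    rw [hc₁0, hc₁1] at this
    exact hach _ ((hψ _ hs).2 h0) _ hp this
  have hp₂ : ψ p₂ 0 ≠ 0 := by
    intro h0
    have hs : p₂ ∈ ψ.source := hc₂1 ▸ (hc₂U 1 (by simp)).2
    have := hc₂.chron
    rw [hc₂0, hc₂1] at this
    exact hach _ hp _ ((hψ _ hs).2 h0) this
  -- Moving along the zeroth coordinate axis reaches both sides of `H` arbitrarily close to `p`.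
  have side : ∀ r : ℝ, r ≠ 0 → ∃ z ∈ V, ψ z 0 * r < 0 := by
    intro r hr
    have hcont : ContinuousAt ψ.symm (ψ p) := ψ.continuousAt_symm (ψ.map_source hpψ)
    have hlim : Tendsto (fun ε : ℝ => ψ p - (ε * r) • EuclideanSpace.single (0 : Fin (n + 2)) (1 : ℝ))
        (𝓝[>] 0) (𝓝 (ψ p)) :=
      (Continuous.tendsto' (by fun_prop) 0 _ (by simp)).mono_left nhdsWithin_le_nhds
    have hV' : V ∈ 𝓝 (ψ.symm (ψ p)) := by rwa [ψ.left_inv hpψ]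
    obtain ⟨ε, h1, h2, h3⟩ := (((hcont.tendsto.comp hlim).eventually_mem hV').and
      ((hlim.eventually_mem (ψ.open_target.mem_nhds (ψ.map_source hpψ))).and
        self_mem_nhdsWithin)).exists
    refine ⟨_, h1, ?_⟩
    simp only [Function.comp_apply]
    rw [ψ.right_inv h2]
    have hp0 : ψ p 0 = 0 := (hψ p hpψ).1 hp
    simp [hp0]
    have := mul_self_pos.2 hr
    nlinarith
  -- If `p₁` and `p₂` were on the same side, a point `z` near `p` on the other side would satisfy
  -- `h₁ ≪ z ≪ h₂` with both `h₁` and `h₂` in `H`.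
  have hopp : ψ p₁ 0 * ψ p₂ 0 < 0 := by
    by_contra! hcon
    have hpos : 0 < ψ p₁ 0 * ψ p₂ 0 := lt_of_le_of_ne hcon (mul_ne_zero hp₁ hp₂).symm
    obtain ⟨z, hz, hzneg⟩ := side _ hp₂
    have hzneg' : ψ p₁ 0 * ψ z 0 < 0 := by
      by_contra! h
      have h1 := mul_pos_of_neg_of_neg hzneg (neg_neg_of_pos hpos)
      have := mul_nonneg h (mul_self_nonneg (ψ p₂ 0))
      nlinarith
    obtain ⟨h₁, hh₁, -, hz1⟩ := down z hz hzneg'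
    obtain ⟨h₂, hh₂, hz2, -⟩ := up z hz hzneg
    exact hach _ hh₁.1 _ hh₂.1 (hz1.trans hz2)
  refine ⟨V ∩ ψ.source, hVU, fun q hq hqH => ?_⟩
  have hq0 : ψ q 0 ≠ 0 := fun h => hqH ((hψ q hq.2).2 h)
  rcases lt_or_gt_of_ne (mul_ne_zero hq0 hp₂) with h | h
  · obtain ⟨h, hh, h1, -⟩ := up q hq.1 h
    exact Or.inl ⟨h, hh, h1⟩
  · have : ψ p₁ 0 * ψ q 0 < 0 := by
      by_contra! h'
      have h1 := mul_pos_of_neg_of_neg hopp (neg_neg_of_pos h)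
      have := mul_nonneg h' (mul_self_nonneg (ψ p₂ 0))
      nlinarith
    obtain ⟨h, hh, -, h1⟩ := down q hq.1 this
    exact Or.inr ⟨h, hh, h1⟩

end Spacetime
end

noncomputable section

set_option maxSynthPendingDepth 3

/-! ### Christoffel symbols under a change of coordinates -/

section Christoffel

variable {E : Type*} [NormedAddCommGroup E] [NormedSpace ℝ E]

/-- The Christoffel symbol `Γ(u, u, ·)` of the first kind of a field of bilinear forms. -/
def christoffelDual (G : E → E →L[ℝ] E →L[ℝ] ℝ) (y u : E) : E →L[ℝ] ℝ :=
  fderiv ℝ G y u u - (1 / 2 : ℝ) • ((fderiv ℝ G y).flip u).flip u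

theorem christoffelDual_apply (G : E → E →L[ℝ] E →L[ℝ] ℝ) (y u w : E) :
    christoffelDual G y u w = fderiv ℝ G y u u w - (1 / 2) * fderiv ℝ G y w u u := by
  simp [christoffelDual]

/-- Differentiating the pullback produces, besides the pulled-back derivative of `G₀`, terms with
the second derivative of `ψ`. By symmetry of that derivative and of `G₀` they combine into one
inhomogeneous term. -/
theorem christoffelDual_pullback {G₀ G₁ : E → E →L[ℝ] E →L[ℝ] ℝ} {ψ : E → E} {y : E}
    (hψ : ContDiffAt ℝ 2 ψ y) (hG₀ : DifferentiableAt ℝ G₀ (ψ y))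
    (hsymm : ∀ u v, G₀ (ψ y) u v = G₀ (ψ y) v u)
    (hG : ∀ᶠ z in 𝓝 y, ∀ u v, G₁ z u v = G₀ (ψ z) (fderiv ℝ ψ z u) (fderiv ℝ ψ z v))
    (hG₁ : DifferentiableAt ℝ G₁ y) (u w : E) :
    christoffelDual G₁ y u w = christoffelDual G₀ (ψ y) (fderiv ℝ ψ y u) (fderiv ℝ ψ y w) +
      G₀ (ψ y) (fderiv ℝ (fderiv ℝ ψ) y u u) (fderiv ℝ ψ y w) := by
  have hψd : HasFDerivAt ψ (fderiv ℝ ψ y) y := (hψ.differentiableAt (by simp)).hasFDerivAt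
  have hψ2 : HasFDerivAt (fderiv ℝ ψ) (fderiv ℝ (fderiv ℝ ψ) y) y :=
    ((hψ.fderiv_right (m := 1) (by norm_num)).differentiableAt (by simp)).hasFDerivAt
  have hcomp : HasFDerivAt (fun z => G₀ (ψ z)) ((fderiv ℝ G₀ (ψ y)).comp (fderiv ℝ ψ y)) y := by
    have := HasFDerivAt.comp (g := G₀) (f := ψ) y hG₀.hasFDerivAt hψd
    exact this
  have key : ∀ a b c : E, fderiv ℝ G₁ y a b c =
      fderiv ℝ G₀ (ψ y) (fderiv ℝ ψ y a) (fderiv ℝ ψ y b) (fderiv ℝ ψ y c) +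
      G₀ (ψ y) (fderiv ℝ (fderiv ℝ ψ) y a b) (fderiv ℝ ψ y c) +
      G₀ (ψ y) (fderiv ℝ ψ y b) (fderiv ℝ (fderiv ℝ ψ) y a c) := by
    intro a b c
    have h1 : HasFDerivAt (fun z => G₁ z b c) _ y :=
      (hG₁.hasFDerivAt.clm_apply (hasFDerivAt_const b y)).clm_apply (hasFDerivAt_const c y)
    have hb := hψ2.clm_apply (hasFDerivAt_const b y)
    have hc := hψ2.clm_apply (hasFDerivAt_const c y)
    have h2 := (hcomp.clm_apply hb).clm_apply hc
    have h3 : (fun z => G₁ z b c) =ᶠ[𝓝 y]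
        fun z => G₀ (ψ z) (fderiv ℝ ψ z b) (fderiv ℝ ψ z c) := by
      filter_upwards [hG] with z hz using hz b c
    have h4 := DFunLike.congr_fun (h1.unique (h2.congr_of_eventuallyEq h3)) a
    simp at h4
    rw [h4]
    ring
  have hs2 : ∀ a b, fderiv ℝ (fderiv ℝ ψ) y a b = fderiv ℝ (fderiv ℝ ψ) y b a := by
    intro a b
    exact (hψ.isSymmSndFDerivAt (by simp)) a b
  rw [christoffelDual_apply, christoffelDual_apply, key, key, hs2 w u,
    hsymm (fderiv ℝ (fderiv ℝ ψ) y u w) (fderiv ℝ ψ y u)]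
  ring

/-- The left hand side of the geodesic equation, with its free index lowered. -/
def geodesicDefect (G : E → E →L[ℝ] E →L[ℝ] ℝ) (x : ℝ → E) (t : ℝ) : E →L[ℝ] ℝ :=
  G (x t) (deriv (deriv x) t) + christoffelDual G (x t) (deriv x t)

theorem geodesicDefect_congr {G : E → E →L[ℝ] E →L[ℝ] ℝ} {x x' : ℝ → E} {t : ℝ}
    (h : x =ᶠ[𝓝 t] x') : geodesicDefect G x t = geodesicDefect G x' t := by
  rw [geodesicDefect, geodesicDefect, h.deriv.deriv_eq, h.deriv_eq, h.self_of_nhds]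

/-- The second derivative of `ψ ∘ x₁` contains exactly the term by which the Christoffel symbols
fail to be tensorial. The defect therefore transforms as a covector, and its vanishing is
independent of coordinates. -/
theorem geodesicDefect_pullback {G₀ G₁ : E → E →L[ℝ] E →L[ℝ] ℝ} {ψ : E → E} {x₀ x₁ : ℝ → E} {t : ℝ}
    (hψ : ContDiffAt ℝ 2 ψ (x₁ t)) (hG₀ : DifferentiableAt ℝ G₀ (ψ (x₁ t)))
    (hsymm : ∀ u v, G₀ (ψ (x₁ t)) u v = G₀ (ψ (x₁ t)) v u)
    (hG : ∀ᶠ z in 𝓝 (x₁ t), ∀ u v, G₁ z u v = G₀ (ψ z) (fderiv ℝ ψ z u) (fderiv ℝ ψ z v))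
    (hG₁ : DifferentiableAt ℝ G₁ (x₁ t)) (hx : ContDiffAt ℝ 2 x₁ t)
    (heq : x₀ =ᶠ[𝓝 t] fun s => ψ (x₁ s)) (w : E) :
    geodesicDefect G₁ x₁ t w = geodesicDefect G₀ x₀ t (fderiv ℝ ψ (x₁ t) w) := by
  have hx1 : ∀ᶠ s in 𝓝 t, DifferentiableAt ℝ x₁ s := by
    filter_upwards [hx.eventually (by simp)] with s hs using hs.differentiableAt (by simp)
  have hψ1 : ∀ᶠ s in 𝓝 t, DifferentiableAt ℝ ψ (x₁ s) := by
    filter_upwards [hx.continuousAt.eventually (hψ.eventually (by simp))] with s hs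
    exact hs.differentiableAt (by simp)
  have hd : deriv x₀ =ᶠ[𝓝 t] fun s => fderiv ℝ ψ (x₁ s) (deriv x₁ s) := by
    refine heq.deriv.trans ?_
    filter_upwards [hx1, hψ1] with s h1 h2
    exact (h2.hasFDerivAt.comp_hasDerivAt s h1.hasDerivAt).deriv
  have hψ2 : HasFDerivAt (fderiv ℝ ψ) (fderiv ℝ (fderiv ℝ ψ) (x₁ t)) (x₁ t) :=
    ((hψ.fderiv_right (m := 1) (by norm_num)).differentiableAt (by simp)).hasFDerivAt
  have hx1t := hx1.self_of_nhds.hasDerivAt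
  have hx2 : HasDerivAt (deriv x₁) (deriv (deriv x₁) t) t := by
    have h := ((hx.fderiv_right (m := 1) (by norm_num)).differentiableAt (by simp))
    have h2 : DifferentiableAt ℝ (deriv x₁) t := h.clm_apply (differentiableAt_const (1 : ℝ))
    exact h2.hasDerivAt
  have hdd : deriv (deriv x₀) t = fderiv ℝ (fderiv ℝ ψ) (x₁ t) (deriv x₁ t) (deriv x₁ t) +
      fderiv ℝ ψ (x₁ t) (deriv (deriv x₁) t) := by
    rw [hd.deriv_eq]
    exact ((hψ2.comp_hasDerivAt t hx1t).clm_apply hx2).deriv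
  have h0 : x₀ t = ψ (x₁ t) := heq.self_of_nhds
  have h1 : deriv x₀ t = fderiv ℝ ψ (x₁ t) (deriv x₁ t) := hd.self_of_nhds
  simp only [geodesicDefect, add_apply]
  rw [christoffelDual_pullback hψ hG₀ hsymm hG hG₁, hG.self_of_nhds, h0, h1, hdd]
  simp only [map_add, add_apply]
  ring

/-- The acceleration of the geodesic with velocity `u` at the point `y`. -/
def geodesicAccel (G : E → E →L[ℝ] E →L[ℝ] ℝ) (y u : E) : E :=
  -(G y).inverse (christoffelDual G y u)

theorem geodesicDefect_eq_zero_iff_accel {G : E → E →L[ℝ] E →L[ℝ] ℝ} {x : ℝ → E} {t : ℝ}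
    (e : E ≃L[ℝ] (E →L[ℝ] ℝ)) (he : (e : E →L[ℝ] (E →L[ℝ] ℝ)) = G (x t)) :
    geodesicDefect G x t = 0 ↔ deriv (deriv x) t = geodesicAccel G (x t) (deriv x t) := by
  rw [geodesicDefect, geodesicAccel, ← he, ContinuousLinearMap.inverse_equiv,
    add_eq_zero_iff_eq_neg, ← map_neg]
  exact (ContinuousLinearEquiv.eq_symm_apply e).symm

theorem ContDiffAt.clm_inverse [CompleteSpace E] {G : E → E →L[ℝ] E →L[ℝ] ℝ} {y : E}
    (e : E ≃L[ℝ] (E →L[ℝ] ℝ)) (he : (e : E →L[ℝ] (E →L[ℝ] ℝ)) = G y) (hG : ContDiffAt ℝ ∞ G y) :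
    ContDiffAt ℝ ∞ (fun z => (G z).inverse) y := by
  have h1 := contDiffAt_map_inverse (𝕜 := ℝ) (n := ∞) e
  rw [he] at h1
  exact h1.comp y hG

theorem contDiffAt_geodesicAccel [CompleteSpace E] {G : E → E →L[ℝ] E →L[ℝ] ℝ} {z : E × E}
    (e : E ≃L[ℝ] (E →L[ℝ] ℝ)) (he : (e : E →L[ℝ] (E →L[ℝ] ℝ)) = G z.1)
    (hG : ContDiffAt ℝ ∞ G z.1) :
    ContDiffAt ℝ ∞ (fun z : E × E => geodesicAccel G z.1 z.2) z := by
  have h1 : ContDiffAt ℝ ∞ (fun z : E × E => (G z.1).inverse) z :=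
    (hG.clm_inverse e he).comp z contDiffAt_fst
  have h2 : ContDiffAt ℝ ∞ (fun z : E × E => fderiv ℝ G z.1) z :=
    (hG.fderiv_right (m := ∞) (by simp)).comp z contDiffAt_fst
  have h3 : ContDiffAt ℝ ∞ (fun z : E × E => z.2) z := contDiffAt_snd
  have h4 : ContDiffAt ℝ ∞ (fun z : E × E => (fderiv ℝ G z.1).flip z.2) z :=
    ((ContinuousLinearMap.flipₗᵢ ℝ E E (E →L[ℝ] ℝ)).contDiff.contDiffAt.comp z h2).clm_apply h3
  have h5 : ContDiffAt ℝ ∞ (fun z : E × E => ((fderiv ℝ G z.1).flip z.2).flip z.2) z :=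
    ((ContinuousLinearMap.flipₗᵢ ℝ E E ℝ).contDiff.contDiffAt.comp z h4).clm_apply h3
  exact (h1.clm_apply (((h2.clm_apply h3).clm_apply h3).sub (h5.const_smul (1 / 2 : ℝ)))).neg

/-- The acceleration is locally bounded by the square of the velocity. -/
theorem exists_geodesicAccel_bound [CompleteSpace E] {G : E → E →L[ℝ] E →L[ℝ] ℝ} {y₀ : E}
    (e : E ≃L[ℝ] (E →L[ℝ] ℝ)) (he : (e : E →L[ℝ] (E →L[ℝ] ℝ)) = G y₀)
    (hG : ContDiffAt ℝ ∞ G y₀) :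
    ∃ C > 0, ∀ᶠ y in 𝓝 y₀, ∀ u, ‖geodesicAccel G y u‖ ≤ C * (‖u‖ * ‖u‖) := by
  have h1 := (hG.clm_inverse e he).continuousAt.norm
  have h2 := (hG.fderiv_right (m := ∞) (by simp)).continuousAt.norm
  set A := ‖(G y₀).inverse‖ + 1
  set B := ‖fderiv ℝ G y₀‖ + 1
  have hA : 0 < A := by positivity
  have hB : 0 < B := by positivity
  refine ⟨A * (2 * B), by positivity, ?_⟩
  filter_upwards [h1.eventually_lt_const (lt_add_one _), h2.eventually_lt_const (lt_add_one _)]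
    with y hA' hB' u
  have h3 : ‖christoffelDual G y u‖ ≤ 2 * B * (‖u‖ * ‖u‖) := by
    have a1 : ‖fderiv ℝ G y u u‖ ≤ B * ‖u‖ * ‖u‖ :=
      (ContinuousLinearMap.le_opNorm₂ (fderiv ℝ G y) u u).trans (by gcongr)
    have a2 : ‖((fderiv ℝ G y).flip u).flip u‖ ≤ B * ‖u‖ * ‖u‖ := by
      refine (ContinuousLinearMap.le_opNorm _ _).trans ?_
      rw [ContinuousLinearMap.opNorm_flip]
      gcongr
      refine (ContinuousLinearMap.le_opNorm _ _).trans ?_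
      rw [ContinuousLinearMap.opNorm_flip]
      gcongr
    calc _ ≤ ‖fderiv ℝ G y u u‖ + ‖(1 / 2 : ℝ) • ((fderiv ℝ G y).flip u).flip u‖ :=
          norm_sub_le _ _
      _ ≤ B * ‖u‖ * ‖u‖ + (1 / 2) * (B * ‖u‖ * ‖u‖) := by
          rw [norm_smul, Real.norm_of_nonneg (by norm_num : (0:ℝ) ≤ 1 / 2)]
          gcongr
      _ ≤ _ := by nlinarith [mul_nonneg hB.le (mul_nonneg (norm_nonneg u) (norm_nonneg u))]
  rw [geodesicAccel, norm_neg]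
  calc _ ≤ ‖(G y).inverse‖ * ‖christoffelDual G y u‖ := ContinuousLinearMap.le_opNorm _ _
    _ ≤ A * (2 * B * (‖u‖ * ‖u‖)) := by gcongr
    _ = _ := by ring

end Christoffel

namespace Spacetime

variable {n : ℕ} {M : Type*} [TopologicalSpace M] [ChartedSpace (Model n) M]
  [IsManifold 𝓘(ℝ, Model n) ∞ M]

local notation "φ[" x₀ "]" => extChartAt (modelWithCornersSelf ℝ (Model n)) x₀

/-! ### The geodesic equation in an arbitrary chart -/

theorem contDiffAt_chartForm (𝔤 : Spacetime n M) {x₀ : M} {y : Model n}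
    (hy : y ∈ (φ[x₀]).target) : ContDiffAt ℝ ∞ (𝔤.chartForm x₀) y :=
  (𝔤.contDiffOn_chartForm x₀).contDiffAt (target_mem_nhds hy)

theorem christoffel_eq (𝔤 : Spacetime n M) {x₀ : M} {y : Model n} (hy : y ∈ (φ[x₀]).target)
    (u w : Model n) :
    𝔤.christoffel x₀ y u u w = christoffelDual (𝔤.chartForm x₀) y u w := by
  have hG := ((𝔤.contDiffAt_chartForm hy).differentiableAt (by simp)).hasFDerivAt
  have key : ∀ a b c, fderiv ℝ (fun z => coordForm 𝔤.g x₀ z a b) y c =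
      fderiv ℝ (𝔤.chartForm x₀) y c a b := by
    intro a b c
    have h1 : HasFDerivAt (fun z => 𝔤.chartForm x₀ z a b) _ y :=
      (hG.clm_apply (hasFDerivAt_const a y)).clm_apply (hasFDerivAt_const b y)
    have h2 := DFunLike.congr_fun h1.fderiv c
    simp only [coordForm_eq]
    simpa using h2
  rw [christoffel, christoffelDual_apply, key, key]
  ring

theorem geodesicEqAt_iff (𝔤 : Spacetime n M) (γ : ℝ → M) (t : ℝ) :
    𝔤.GeodesicEqAt γ t ↔
      geodesicDefect (𝔤.chartForm (γ t)) (fun s => φ[γ t] (γ s)) t = 0 := by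
  rw [ContinuousLinearMap.ext_iff]
  refine forall_congr' fun w => ?_
  rw [coordForm_eq, christoffel_eq _ (mem_extChartAt_target (γ t))]
  rfl

theorem fderiv_chart_change {x₀ x₁ : M} {y : Model n} (hy : y ∈ (φ[x₁]).target)
    (hy' : (φ[x₁]).symm y ∈ (φ[x₀]).source) (u : Model n) :
    fderiv ℝ (fun z => φ[x₀] ((φ[x₁]).symm z)) y u =
      chartDeriv n x₀ ((φ[x₁]).symm y) (chartVec n x₁ y u) := by
  have : IsManifold 𝓘(ℝ, Model n) 1 M := IsManifold.of_le (n := ∞) (by simp)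
  have h1 : MDifferentiableAt 𝓘(ℝ, Model n) 𝓘(ℝ, Model n) (φ[x₀]) ((φ[x₁]).symm y) :=
    mdifferentiableAt_extChartAt (by rwa [extChartAt_source] at hy')
  have h2 : MDifferentiableAt 𝓘(ℝ, Model n) 𝓘(ℝ, Model n) (φ[x₁]).symm y :=
    (mdifferentiableOn_extChartAt_symm y hy).mdifferentiableAt (target_mem_nhds hy)
  have h := mfderiv_comp y h1 h2
  rw [mfderiv_eq_fderiv] at h
  exact DFunLike.congr_fun h u

theorem contDiffAt_chart_change {x₀ x₁ : M} {y : Model n} (hy : y ∈ (φ[x₁]).target)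
    (hy' : (φ[x₁]).symm y ∈ (φ[x₀]).source) :
    ContDiffAt ℝ ∞ (fun z => φ[x₀] ((φ[x₁]).symm z)) y := by
  rw [← contMDiffAt_iff_contDiffAt]
  have h1 : ContMDiffAt 𝓘(ℝ, Model n) 𝓘(ℝ, Model n) ∞ (φ[x₀]) ((φ[x₁]).symm y) :=
    contMDiffAt_extChartAt' (by rwa [extChartAt_source] at hy')
  have h2 : ContMDiffAt 𝓘(ℝ, Model n) 𝓘(ℝ, Model n) ∞ (φ[x₁]).symm y :=
    (contMDiffOn_extChartAt_symm x₁ y hy).contMDiffAt (target_mem_nhds hy)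
  exact h1.comp y h2

theorem contDiffAt_chart_comp {x₀ : M} {γ : ℝ → M} {t : ℝ}
    (hγ : ContMDiffAt 𝓘(ℝ, ℝ) 𝓘(ℝ, Model n) ∞ γ t) (ht : γ t ∈ (φ[x₀]).source) :
    ContDiffAt ℝ ∞ (fun s => φ[x₀] (γ s)) t := by
  rw [← contMDiffAt_iff_contDiffAt]
  have h1 : ContMDiffAt 𝓘(ℝ, Model n) 𝓘(ℝ, Model n) ∞ (φ[x₀]) (γ t) :=
    contMDiffAt_extChartAt' (by rwa [extChartAt_source] at ht)
  exact h1.comp t hγ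

/-- The geodesic equation does not depend on the chart. -/
theorem geodesicDefect_eq_zero_of_chart (𝔤 : Spacetime n M) {x₀ x₁ : M} {γ : ℝ → M} {t : ℝ}
    (hγ : ContMDiffAt 𝓘(ℝ, ℝ) 𝓘(ℝ, Model n) ∞ γ t) (h₀ : γ t ∈ (φ[x₀]).source)
    (h₁ : γ t ∈ (φ[x₁]).source)
    (h : geodesicDefect (𝔤.chartForm x₀) (fun s => φ[x₀] (γ s)) t = 0) :
    geodesicDefect (𝔤.chartForm x₁) (fun s => φ[x₁] (γ s)) t = 0 := by
  have hinv : (φ[x₁]).symm (φ[x₁] (γ t)) = γ t := (φ[x₁]).left_inv h₁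
  have hy : φ[x₁] (γ t) ∈ (φ[x₁]).target := (φ[x₁]).map_source h₁
  have hy' : (φ[x₁]).symm (φ[x₁] (γ t)) ∈ (φ[x₀]).source := by rwa [hinv]
  have hy0 : φ[x₀] ((φ[x₁]).symm (φ[x₁] (γ t))) ∈ (φ[x₀]).target := (φ[x₀]).map_source hy'
  have hcs : ContinuousAt (φ[x₁]).symm (φ[x₁] (γ t)) :=
    (continuousOn_extChartAt_symm x₁).continuousAt (target_mem_nhds hy)
  have hpull : ∀ᶠ z in 𝓝 (φ[x₁] (γ t)), ∀ u v, 𝔤.chartForm x₁ z u v =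
      𝔤.chartForm x₀ (φ[x₀] ((φ[x₁]).symm z)) (fderiv ℝ (fun z => φ[x₀] ((φ[x₁]).symm z)) z u)
        (fderiv ℝ (fun z => φ[x₀] ((φ[x₁]).symm z)) z v) := by
    filter_upwards [target_mem_nhds hy, hcs.preimage_mem_nhds
      ((isOpen_extChartAt_source x₀).mem_nhds hy')] with z hz hz' u v
    rw [fderiv_chart_change hz hz', fderiv_chart_change hz hz', chartForm_chartDeriv _ hz',
      chartForm, ContinuousLinearMap.bilinearComp_apply]
  have heq : (fun s => φ[x₀] (γ s)) =ᶠ[𝓝 t] fun s => φ[x₀] ((φ[x₁]).symm (φ[x₁] (γ s))) := by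
    filter_upwards [hγ.continuousAt.preimage_mem_nhds
      ((isOpen_extChartAt_source x₁).mem_nhds h₁)] with s hs
    rw [(φ[x₁]).left_inv hs]
  have hψ : ContDiffAt ℝ 2 (fun z => φ[x₀] ((φ[x₁]).symm z)) (φ[x₁] (γ t)) :=
    (contDiffAt_chart_change hy hy').of_le (WithTop.coe_le_coe.2 le_top)
  have hx : ContDiffAt ℝ 2 (fun s => φ[x₁] (γ s)) t :=
    (contDiffAt_chart_comp hγ h₁).of_le (WithTop.coe_le_coe.2 le_top)
  have hG₀ : DifferentiableAt ℝ (𝔤.chartForm x₀) (φ[x₀] ((φ[x₁]).symm (φ[x₁] (γ t)))) :=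
    (𝔤.contDiffAt_chartForm hy0).differentiableAt (by simp)
  have hG₁ : DifferentiableAt ℝ (𝔤.chartForm x₁) (φ[x₁] (γ t)) :=
    (𝔤.contDiffAt_chartForm hy).differentiableAt (by simp)
  have hsymm := (𝔤.isLorentzForm_chartForm x₀ hy0).symm
  ext w
  have key := geodesicDefect_pullback (E := Model n) (G₀ := 𝔤.chartForm x₀) (G₁ := 𝔤.chartForm x₁)
    (ψ := fun z => φ[x₀] ((φ[x₁]).symm z)) (x₀ := fun s => φ[x₀] (γ s))
    (x₁ := fun s => φ[x₁] (γ s)) (t := t) hψ hG₀ hsymm hpull hG₁ hx heq w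
  rw [h] at key
  exact key

/-- `GeodesicEqAt` uses a chart centred at the moving point, whereas the theory of differential
equations needs one chart for a whole interval of parameters. -/
theorem geodesicEqAt_iff_chart (𝔤 : Spacetime n M) {x₀ : M} {γ : ℝ → M} {t : ℝ}
    (hγ : ContMDiffAt 𝓘(ℝ, ℝ) 𝓘(ℝ, Model n) ∞ γ t) (h₀ : γ t ∈ (φ[x₀]).source) :
    𝔤.GeodesicEqAt γ t ↔ geodesicDefect (𝔤.chartForm x₀) (fun s => φ[x₀] (γ s)) t = 0 := by
  rw [geodesicEqAt_iff]
  exact ⟨𝔤.geodesicDefect_eq_zero_of_chart hγ (mem_extChartAt_source _) h₀,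
    𝔤.geodesicDefect_eq_zero_of_chart hγ h₀ (mem_extChartAt_source _)⟩

/-! ### The geodesic equation as an ordinary differential equation -/

/-- Nondegeneracy makes lowering an index injective, and equal dimensions make it bijective. This is
what allows the geodesic equation to be solved for the second derivative. -/
theorem exists_equiv_chartForm (𝔤 : Spacetime n M) {x₀ : M} {y : Model n}
    (hy : y ∈ (φ[x₀]).target) :
    ∃ e : Model n ≃L[ℝ] (Model n →L[ℝ] ℝ), (e : Model n →L[ℝ] (Model n →L[ℝ] ℝ)) =
      𝔤.chartForm x₀ y := by
  have hB := 𝔤.isLorentzForm_chartForm x₀ hy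
  have hinj : Function.Injective (𝔤.chartForm x₀ y : Model n →ₗ[ℝ] (Model n →L[ℝ] ℝ)) := by
    rw [← LinearMap.ker_eq_bot, LinearMap.ker_eq_bot']
    intro u hu
    refine hB.eq_zero_of_forall fun v => ?_
    have := DFunLike.congr_fun hu v
    simpa using this
  have hfr : Module.finrank ℝ (Model n) = Module.finrank ℝ (Model n →L[ℝ] ℝ) := by
    rw [← (LinearMap.toContinuousLinearMap (𝕜 := ℝ) (E := Model n) (F' := ℝ)).finrank_eq,
      Module.finrank_linearMap]
    simp
  refine ⟨(LinearEquiv.ofInjectiveOfFinrankEq _ hinj hfr).toContinuousLinearEquiv, ?_⟩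
  ext u v
  rfl

/-- The acceleration of the geodesic with velocity `u` at the point `y` of a chart. -/
def accel (𝔤 : Spacetime n M) (x₀ : M) (y u : Model n) : Model n :=
  geodesicAccel (𝔤.chartForm x₀) y u

theorem geodesicDefect_eq_zero_iff (𝔤 : Spacetime n M) {x₀ : M} {x : ℝ → Model n} {t : ℝ}
    (ht : x t ∈ (φ[x₀]).target) :
    geodesicDefect (𝔤.chartForm x₀) x t = 0 ↔
      deriv (deriv x) t = 𝔤.accel x₀ (x t) (deriv x t) := by
  obtain ⟨e, he⟩ := 𝔤.exists_equiv_chartForm ht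
  exact geodesicDefect_eq_zero_iff_accel e he

theorem contDiffAt_accel (𝔤 : Spacetime n M) {x₀ : M} {z : Model n × Model n}
    (hz : z.1 ∈ (φ[x₀]).target) :
    ContDiffAt ℝ ∞ (fun z : Model n × Model n => 𝔤.accel x₀ z.1 z.2) z := by
  obtain ⟨e, he⟩ := 𝔤.exists_equiv_chartForm hz
  exact contDiffAt_geodesicAccel e he (𝔤.contDiffAt_chartForm hz)

theorem exists_accel_bound (𝔤 : Spacetime n M) {x₀ : M} {y₀ : Model n}
    (hy : y₀ ∈ (φ[x₀]).target) :
    ∃ C > 0, ∀ᶠ y in 𝓝 y₀, ∀ u, ‖𝔤.accel x₀ y u‖ ≤ C * (‖u‖ * ‖u‖) := by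
  obtain ⟨e, he⟩ := 𝔤.exists_equiv_chartForm hy
  exact exists_geodesicAccel_bound e he (𝔤.contDiffAt_chartForm hy)

end Spacetime
end

noncomputable section

set_option maxSynthPendingDepth 3

/-! ### Local solutions of ordinary differential equations -/

/-- The Picard–Lindelöf theorem gives a time of existence common to nearby initial data. Joint
continuity in the initial value and time allows shrinking both until the solutions stay in `Ω`,
where smoothness of `f` passes to the solutions. -/
theorem exists_local_solution {F : Type*} [NormedAddCommGroup F] [NormedSpace ℝ F]
    [CompleteSpace F] {f : F → F} {Ω : Set F} (hΩ : IsOpen Ω) (hf : ContDiffOn ℝ ∞ f Ω) {z₀ : F}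
    (hz₀ : z₀ ∈ Ω) : ∃ r > 0, ∃ ε > 0, ∀ z ∈ Metric.closedBall z₀ r, ∃ α : ℝ → F, α 0 = z ∧
      ContDiffOn ℝ ∞ α (Ioo (-ε) ε) ∧ ∀ t ∈ Ioo (-ε) ε, HasDerivAt α (f (α t)) t ∧ α t ∈ Ω := by
  have hf1 : ContDiffAt ℝ 1 f z₀ := (hf.contDiffAt (hΩ.mem_nhds hz₀)).of_le (by simp)
  obtain ⟨ε, hε, a, r, L, K, hr, hpl⟩ := IsPicardLindelof.of_contDiffAt_one hf1
  obtain ⟨α, hα, hcont⟩ := (hpl 0).exists_forall_mem_closedBall_eq_hasDerivWithinAt_continuousOn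
  simp only [zero_sub, zero_add] at hα hcont
  have hr' : (0 : ℝ) < r := hr
  have hmem : (z₀, (0 : ℝ)) ∈ Metric.closedBall z₀ (r : ℝ) ×ˢ Icc (-ε) ε :=
    ⟨Metric.mem_closedBall_self hr'.le, by constructor <;> linarith⟩
  have h0 : α (z₀, 0) = z₀ := (hα z₀ hmem.1).1
  have hnhds : Metric.closedBall z₀ (r : ℝ) ×ˢ Icc (-ε) ε ∈ 𝓝 (z₀, (0 : ℝ)) :=
    prod_mem_nhds (Metric.closedBall_mem_nhds z₀ hr') (Icc_mem_nhds (by linarith) hε)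
  have hca : ContinuousAt α (z₀, 0) := hcont.continuousAt hnhds
  have hev : ∀ᶠ p in 𝓝 (z₀, (0 : ℝ)), α p ∈ Ω := hca.eventually_mem (by
    rw [h0]; exact hΩ.mem_nhds hz₀)
  rw [nhds_prod_eq] at hev
  obtain ⟨P, hP, Q, hQ, hPQ⟩ := Filter.eventually_prod_iff.1 hev
  obtain ⟨r₁, hr₁, hP₁⟩ := Metric.nhds_basis_closedBall.eventually_iff.1 hP
  obtain ⟨ε₁, hε₁, hQ₁⟩ := Metric.nhds_basis_closedBall.eventually_iff.1 hQ
  set ε' := min ε ε₁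
  have hε' : 0 < ε' := lt_min hε hε₁
  refine ⟨min r r₁, lt_min hr' hr₁, ε', hε', fun z hz => ⟨fun t => α (z, t), ?_, ?_, ?_⟩⟩
  · exact (hα z (Metric.closedBall_subset_closedBall (min_le_left _ _) hz)).1
  all_goals
    have hzr := Metric.closedBall_subset_closedBall (min_le_left _ _) hz
    have hzr₁ := Metric.closedBall_subset_closedBall (min_le_right _ _) hz
    have hsub : Icc (-ε') ε' ⊆ Icc (-ε) ε :=
      Icc_subset_Icc (neg_le_neg (min_le_left _ _)) (min_le_left _ _)
    have hΩt : ∀ t ∈ Icc (-ε') ε', α (z, t) ∈ Ω := fun t ht => hPQ (hP₁ hzr₁) (hQ₁ (by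
      rw [Metric.mem_closedBall, Real.dist_0_eq_abs]
      exact (abs_le.2 ht).trans (min_le_right _ _)))
    have hder : ∀ t ∈ Icc (-ε') ε', HasDerivWithinAt (fun t => α (z, t)) (f (α (z, t)))
        (Icc (-ε') ε') t := fun t ht => ((hα z hzr).2 t (hsub ht)).mono hsub
  · refine (ODE.contDiffOn_enat_Icc_of_hasDerivWithinAt (n := ⊤) (f := fun _ => f) (u := Ω)
      ?_ hder hΩt).mono Ioo_subset_Icc_self
    exact hf.comp contDiffOn_snd fun p hp => hp.2
  · intro t ht
    exact ⟨(hder t (Ioo_subset_Icc_self ht)).hasDerivAt (Icc_mem_nhds ht.1 ht.2),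
      hΩt t (Ioo_subset_Icc_self ht)⟩

namespace Spacetime

variable {n : ℕ} {M : Type*} [TopologicalSpace M] [ChartedSpace (Model n) M]
  [IsManifold 𝓘(ℝ, Model n) ∞ M]

local notation "φ[" x₀ "]" => extChartAt (modelWithCornersSelf ℝ (Model n)) x₀

/-! ### Geodesics: locality, existence and uniqueness -/

theorem IsGeodesic.contMDiffAt {𝔤 : Spacetime n M} {γ : ℝ → M} {J : Set ℝ} (h : 𝔤.IsGeodesic γ J)
    {t : ℝ} (ht : t ∈ J) : ContMDiffAt 𝓘(ℝ, ℝ) 𝓘(ℝ, Model n) ∞ γ t :=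
  h.2.2.2.1.contMDiffAt (h.1.mem_nhds ht)

theorem IsGeodesic.continuousAt {𝔤 : Spacetime n M} {γ : ℝ → M} {J : Set ℝ}
    (h : 𝔤.IsGeodesic γ J) {t : ℝ} (ht : t ∈ J) : ContinuousAt γ t :=
  (h.contMDiffAt ht).continuousAt

theorem IsGeodesic.mdifferentiableAt {𝔤 : Spacetime n M} {γ : ℝ → M} {J : Set ℝ}
    (h : 𝔤.IsGeodesic γ J) {t : ℝ} (ht : t ∈ J) :
    MDifferentiableAt 𝓘(ℝ, ℝ) 𝓘(ℝ, Model n) γ t :=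
  (h.contMDiffAt ht).mdifferentiableAt (by simp)

theorem IsGeodesic.deriv_deriv_chart {𝔤 : Spacetime n M} {γ : ℝ → M} {J : Set ℝ}
    (h : 𝔤.IsGeodesic γ J) {t : ℝ} (ht : t ∈ J) {x₀ : M} (hs : γ t ∈ (φ[x₀]).source) :
    deriv (deriv fun s => φ[x₀] (γ s)) t =
      𝔤.accel x₀ (φ[x₀] (γ t)) (deriv (fun s => φ[x₀] (γ s)) t) :=
  (𝔤.geodesicDefect_eq_zero_iff (x := fun s => φ[x₀] (γ s)) ((φ[x₀]).map_source hs)).1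
    ((𝔤.geodesicEqAt_iff_chart (h.contMDiffAt ht) hs).1 (h.2.2.2.2 t ht))

theorem GeodesicEqAt.congr {𝔤 : Spacetime n M} {γ γ' : ℝ → M} {t : ℝ} (h : 𝔤.GeodesicEqAt γ t)
    (hγ : γ' =ᶠ[𝓝 t] γ) : 𝔤.GeodesicEqAt γ' t := by
  rw [geodesicEqAt_iff] at h ⊢
  rw [hγ.self_of_nhds]
  have h1 : (fun s => φ[γ t] (γ' s)) =ᶠ[𝓝 t] fun s => φ[γ t] (γ s) := by
    filter_upwards [hγ] with s hs
    rw [hs]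
  rw [geodesicDefect_congr h1]
  exact h

theorem isGeodesic_of_chart (𝔤 : Spacetime n M) {x₀ : M} {x : ℝ → Model n} {J : Set ℝ}
    (hJ : IsOpen J) (hJc : J.OrdConnected) (hJn : J.Nonempty) (hx : ContDiffOn ℝ ∞ x J)
    (ht : MapsTo x J (φ[x₀]).target)
    (hdd : ∀ t ∈ J, deriv (deriv x) t = 𝔤.accel x₀ (x t) (deriv x t)) :
    𝔤.IsGeodesic (fun t => (φ[x₀]).symm (x t)) J := by
  have hsm := contMDiffOn_chart_symm_comp (x₀ := x₀) le_rfl hx ht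
  refine ⟨hJ, hJc, hJn, hsm, fun t htJ => ?_⟩
  have hs : (φ[x₀]).symm (x t) ∈ (φ[x₀]).source := (φ[x₀]).map_target (ht htJ)
  rw [𝔤.geodesicEqAt_iff_chart (x₀ := x₀) (hsm.contMDiffAt (hJ.mem_nhds htJ)) hs]
  have heq : (fun s => φ[x₀] ((φ[x₀]).symm (x s))) =ᶠ[𝓝 t] x := by
    filter_upwards [hJ.mem_nhds htJ] with s hs
    exact (φ[x₀]).right_inv (ht hs)
  rw [geodesicDefect_congr heq]
  exact (𝔤.geodesicDefect_eq_zero_iff (ht htJ)).2 (hdd t htJ)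

/-- Local existence of geodesics, with a time of existence uniform in the initial data. -/
theorem exists_local_geodesic (𝔤 : Spacetime n M) {x₀ : M} {y₀ : Model n}
    (hy₀ : y₀ ∈ (φ[x₀]).target) (v : Model n) :
    ∃ r > 0, ∃ ε > 0, ∀ y u : Model n, ‖y - y₀‖ ≤ r → ‖u - v‖ ≤ r → ∃ σ : ℝ → M,
      𝔤.IsGeodesic σ (Ioo (-ε) ε) ∧ y ∈ (φ[x₀]).target ∧ σ 0 = (φ[x₀]).symm y ∧
        deriv (fun s => φ[x₀] (σ s)) 0 = u := by
  have hΩ : IsOpen ((φ[x₀]).target ×ˢ (univ : Set (Model n))) :=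
    (isOpen_extChartAt_target x₀).prod isOpen_univ
  -- The second-order equation as a first-order system for position and velocity.
  have hf : ContDiffOn ℝ ∞ (fun z : Model n × Model n => (z.2, 𝔤.accel x₀ z.1 z.2))
      ((φ[x₀]).target ×ˢ (univ : Set (Model n))) := fun z hz =>
    (contDiffAt_snd.prodMk (𝔤.contDiffAt_accel hz.1)).contDiffWithinAt
  obtain ⟨r, hr, ε, hε, h⟩ := exists_local_solution hΩ hf (z₀ := (y₀, v)) ⟨hy₀, mem_univ _⟩
  refine ⟨r, hr, ε, hε, fun y u hy hu => ?_⟩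
  obtain ⟨α, hα0, hαs, hα⟩ := h (y, u) (by
    rw [mem_closedBall_iff_norm, Prod.mk_sub_mk, Prod.norm_mk]
    exact max_le hy hu)
  have h0 : (0 : ℝ) ∈ Ioo (-ε) ε := ⟨by linarith, hε⟩
  have hd : ∀ t ∈ Ioo (-ε) ε, HasDerivAt (fun s => (α s).1) (α t).2 t := fun t ht =>
    (hα t ht).1.fst
  have hderiv : ∀ t ∈ Ioo (-ε) ε, deriv (fun s => (α s).1) =ᶠ[𝓝 t] fun s => (α s).2 := by
    intro t ht
    filter_upwards [isOpen_Ioo.mem_nhds ht] with s hs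
    exact (hd s hs).deriv
  have ht : MapsTo (fun s => (α s).1) (Ioo (-ε) ε) (φ[x₀]).target := fun t ht => (hα t ht).2.1
  have hy' : y ∈ (φ[x₀]).target := by
    have := ht h0
    simpa only [hα0] using this
  refine ⟨fun t => (φ[x₀]).symm (α t).1, 𝔤.isGeodesic_of_chart isOpen_Ioo ordConnected_Ioo ⟨0, h0⟩
    hαs.fst ht fun t ht => ?_, hy', by simp only [hα0], ?_⟩
  · rw [(hderiv t ht).deriv_eq, (hd t ht).deriv]
    have h2 : HasDerivAt (fun s => (α s).2) (𝔤.accel x₀ (α t).1 (α t).2) t := (hα t ht).1.snd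
    exact h2.deriv
  · have heq : (fun s => φ[x₀] ((φ[x₀]).symm (α s).1)) =ᶠ[𝓝 0] fun s => (α s).1 := by
      filter_upwards [isOpen_Ioo.mem_nhds h0] with s hs
      exact (φ[x₀]).right_inv (ht hs)
    rw [heq.deriv_eq, (hd 0 h0).deriv, hα0]

/-- Geodesics with the same initial data agree near the initial parameter. -/
theorem IsGeodesic.eventuallyEq {𝔤 : Spacetime n M} {γ γ' : ℝ → M} {J J' : Set ℝ}
    (h : 𝔤.IsGeodesic γ J) (h' : 𝔤.IsGeodesic γ' J') {t : ℝ} (ht : t ∈ J) (ht' : t ∈ J') {x₀ : M}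
    (hs : γ t ∈ (φ[x₀]).source) (h0 : γ t = γ' t)
    (h1 : deriv (fun s => φ[x₀] (γ s)) t = deriv (fun s => φ[x₀] (γ' s)) t) :
    γ =ᶠ[𝓝 t] γ' := by
  have sol : ∀ (σ : ℝ → M) (I : Set ℝ), 𝔤.IsGeodesic σ I → t ∈ I → σ t ∈ (φ[x₀]).source →
      (∀ᶠ s in 𝓝 t, HasDerivAt (fun s => (φ[x₀] (σ s), deriv (fun s => φ[x₀] (σ s)) s))
        (deriv (fun s => φ[x₀] (σ s)) s,
          𝔤.accel x₀ (φ[x₀] (σ s)) (deriv (fun s => φ[x₀] (σ s)) s)) s) ∧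
      (∀ᶠ s in 𝓝 t, σ s ∈ (φ[x₀]).source) := by
    intro σ I hσ htI hsrc
    have hsrc' : ∀ᶠ s in 𝓝 t, σ s ∈ (φ[x₀]).source :=
      (hσ.continuousAt htI).eventually_mem ((isOpen_extChartAt_source x₀).mem_nhds hsrc)
    refine ⟨?_, hsrc'⟩
    filter_upwards [hsrc', hσ.1.mem_nhds htI] with s hs hsI
    have hc := contDiffAt_chart_comp (hσ.contMDiffAt hsI) hs
    have hd1 := (hc.differentiableAt (by simp)).hasDerivAt
    have hd2 : DifferentiableAt ℝ (deriv fun s => φ[x₀] (σ s)) s :=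
      ((hc.fderiv_right (m := ∞) (by simp)).differentiableAt (by simp)).clm_apply
        (differentiableAt_const (1 : ℝ))
    have hd2' := hd2.hasDerivAt
    rw [hσ.deriv_deriv_chart hsI hs] at hd2'
    exact hd1.prodMk hd2'
  obtain ⟨e1, s1⟩ := sol γ J h ht hs
  obtain ⟨e2, s2⟩ := sol γ' J' h' ht' (h0 ▸ hs)
  have hf : ContDiffAt ℝ 1 (fun z : Model n × Model n => (z.2, 𝔤.accel x₀ z.1 z.2))
      (φ[x₀] (γ t), deriv (fun s => φ[x₀] (γ s)) t) :=
    ContDiffAt.of_le (contDiffAt_snd.prodMk (𝔤.contDiffAt_accel ((φ[x₀]).map_source hs)))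
      (n := ∞) (by simp)
  obtain ⟨K, N, hN, hlip⟩ := hf.exists_lipschitzOnWith
  have hinit : (φ[x₀] (γ t), deriv (fun s => φ[x₀] (γ s)) t) =
      (φ[x₀] (γ' t), deriv (fun s => φ[x₀] (γ' s)) t) := by rw [h0, h1]
  have huniq := ODE_solution_unique_of_eventually (t₀ := t) (K := K) (s := fun _ => N)
    (v := fun _ z => (z.2, 𝔤.accel x₀ z.1 z.2))
    (f := fun s => (φ[x₀] (γ s), deriv (fun s => φ[x₀] (γ s)) s))
    (g := fun s => (φ[x₀] (γ' s), deriv (fun s => φ[x₀] (γ' s)) s))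
    (Eventually.of_forall fun _ => hlip)
    (e1.and (e1.self_of_nhds.continuousAt.eventually_mem hN))
    (e2.and (e2.self_of_nhds.continuousAt.eventually_mem (by rw [← hinit]; exact hN))) hinit
  filter_upwards [huniq, s1, s2] with s hs h3 h4
  have := congrArg Prod.fst hs
  simp only at this
  rw [← (φ[x₀]).left_inv h3, this, (φ[x₀]).left_inv h4]

/-- Geodesics with the same initial data agree on their common domain. -/
theorem IsGeodesic.eqOn_of_eventuallyEq [T2Space M] {𝔤 : Spacetime n M} {γ γ' : ℝ → M}
    {J J' : Set ℝ} (h : 𝔤.IsGeodesic γ J) (h' : 𝔤.IsGeodesic γ' J') {t : ℝ} (ht : t ∈ J)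
    (ht' : t ∈ J') (heq : γ =ᶠ[𝓝 t] γ') : EqOn γ γ' (J ∩ J') := by
  have hconn : IsPreconnected (J ∩ J') := (h.2.1.inter h'.2.1).isPreconnected
  have hopen : IsOpen {s | γ =ᶠ[𝓝 s] γ'} := isOpen_setOfPred_eventually_nhds
  -- The set of parameters at which the germs agree is open. It is relatively closed because at a
  -- limit parameter positions and velocities agree by continuity, and local uniqueness applies
  -- there.
  have hsub := hconn.subset_of_closure_inter_subset hopen ⟨t, ⟨ht, ht'⟩, heq⟩ ?_
  · intro s hs
    exact (hsub hs).self_of_nhds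
  rintro s ⟨hcl, hs, hs'⟩
  have hfreq : ∃ᶠ r in 𝓝 s, γ =ᶠ[𝓝 r] γ' := mem_closure_iff_frequently.1 hcl
  have hnb : (𝓝 s ⊓ 𝓟 {r | γ =ᶠ[𝓝 r] γ'}).NeBot := frequently_mem_iff_neBot.1 hfreq
  have hmem : ∀ᶠ r in 𝓝 s ⊓ 𝓟 {r | γ =ᶠ[𝓝 r] γ'}, γ =ᶠ[𝓝 r] γ' :=
    eventually_inf_principal.2 (Eventually.of_forall fun _ h => h)
  have h0 : γ s = γ' s := by
    refine tendsto_nhds_unique (l := 𝓝 s ⊓ 𝓟 {r | γ =ᶠ[𝓝 r] γ'}) ((h.continuousAt hs).tendsto.mono_left inf_le_left)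
      (((h'.continuousAt hs').tendsto.mono_left inf_le_left).congr' ?_)
    filter_upwards [hmem] with r hr using hr.self_of_nhds.symm
  have hsrc := mem_extChartAt_source (I := 𝓘(ℝ, Model n)) (γ s)
  have hd : ∀ (σ : ℝ → M), ContMDiffAt 𝓘(ℝ, ℝ) 𝓘(ℝ, Model n) ∞ σ s → σ s ∈ (φ[γ s]).source →
      ContinuousAt (deriv fun r => φ[γ s] (σ r)) s := by
    intro σ hσ hσs
    have hc := contDiffAt_chart_comp hσ hσs
    exact ((hc.fderiv_right (m := ∞) (by simp)).continuousAt).clm_apply continuousAt_const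
  refine h.eventuallyEq h' hs hs' hsrc h0 ?_
  refine tendsto_nhds_unique (l := 𝓝 s ⊓ 𝓟 {r | γ =ᶠ[𝓝 r] γ'}) ((hd γ (h.contMDiffAt hs) hsrc).tendsto.mono_left inf_le_left)
    (((hd γ' (h'.contMDiffAt hs') (h0 ▸ hsrc)).tendsto.mono_left inf_le_left).congr' ?_)
  filter_upwards [hmem] with r hr
  refine Filter.EventuallyEq.deriv_eq ?_
  filter_upwards [hr] with q hq
  rw [hq]

theorem IsGeodesic.eqOn [T2Space M] {𝔤 : Spacetime n M} {γ γ' : ℝ → M}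
    {J J' : Set ℝ} (h : 𝔤.IsGeodesic γ J) (h' : 𝔤.IsGeodesic γ' J') {t : ℝ} (ht : t ∈ J)
    (ht' : t ∈ J') (h0 : γ t = γ' t) (h1 : vel n γ t = vel n γ' t) : EqOn γ γ' (J ∩ J') := by
  refine h.eqOn_of_eventuallyEq h' ht ht'
    (h.eventuallyEq h' ht ht' (mem_extChartAt_source (γ t)) h0 ?_)
  rw [deriv_chart (h.mdifferentiableAt ht) (mem_extChartAt_source _),
    deriv_chart (h'.mdifferentiableAt ht') (h0 ▸ mem_extChartAt_source _), h0, h1]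

/-- Two geodesics that agree on the overlap of their domains can be glued. -/
theorem IsGeodesic.exists_union {𝔤 : Spacetime n M} {γ σ : ℝ → M} {J I : Set ℝ}
    (h : 𝔤.IsGeodesic γ J) (h' : 𝔤.IsGeodesic σ I) (hne : (J ∩ I).Nonempty)
    (heq : EqOn γ σ (J ∩ I)) :
    ∃ ρ : ℝ → M, 𝔤.IsGeodesic ρ (J ∪ I) ∧ EqOn ρ γ J ∧ EqOn ρ σ I := by
  classical
  have e1 : EqOn (J.piecewise γ σ) γ J := piecewise_eqOn _ _ _
  have e2 : EqOn (J.piecewise γ σ) σ I := by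
    intro t ht
    by_cases htJ : t ∈ J
    · rw [piecewise_eq_of_mem _ _ _ htJ]
      exact heq ⟨htJ, ht⟩
    · rw [piecewise_eq_of_notMem _ _ _ htJ]
  obtain ⟨r, hrJ, hrI⟩ := hne
  refine ⟨J.piecewise γ σ, ⟨h.1.union h'.1, ?_, ⟨r, Or.inl hrJ⟩, ?_, ?_⟩, e1, e2⟩
  · rw [← isPreconnected_iff_ordConnected]
    exact IsPreconnected.union r hrJ hrI h.2.1.isPreconnected h'.2.1.isPreconnected
  · rintro t (ht | ht)
    · exact ((h.contMDiffAt ht).congr_of_eventuallyEq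
        (e1.eventuallyEq_of_mem (h.1.mem_nhds ht))).contMDiffWithinAt
    · exact ((h'.contMDiffAt ht).congr_of_eventuallyEq
        (e2.eventuallyEq_of_mem (h'.1.mem_nhds ht))).contMDiffWithinAt
  · rintro t (ht | ht)
    · exact (h.2.2.2.2 t ht).congr (e1.eventuallyEq_of_mem (h.1.mem_nhds ht))
    · exact (h'.2.2.2.2 t ht).congr (e2.eventuallyEq_of_mem (h'.1.mem_nhds ht))

/-- Affine reparametrisation of geodesics. -/
theorem IsGeodesic.comp_affine {𝔤 : Spacetime n M} {γ : ℝ → M} {J : Set ℝ} (h : 𝔤.IsGeodesic γ J)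
    (s : ℝ) {c : ℝ} (hc : c ≠ 0) :
    𝔤.IsGeodesic (fun t => γ (s + c * t)) {t | s + c * t ∈ J} := by
  have hcont : Continuous fun t : ℝ => s + c * t := by fun_prop
  have hsm : ContMDiff 𝓘(ℝ, ℝ) 𝓘(ℝ, ℝ) ∞ fun t : ℝ => s + c * t := by
    rw [contMDiff_iff_contDiff]; fun_prop
  refine ⟨h.1.preimage hcont, ?_, ?_, ?_, ?_⟩
  · refine ⟨fun a ha b hb t ht => ?_⟩
    rcases lt_or_gt_of_ne hc with hc | hc
    · refine h.2.1.out hb ha ⟨?_, ?_⟩ <;> nlinarith [ht.1, ht.2]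
    · refine h.2.1.out ha hb ⟨?_, ?_⟩ <;> nlinarith [ht.1, ht.2]
  · obtain ⟨r, hr⟩ := h.2.2.1
    refine ⟨(r - s) / c, ?_⟩
    change s + c * ((r - s) / c) ∈ J
    rwa [mul_div_cancel₀ _ hc, add_sub_cancel]
  · intro t ht
    exact ((h.contMDiffAt ht).comp t hsm.contMDiffAt).contMDiffWithinAt
  · intro t ht
    have hg := h.2.2.2.2 _ ht
    rw [geodesicEqAt_iff] at hg ⊢
    set x : ℝ → Model n := fun r => φ[γ (s + c * t)] (γ r) with hx
    have hd : ∀ f : ℝ → Model n, deriv (fun r => f (s + c * r)) = fun r => c • deriv f (s + c * r) := by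
      intro f
      funext r
      have h1 := deriv_comp_mul_left c (fun r => f (s + r)) r
      rwa [deriv_comp_const_add] at h1
    change geodesicDefect _ (fun r => x (s + c * r)) t = 0
    have hd1 := hd x
    have hd2 : deriv (deriv fun r => x (s + c * r)) t = c • c • deriv (deriv x) (s + c * t) := by
      rw [hd1, deriv_fun_const_smul_field, hd]
    rw [geodesicDefect, hd2, hd1]
    ext w
    have hg' := DFunLike.congr_fun hg w
    simp only [geodesicDefect, add_apply, christoffelDual_apply, map_smul, smul_apply,
      smul_eq_mul, zero_apply] at hg' ⊢
    -- Both the acceleration and the Christoffel term scale by `c ^ 2`.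
    linear_combination c * c * hg'

omit [IsManifold 𝓘(ℝ, Model n) ∞ M] in
theorem vel_comp_affine {γ : ℝ → M} {s c t : ℝ}
    (h : MDifferentiableAt 𝓘(ℝ, ℝ) 𝓘(ℝ, Model n) γ (s + c * t)) :
    vel n (fun t => γ (s + c * t)) t = c • vel n γ (s + c * t) := by
  have hd : HasDerivAt (fun t : ℝ => s + c * t) c t := by
    simpa using ((hasDerivAt_id t).const_mul c).const_add s
  have hm : HasMFDerivAt 𝓘(ℝ, ℝ) 𝓘(ℝ, ℝ) (fun t : ℝ => s + c * t) t _ := hd.hasFDerivAt.hasMFDerivAt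
  have h2 := (h.hasMFDerivAt.comp t hm).mfderiv
  have h3 := DFunLike.congr_fun h2 (1 : ℝ)
  refine Eq.trans h3 ?_
  have h4 : ∀ A : ℝ →L[ℝ] Model n, A ((1 : ℝ) • c) = c • A 1 := fun A => by
    rw [one_smul, ← map_smul, smul_eq_mul, mul_one]
  exact h4 _

end Spacetime
end

noncomputable section

set_option maxSynthPendingDepth 3

/-! ### Real analysis for curves of bounded logarithmic acceleration -/

/-- The logarithmic derivative of `r = h'` is bounded by `D * h'`, so `log r + D * h` and `D * h -
log r` are both increasing. A bound on the growth of `h` thus controls `r` from both sides. -/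
theorem exp_bounds_of_deriv_le_sq {h r r' : ℝ → ℝ} {T t D B : ℝ} (hTt : T ≤ t)
    (hh : ∀ s ∈ Icc T t, HasDerivAt h (r s) s) (hr : ∀ s ∈ Icc T t, HasDerivAt r (r' s) s)
    (hD : ∀ s ∈ Icc T t, |r' s| ≤ D * r s ^ 2) (hpos : ∀ s ∈ Icc T t, 0 < r s) (hD0 : 0 ≤ D)
    (hB : h t - h T ≤ B) :
    r T * Real.exp (-(D * B)) ≤ r t ∧ r t ≤ r T * Real.exp (D * B) := by
  have hlog : ∀ s ∈ Icc T t, HasDerivAt (fun s => Real.log (r s)) (r' s / r s) s := fun s hs =>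
    (hr s hs).log (hpos s hs).ne'
  have hq : ∀ s ∈ Icc T t, |r' s / r s| ≤ D * r s := fun s hs => by
    rw [abs_div, abs_of_pos (hpos s hs), div_le_iff₀ (hpos s hs)]
    calc _ ≤ _ := hD s hs
      _ = _ := by ring
  have hT : T ∈ Icc T t := ⟨le_rfl, hTt⟩
  have ht : t ∈ Icc T t := ⟨hTt, le_rfl⟩
  have m1 : MonotoneOn (fun s => Real.log (r s) + D * h s) (Icc T t) := by
    refine monotoneOn_of_hasDerivWithinAt_nonneg (convex_Icc T t)
      (f' := fun s => r' s / r s + D * r s) (fun s hs =>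
        ((hlog s hs).add ((hh s hs).const_mul D)).continuousAt.continuousWithinAt) ?_ ?_
    · intro s hs
      have hs' := interior_subset hs
      exact ((hlog s hs').add ((hh s hs').const_mul D)).hasDerivWithinAt
    · intro s hs
      linarith [(abs_le.1 (hq s (interior_subset hs))).1]
  have m2 : MonotoneOn (fun s => D * h s - Real.log (r s)) (Icc T t) := by
    refine monotoneOn_of_hasDerivWithinAt_nonneg (convex_Icc T t)
      (f' := fun s => D * r s - r' s / r s) (fun s hs =>
        (((hh s hs).const_mul D).sub (hlog s hs)).continuousAt.continuousWithinAt) ?_ ?_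
    · intro s hs
      have hs' := interior_subset hs
      exact (((hh s hs').const_mul D).sub (hlog s hs')).hasDerivWithinAt
    · intro s hs
      linarith [(abs_le.1 (hq s (interior_subset hs))).2]
  have e1 := m1 hT ht hTt
  have e2 := m2 hT ht hTt
  simp only at e1 e2
  have hDB := mul_le_mul_of_nonneg_left hB hD0
  have hrT : r T = Real.exp (Real.log (r T)) := (Real.exp_log (hpos T hT)).symm
  have hrt : r t = Real.exp (Real.log (r t)) := (Real.exp_log (hpos t ht)).symm
  constructor
  · rw [hrT, hrt, ← Real.exp_add]
    refine Real.exp_le_exp.2 ?_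
    nlinarith
  · rw [hrT, hrt, ← Real.exp_add]
    refine Real.exp_le_exp.2 ?_
    nlinarith

/-- The lower bound on `r` makes `h` grow at least linearly, so bounded growth of `h` leaves room
only for a parameter interval of bounded length. -/
theorem length_mul_le_of_deriv_le_sq {h r r' : ℝ → ℝ} {T t D B : ℝ} (hTt : T ≤ t)
    (hh : ∀ s ∈ Icc T t, HasDerivAt h (r s) s) (hr : ∀ s ∈ Icc T t, HasDerivAt r (r' s) s)
    (hD : ∀ s ∈ Icc T t, |r' s| ≤ D * r s ^ 2) (hpos : ∀ s ∈ Icc T t, 0 < r s) (hD0 : 0 ≤ D)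
    (hB : ∀ s ∈ Icc T t, h s - h T ≤ B) :
    (t - T) * (r T * Real.exp (-(D * B))) ≤ B := by
  have hlow : ∀ s ∈ Icc T t, r T * Real.exp (-(D * B)) ≤ r s := fun s hs =>
    (exp_bounds_of_deriv_le_sq hs.1 (fun q hq => hh q ⟨hq.1, hq.2.trans hs.2⟩)
      (fun q hq => hr q ⟨hq.1, hq.2.trans hs.2⟩) (fun q hq => hD q ⟨hq.1, hq.2.trans hs.2⟩)
      (fun q hq => hpos q ⟨hq.1, hq.2.trans hs.2⟩) hD0 (hB s hs)).1
  set m := r T * Real.exp (-(D * B))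
  have mono : MonotoneOn (fun s => h s - s * m) (Icc T t) := by
    refine monotoneOn_of_hasDerivWithinAt_nonneg (convex_Icc T t)
      (f' := fun s => r s - 1 * m) (fun s hs =>
        ((hh s hs).sub ((hasDerivAt_id s).mul_const m)).continuousAt.continuousWithinAt) ?_ ?_
    · intro s hs
      exact ((hh s (interior_subset hs)).sub ((hasDerivAt_id s).mul_const m)).hasDerivWithinAt
    · intro s hs
      linarith [hlow s (interior_subset hs)]
  have := mono ⟨le_rfl, hTt⟩ ⟨hTt, le_rfl⟩ hTt
  simp only at this
  have := hB t ⟨hTt, le_rfl⟩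
  nlinarith

/-- Every nonempty open interval is the image of the line under an increasing smooth map. -/
theorem exists_smooth_param {J : Set ℝ} (hJ : IsOpen J) (hJc : J.OrdConnected) (hJn : J.Nonempty) :
    ∃ θ θ' : ℝ → ℝ, ContDiff ℝ ∞ θ ∧ (∀ t, HasDerivAt θ (θ' t) t) ∧ (∀ t, 0 < θ' t) ∧
      range θ = J := by
  have hpre := hJc.isPreconnected
  have hmax : ∀ t ∈ J, ∃ s ∈ J, t < s := fun t ht => by
    have h1 : ∀ᶠ s in 𝓝[>] t, s ∈ J := mem_nhdsWithin_of_mem_nhds (hJ.mem_nhds ht)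
    obtain ⟨s, hs, hts⟩ := (h1.and self_mem_nhdsWithin).exists
    exact ⟨s, hs, hts⟩
  have hmin : ∀ t ∈ J, ∃ s ∈ J, s < t := fun t ht => by
    have h1 : ∀ᶠ s in 𝓝[<] t, s ∈ J := mem_nhdsWithin_of_mem_nhds (hJ.mem_nhds ht)
    obtain ⟨s, hs, hts⟩ := (h1.and self_mem_nhdsWithin).exists
    exact ⟨s, hs, hts⟩
  have hltsup : BddAbove J → ∀ t ∈ J, t < sSup J := fun hb t ht => by
    obtain ⟨s, hs, hts⟩ := hmax t ht
    exact hts.trans_le (le_csSup hb hs)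
  have hinflt : BddBelow J → ∀ t ∈ J, sInf J < t := fun hb t ht => by
    obtain ⟨s, hs, hts⟩ := hmin t ht
    exact (csInf_le hb hs).trans_lt hts
  -- A bounded interval is parametrised by a rescaled arctangent, a half-line by an exponential, the
  -- whole line by the identity.
  by_cases ha : BddAbove J <;> by_cases hb : BddBelow J
  · set a := sInf J
    set b := sSup J
    have hab : a < b := (hinflt hb _ hJn.some_mem).trans (hltsup ha _ hJn.some_mem)
    have hJeq : J = Ioo a b := Subset.antisymm (fun t ht => ⟨hinflt hb t ht, hltsup ha t ht⟩)
      (IsConnected.Ioo_csInf_csSup_subset ⟨hJn, hpre⟩ hb ha)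
    have hpi := Real.pi_pos
    have hba : 0 < b - a := sub_pos.2 hab
    refine ⟨fun t => (a + b) / 2 + (b - a) / Real.pi * Real.arctan t,
      fun t => (b - a) / Real.pi * (1 / (1 + t ^ 2)),
      contDiff_const.add (contDiff_const.mul Real.contDiff_arctan),
      fun t => ((Real.hasDerivAt_arctan t).const_mul _).const_add _, fun t => by positivity, ?_⟩
    rw [hJeq]
    ext y
    constructor
    · rintro ⟨t, rfl⟩
      have h1 := Real.neg_pi_div_two_lt_arctan t
      have h2 := Real.arctan_lt_pi_div_two t
      have e : (b - a) / Real.pi * (Real.pi / 2) = (b - a) / 2 := by field_simp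
      have hc : 0 < (b - a) / Real.pi := by positivity
      constructor <;> simp only <;> nlinarith
    · rintro ⟨h1, h2⟩
      refine ⟨Real.tan ((y - (a + b) / 2) * (Real.pi / (b - a))), ?_⟩
      have e : (b - a) / 2 * (Real.pi / (b - a)) = Real.pi / 2 := by field_simp
      have hc : 0 < Real.pi / (b - a) := by positivity
      simp only
      rw [Real.arctan_tan (by nlinarith) (by nlinarith)]
      field_simp
      ring
  · have hJeq : J = Iio (sSup J) := Subset.antisymm (fun t ht => hltsup ha t ht)
      (hpre.Iio_csSup_subset hb ha)
    refine ⟨fun t => sSup J - Real.exp (-t), fun t => Real.exp (-t), by fun_prop, fun t => ?_,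
      fun t => Real.exp_pos _, ?_⟩
    · simpa using ((hasDerivAt_neg t).exp).const_sub (sSup J)
    · conv_rhs => rw [hJeq]
      ext y
      constructor
      · rintro ⟨t, rfl⟩
        simp [Real.exp_pos]
      · intro h
        refine ⟨-Real.log (sSup J - y), ?_⟩
        simp only [neg_neg]
        rw [Real.exp_log (sub_pos.2 h)]
        ring
  · have hJeq : J = Ioi (sInf J) := Subset.antisymm (fun t ht => hinflt hb t ht)
      (hpre.Ioi_csInf_subset hb ha)
    refine ⟨fun t => sInf J + Real.exp t, fun t => Real.exp t, by fun_prop,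
      fun t => (Real.hasDerivAt_exp t).const_add _, fun t => Real.exp_pos _, ?_⟩
    conv_rhs => rw [hJeq]
    ext y
    constructor
    · rintro ⟨t, rfl⟩
      simp [Real.exp_pos]
    · intro h
      refine ⟨Real.log (y - sInf J), ?_⟩
      simp only
      rw [Real.exp_log (sub_pos.2 h)]
      ring
  · have hJeq : J = univ := hpre.eq_univ_of_unbounded hb ha
    exact ⟨id, fun _ => 1, contDiff_id, hasDerivAt_id, fun _ => one_pos, by simp [hJeq]⟩

namespace Spacetime

variable {n : ℕ} {M : Type*} [TopologicalSpace M] [ChartedSpace (Model n) M]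
  [IsManifold 𝓘(ℝ, Model n) ∞ M]

local notation "φ[" x₀ "]" => extChartAt (modelWithCornersSelf ℝ (Model n)) x₀

/-! ### Maximal geodesics -/

omit [IsManifold 𝓘(ℝ, Model n) ∞ M] in
theorem vel_congr {γ γ' : ℝ → M} {t : ℝ} (h : γ =ᶠ[𝓝 t] γ') : vel n γ t = vel n γ' t :=
  DFunLike.congr_fun h.mfderiv_eq (1 : ℝ)

theorem exists_geodesic (𝔤 : Spacetime n M) (p : M) (v : Model n) : ∃ (γ : ℝ → M) (J : Set ℝ),
    𝔤.IsGeodesic γ J ∧ 0 ∈ J ∧ γ 0 = p ∧ vel n γ 0 = v := by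
  obtain ⟨r, hr, ε, hε, h⟩ := 𝔤.exists_local_geodesic (mem_extChartAt_target p) v
  obtain ⟨σ, hσ, -, h0, h1⟩ := h (φ[p] p) v (by simpa using hr.le) (by simpa using hr.le)
  have h00 : (0 : ℝ) ∈ Ioo (-ε) ε := ⟨by linarith, hε⟩
  rw [(φ[p]).left_inv (mem_extChartAt_source p)] at h0
  refine ⟨σ, _, hσ, h00, h0, ?_⟩
  rw [deriv_chart (hσ.mdifferentiableAt h00) (by rw [h0]; exact mem_extChartAt_source p), h0,
    chartDeriv_self] at h1
  exact h1

/-- All geodesics with the given initial data agree where they overlap, so their union is a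
geodesic; any extension of it is again one of them. -/
theorem exists_maximal_geodesic [T2Space M] (𝔤 : Spacetime n M) (p : M) (v : Model n) :
    ∃ (γ : ℝ → M) (J : Set ℝ), 𝔤.IsGeodesic γ J ∧ 0 ∈ J ∧ γ 0 = p ∧ vel n γ 0 = v ∧
      ∀ (γ' : ℝ → M) (J' : Set ℝ), 𝔤.IsGeodesic γ' J' → J ⊆ J' → EqOn γ γ' J → J' = J := by
  classical
  let 𝓕 : Set ((ℝ → M) × Set ℝ) :=
    {P | 𝔤.IsGeodesic P.1 P.2 ∧ 0 ∈ P.2 ∧ P.1 0 = p ∧ vel n P.1 0 = v}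
  let J : Set ℝ := ⋃ P ∈ 𝓕, P.2
  let γ : ℝ → M := fun t => if h : ∃ P ∈ 𝓕, t ∈ P.2 then h.choose.1 t else p
  have heq : ∀ P ∈ 𝓕, EqOn γ P.1 P.2 := by
    intro P hP t ht
    have h : ∃ P ∈ 𝓕, t ∈ P.2 := ⟨P, hP, ht⟩
    have hγ : γ t = h.choose.1 t := dif_pos h
    obtain ⟨hQ, hQt⟩ := h.choose_spec
    rw [hγ]
    exact hQ.1.eqOn hP.1 hQ.2.1 hP.2.1 (hQ.2.2.1.trans hP.2.2.1.symm)
      (hQ.2.2.2.trans hP.2.2.2.symm) ⟨hQt, ht⟩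
  have hev : ∀ P ∈ 𝓕, ∀ t ∈ P.2, γ =ᶠ[𝓝 t] P.1 := fun P hP t ht =>
    (heq P hP).eventuallyEq_of_mem (hP.1.1.mem_nhds ht)
  obtain ⟨γ₀, J₀, h₀⟩ := 𝔤.exists_geodesic p v
  have hP₀ : (γ₀, J₀) ∈ 𝓕 := h₀
  have hmemJ : ∀ t, t ∈ J ↔ ∃ P ∈ 𝓕, t ∈ P.2 := fun t => by simp [J]
  have h0J : 0 ∈ J := (hmemJ 0).2 ⟨_, hP₀, h₀.2.1⟩
  have hgeo : 𝔤.IsGeodesic γ J := by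
    refine ⟨isOpen_biUnion fun P hP => hP.1.1, ?_, ⟨0, h0J⟩, ?_, ?_⟩
    · rw [← isPreconnected_iff_ordConnected]
      refine isPreconnected_of_forall 0 fun t ht => ?_
      obtain ⟨P, hP, htP⟩ := (hmemJ t).1 ht
      exact ⟨P.2, fun s hs => (hmemJ s).2 ⟨P, hP, hs⟩, hP.2.1, htP, hP.1.2.1.isPreconnected⟩
    · intro t ht
      obtain ⟨P, hP, htP⟩ := (hmemJ t).1 ht
      exact ((hP.1.contMDiffAt htP).congr_of_eventuallyEq (hev P hP t htP)).contMDiffWithinAt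
    · intro t ht
      obtain ⟨P, hP, htP⟩ := (hmemJ t).1 ht
      exact (hP.1.2.2.2.2 t htP).congr (hev P hP t htP)
  have hγ0 : γ 0 = p := (heq _ hP₀ h₀.2.1).trans h₀.2.2.1
  have hv0 : vel n γ 0 = v := (vel_congr (hev _ hP₀ 0 h₀.2.1)).trans h₀.2.2.2
  refine ⟨γ, J, hgeo, h0J, hγ0, hv0, fun γ' J' hγ' hJJ' hE => ?_⟩
  refine Subset.antisymm (fun t ht => (hmemJ t).2 ⟨(γ', J'), ⟨hγ', hJJ' h0J, ?_, ?_⟩, ht⟩) hJJ'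
  · exact (hE h0J).symm.trans hγ0
  · exact (vel_congr (hE.eventuallyEq_of_mem (hgeo.1.mem_nhds h0J))).symm.trans hv0

/-! ### Conservation of the causal character -/

theorem IsGeodesic.hasDerivAt_deriv_chart {𝔤 : Spacetime n M} {γ : ℝ → M} {J : Set ℝ}
    (h : 𝔤.IsGeodesic γ J) {t : ℝ} (ht : t ∈ J) {x₀ : M} (hs : γ t ∈ (φ[x₀]).source) :
    HasDerivAt (deriv fun s => φ[x₀] (γ s)) (𝔤.accel x₀ (φ[x₀] (γ t))
      (deriv (fun s => φ[x₀] (γ s)) t)) t := by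
  have hc := contDiffAt_chart_comp (h.contMDiffAt ht) hs
  have hd2 : DifferentiableAt ℝ (deriv fun s => φ[x₀] (γ s)) t :=
    ((hc.fderiv_right (m := ∞) (by simp)).differentiableAt (by simp)).clm_apply
      (differentiableAt_const (1 : ℝ))
  have := hd2.hasDerivAt
  rwa [h.deriv_deriv_chart ht hs] at this

theorem IsGeodesic.hasDerivAt_chart {𝔤 : Spacetime n M} {γ : ℝ → M} {J : Set ℝ}
    (h : 𝔤.IsGeodesic γ J) {t : ℝ} (ht : t ∈ J) {x₀ : M} (hs : γ t ∈ (φ[x₀]).source) :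
    HasDerivAt (fun s => φ[x₀] (γ s)) (deriv (fun s => φ[x₀] (γ s)) t) t :=
  ((contDiffAt_chart_comp (h.contMDiffAt ht) hs).differentiableAt (by simp)).hasDerivAt

/-- The derivative of the squared length of the velocity is twice the defect paired with the
velocity. -/
theorem hasDerivAt_form_of_geodesicDefect {E : Type*} [NormedAddCommGroup E] [NormedSpace ℝ E]
    {G : E → E →L[ℝ] E →L[ℝ] ℝ} {x : ℝ → E} {t : ℝ} (hG : DifferentiableAt ℝ G (x t))
    (hsymm : ∀ u v, G (x t) u v = G (x t) v u) (hx : HasDerivAt x (deriv x t) t)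
    (hx2 : HasDerivAt (deriv x) (deriv (deriv x) t) t) (h : geodesicDefect G x t = 0) :
    HasDerivAt (fun s => G (x s) (deriv x s) (deriv x s)) 0 t := by
  have h1 : HasDerivAt (fun s => G (x s)) (fderiv ℝ G (x t) (deriv x t)) t :=
    hG.hasFDerivAt.comp_hasDerivAt t hx
  have h2 := (h1.clm_apply hx2).clm_apply hx2
  refine h2.congr_deriv ?_
  have h3 := DFunLike.congr_fun h (deriv x t)
  simp only [geodesicDefect, add_apply, christoffelDual_apply, zero_apply] at h3 ⊢
  rw [hsymm (deriv x t) (deriv (deriv x) t)]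
  linear_combination 2 * h3

theorem IsGeodesic.hasDerivAt_form {𝔤 : Spacetime n M} {γ : ℝ → M} {J : Set ℝ}
    (h : 𝔤.IsGeodesic γ J) {t : ℝ} (ht : t ∈ J) :
    HasDerivAt (fun s => 𝔤.form (γ s) (vel n γ s) (vel n γ s)) 0 t := by
  have hs := mem_extChartAt_source (I := 𝓘(ℝ, Model n)) (γ t)
  have hyt := mem_extChartAt_target (I := 𝓘(ℝ, Model n)) (γ t)
  have h2 := h.hasDerivAt_deriv_chart ht hs
  rw [← h.deriv_deriv_chart ht hs] at h2
  have key := hasDerivAt_form_of_geodesicDefect (E := Model n) (G := 𝔤.chartForm (γ t))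
    (x := fun s => φ[γ t] (γ s)) (t := t)
    ((𝔤.contDiffAt_chartForm hyt).differentiableAt (by simp))
    (𝔤.isLorentzForm_chartForm (γ t) hyt).symm (h.hasDerivAt_chart ht hs) h2
    ((𝔤.geodesicEqAt_iff γ t).1 (h.2.2.2.2 t ht))
  refine key.congr_of_eventuallyEq ?_
  filter_upwards [(h.continuousAt ht).preimage_mem_nhds
    ((isOpen_extChartAt_source (γ t)).mem_nhds hs), h.1.mem_nhds ht] with s hs' hsJ
  rw [deriv_chart (h.mdifferentiableAt hsJ) hs', chartForm_chartDeriv _ hs']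

theorem IsGeodesic.form_vel_eq {𝔤 : Spacetime n M} {γ : ℝ → M} {J : Set ℝ}
    (h : 𝔤.IsGeodesic γ J) {s t : ℝ} (hs : s ∈ J) (ht : t ∈ J) :
    𝔤.form (γ s) (vel n γ s) (vel n γ s) = 𝔤.form (γ t) (vel n γ t) (vel n γ t) :=
  h.1.is_const_of_deriv_eq_zero h.2.1.isPreconnected
    (fun _ hr => (h.hasDerivAt_form hr).differentiableAt.differentiableWithinAt)
    (fun _ hr => (h.hasDerivAt_form hr).deriv) hs ht

theorem IsGeodesic.continuousOn_form_timeVec {𝔤 : Spacetime n M} {γ : ℝ → M} {J : Set ℝ}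
    (h : 𝔤.IsGeodesic γ J) :
    ContinuousOn (fun s => 𝔤.form (γ s) (𝔤.timeVec (γ s)) (vel n γ s)) J := by
  intro t ht
  have hs := mem_extChartAt_source (I := 𝓘(ℝ, Model n)) (γ t)
  have hyt := mem_extChartAt_target (I := 𝓘(ℝ, Model n)) (γ t)
  have hx := (h.hasDerivAt_chart ht hs).continuousAt
  have h1 : ContinuousAt (fun s => 𝔤.chartForm (γ t) (φ[γ t] (γ s))) t :=
    ContinuousAt.comp (g := 𝔤.chartForm (γ t)) (𝔤.continuousAt_chartForm hyt) hx
  have h2 : ContinuousAt (fun s => 𝔤.chartTimeVec (γ t) (φ[γ t] (γ s))) t :=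
    ContinuousAt.comp (g := 𝔤.chartTimeVec (γ t)) (𝔤.continuousAt_chartTimeVec hyt) hx
  have h3 := (h.hasDerivAt_deriv_chart ht hs).continuousAt
  refine ContinuousAt.continuousWithinAt (((h1.clm_apply h2).clm_apply h3).congr ?_)
  filter_upwards [(h.continuousAt ht).preimage_mem_nhds
    ((isOpen_extChartAt_source (γ t)).mem_nhds hs), h.1.mem_nhds ht] with s hsrc hsJ
  rw [deriv_chart (h.mdifferentiableAt hsJ) hsrc, chartTimeVec_apply _ hsrc,
    chartForm_chartDeriv _ hsrc]

/-- A geodesic that is future timelike at one parameter is future timelike. -/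
theorem IsGeodesic.futureTimelike {𝔤 : Spacetime n M} {γ : ℝ → M} {J : Set ℝ}
    (h : 𝔤.IsGeodesic γ J) {s t : ℝ} (hs : s ∈ J) (ht : t ∈ J)
    (hfut : 𝔤.FutureTimelike (γ s) (vel n γ s)) : 𝔤.FutureTimelike (γ t) (vel n γ t) := by
  have hneg : ∀ r ∈ J, 𝔤.form (γ r) (vel n γ r) (vel n γ r) < 0 := fun r hr => by
    rw [h.form_vel_eq hr hs]
    exact hfut.1
  have hne : ∀ r ∈ J, 𝔤.form (γ r) (𝔤.timeVec (γ r)) (vel n γ r) ≠ 0 := fun r hr =>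
    (𝔤.isLorentzForm_form (γ r)).apply_ne_zero (𝔤.form_timeVec (γ r))
      (fun h0 => by have := hneg r hr; rw [h0] at this; simp at this) (hneg r hr).le
  refine ⟨hneg t ht, ?_⟩
  change 𝔤.form (γ t) (𝔤.timeVec (γ t)) (vel n γ t) < 0
  by_contra! hcon
  -- A change of time direction would require a parameter at which the timelike velocity is
  -- orthogonal to the time field.
  obtain ⟨r, hr, hr0⟩ := h.2.1.isPreconnected.intermediate_value hs ht
    h.continuousOn_form_timeVec ⟨(show 𝔤.form (γ s) (𝔤.timeVec (γ s)) (vel n γ s) < 0 from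
      hfut.2).le, hcon⟩
  exact hne r hr hr0

/-! ### Maximal causal geodesics have no endpoints -/

/-- A causal geodesic with a limit at its upper end can be extended. -/
theorem IsGeodesic.exists_extension [T2Space M] {𝔤 : Spacetime n M} {γ : ℝ → M} {J : Set ℝ}
    (h : 𝔤.IsGeodesic γ J) {σ : ℝ} (hσ : |σ| = 1)
    (hcausal : ∀ t ∈ J, 𝔤.FutureCausal (γ t) (σ • vel n γ t)) {q : M}
    (hlim : ∀ W ∈ 𝓝 q, ∃ T ∈ J, ∀ t ∈ J, T ≤ t → γ t ∈ W) :
    ∃ (γ' : ℝ → M) (J' : Set ℝ), 𝔤.IsGeodesic γ' J' ∧ J ⊆ J' ∧ EqOn γ γ' J ∧ J' ≠ J := by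
  have hqs := mem_extChartAt_source (I := 𝓘(ℝ, Model n)) q
  have hqt := mem_extChartAt_target (I := 𝓘(ℝ, Model n)) q
  obtain ⟨κ, hκ, hκe⟩ := 𝔤.exists_causal_bound hqt
  obtain ⟨C, hC, hacc⟩ := 𝔤.exists_accel_bound hqt
  set y₀ := φ[q] q with hy₀
  -- A linear coordinate that increases along the curve at a rate of at least `κ` times the
  -- coordinate speed. The sign `σ` treats future-directed and past-directed curves together.
  set τ : Model n →L[ℝ] ℝ := (-σ) • 𝔤.chartForm q y₀ (𝔤.chartTimeVec q y₀) with hτ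
  have e1 : ∀ᶠ y in 𝓝 y₀, ∀ u, 𝔤.ChartCausal q y (σ • u) → κ * ‖u‖ ≤ τ u := by
    have := (Continuous.tendsto (f := fun y : Model n => (y, y₀)) (by fun_prop) y₀).eventually hκe
    filter_upwards [this] with y hy u hu
    have h1 := hy _ hu
    simp only [map_smul, smul_eq_mul, norm_smul, Real.norm_eq_abs, hσ, one_mul] at h1
    simp only [hτ, smul_apply, smul_eq_mul]
    linarith
  have e2 : ∀ᶠ y in 𝓝 y₀, |τ y - τ y₀| < 1 := by
    have := τ.continuous.continuousAt.tendsto.eventually (Metric.ball_mem_nhds (τ y₀) one_pos)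
    simpa [Metric.mem_ball, Real.dist_eq] using this
  obtain ⟨T, hTJ, hT⟩ := hlim _ (chart_preimage_mem_nhds hqs (e1.and (e2.and hacc)))
  set x : ℝ → Model n := fun t => φ[q] (γ t) with hx
  have hsrc : ∀ t ∈ J, T ≤ t → γ t ∈ (φ[q]).source := fun t ht hTt => (hT t ht hTt).1
  have hxd : ∀ t ∈ J, T ≤ t → HasDerivAt x (deriv x t) t := fun t ht hTt =>
    h.hasDerivAt_chart ht (hsrc t ht hTt)
  have hxdd : ∀ t ∈ J, T ≤ t → HasDerivAt (deriv x) (𝔤.accel q (x t) (deriv x t)) t :=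
    fun t ht hTt => h.hasDerivAt_deriv_chart ht (hsrc t ht hTt)
  have hτx : ∀ t ∈ J, T ≤ t → κ * ‖deriv x t‖ ≤ τ (deriv x t) ∧ 0 < ‖deriv x t‖ := by
    intro t ht hTt
    have hc := (𝔤.futureCausal_iff_chart (hsrc t ht hTt) _).1 (hcausal t ht)
    rw [map_smul, ← deriv_chart (h.mdifferentiableAt ht) (hsrc t ht hTt)] at hc
    refine ⟨(hT t ht hTt).2.1 _ hc, norm_pos_iff.2 fun h0 => hc.1 ?_⟩
    change σ • deriv x t = 0
    rw [h0, smul_zero]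
  have hpos : ∀ t ∈ J, T ≤ t → 0 < τ (deriv x t) := fun t ht hTt =>
    (mul_pos hκ (hτx t ht hTt).2).trans_le (hτx t ht hTt).1
  have hhd : ∀ t ∈ J, T ≤ t → HasDerivAt (fun s => τ (x s)) (τ (deriv x t)) t := fun t ht hTt =>
    τ.hasFDerivAt.comp_hasDerivAt t (hxd t ht hTt)
  have hrd : ∀ t ∈ J, T ≤ t → HasDerivAt (fun s => τ (deriv x s))
      (τ (𝔤.accel q (x t) (deriv x t))) t := fun t ht hTt =>
    τ.hasFDerivAt.comp_hasDerivAt t (hxdd t ht hTt)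
  -- The acceleration is at most `C ‖x'‖²`, and `‖x'‖ ≤ τ x' / κ`.
  set D := ‖τ‖ * C / κ ^ 2 with hD
  have hD0 : 0 ≤ D := by positivity
  have hDr : ∀ t ∈ J, T ≤ t → |τ (𝔤.accel q (x t) (deriv x t))| ≤ D * (τ (deriv x t)) ^ 2 := by
    intro t ht hTt
    have h1 : |τ (𝔤.accel q (x t) (deriv x t))| ≤ ‖τ‖ * ‖𝔤.accel q (x t) (deriv x t)‖ :=
      τ.le_opNorm _
    have h2 : ‖𝔤.accel q (x t) (deriv x t)‖ ≤ C * (‖deriv x t‖ * ‖deriv x t‖) :=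
      (hT t ht hTt).2.2.2 _
    have h3 : (κ * ‖deriv x t‖) ^ 2 ≤ (τ (deriv x t)) ^ 2 :=
      pow_le_pow_left₀ (by positivity) (hτx t ht hTt).1 2
    calc _ ≤ ‖τ‖ * (C * (‖deriv x t‖ * ‖deriv x t‖)) := h1.trans (by gcongr)
      _ = D * (κ * ‖deriv x t‖) ^ 2 := by rw [hD]; field_simp
      _ ≤ _ := by gcongr
  -- Both values of `τ` are within `1` of its value at the limit point. The growth of `τ` is
  -- therefore bounded, and with it the parameter length and the speed.
  have hB : ∀ t ∈ J, T ≤ t → τ (x t) - τ (x T) ≤ 2 := by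
    intro t ht hTt
    have a1 := abs_lt.1 (hT t ht hTt).2.2.1
    have a2 := abs_lt.1 (hT T hTJ le_rfl).2.2.1
    change τ (φ[q] (γ t)) - τ (φ[q] (γ T)) ≤ 2
    linarith
  have hsubJ : ∀ t ∈ J, T ≤ t → ∀ s ∈ Icc T t, s ∈ J := fun t ht hTt s hs =>
    h.2.1.out hTJ ht hs
  have hup : ∀ t ∈ J, T ≤ t → τ (deriv x t) ≤ τ (deriv x T) * Real.exp (D * 2) :=
    fun t ht hTt => (exp_bounds_of_deriv_le_sq hTt
      (fun s hs => hhd s (hsubJ t ht hTt s hs) hs.1) (fun s hs => hrd s (hsubJ t ht hTt s hs) hs.1)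
      (fun s hs => hDr s (hsubJ t ht hTt s hs) hs.1) (fun s hs => hpos s (hsubJ t ht hTt s hs) hs.1)
      hD0 (hB t ht hTt)).2
  set m := τ (deriv x T) * Real.exp (-(D * 2)) with hm
  have hm0 : 0 < m := mul_pos (hpos T hTJ le_rfl) (Real.exp_pos _)
  have hlen : ∀ t ∈ J, T ≤ t → t ≤ T + 2 / m := by
    intro t ht hTt
    have := length_mul_le_of_deriv_le_sq hTt
      (fun s hs => hhd s (hsubJ t ht hTt s hs) hs.1) (fun s hs => hrd s (hsubJ t ht hTt s hs) hs.1)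
      (fun s hs => hDr s (hsubJ t ht hTt s hs) hs.1) (fun s hs => hpos s (hsubJ t ht hTt s hs) hs.1)
      hD0 (fun s hs => hB s (hsubJ t ht hTt s hs) hs.1)
    rw [← hm, ← le_div_iff₀ hm0] at this
    linarith
  have hbdd : BddAbove J := ⟨T + 2 / m, fun t ht => by
    rcases le_total T t with hTt | hTt
    · exact hlen t ht hTt
    · have : 0 < 2 / m := by positivity
      linarith⟩
  set b := sSup J
  have hltb : ∀ t ∈ J, t < b := fun t ht => by
    have h1 : ∀ᶠ s in 𝓝[>] t, s ∈ J := mem_nhdsWithin_of_mem_nhds (h.1.mem_nhds ht)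
    obtain ⟨s, hs, hts⟩ := (h1.and self_mem_nhdsWithin).exists
    exact (show t < s from hts).trans_le (le_csSup hbdd hs)
  have hbJ : b ∉ J := fun hb => lt_irrefl _ (hltb b hb)
  obtain ⟨u, -, hu, huJ⟩ := exists_seq_tendsto_sSup h.2.2.1 hbdd
  have huT : ∀ s ∈ J, ∀ᶠ i in atTop, s ≤ u i := fun s hs =>
    (hu.eventually_const_lt (hltb s hs)).mono fun _ h => h.le
  obtain ⟨N, hN⟩ := eventually_atTop.1 (huT T hTJ)
  set R := τ (deriv x T) * Real.exp (D * 2) / κ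
  have hR : ∀ i, deriv x (u (i + N)) ∈ Metric.closedBall (0 : Model n) R := by
    intro i
    have hTi := hN (i + N) (Nat.le_add_left _ _)
    rw [mem_closedBall_zero_iff, le_div_iff₀ hκ, mul_comm]
    exact (hτx _ (huJ _) hTi).1.trans (hup _ (huJ _) hTi)
  -- Velocities along parameters tending to `b` subconverge to some `v`. Geodesics with data near
  -- the limit point and `v` live for a uniform time `ε`, so one started within `ε` of `b` passes
  -- beyond `b`.
  obtain ⟨v, -, ψ, hψ, hv⟩ := (isCompact_closedBall (0 : Model n) R).tendsto_subseq hR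
  obtain ⟨r, hr, ε, hε, hloc⟩ := 𝔤.exists_local_geodesic hqt v
  have hidx : Tendsto (fun i => ψ i + N) atTop atTop :=
    (tendsto_add_atTop_nat N).comp hψ.tendsto_atTop
  have hxy : ∀ᶠ i in atTop, ‖x (u i) - y₀‖ ≤ r := by
    obtain ⟨T', hT'J, hT'⟩ := hlim _ (chart_preimage_mem_nhds hqs (Metric.ball_mem_nhds y₀ hr))
    filter_upwards [huT T' hT'J] with i hi
    have := (hT' _ (huJ i) hi).2
    rw [mem_ball_iff_norm] at this
    exact this.le
  have hvv : ∀ᶠ i in atTop, ‖deriv x (u (ψ i + N)) - v‖ ≤ r := by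
    filter_upwards [hv.eventually_mem (Metric.ball_mem_nhds v hr)] with i hi
    rw [mem_ball_iff_norm] at hi
    exact hi.le
  have hbε : ∀ᶠ i in atTop, b - ε < u i := hu.eventually_const_lt (by linarith)
  obtain ⟨i, hi1, hi2, hi3, hi4⟩ := ((hidx.eventually hxy).and (hvv.and
    ((hidx.eventually hbε).and (hidx.eventually (huT T hTJ))))).exists
  set t₀ := u (ψ i + N) with ht₀
  have ht₀J : t₀ ∈ J := huJ _
  obtain ⟨ρ, hρ, -, hρ0, hρ1⟩ := hloc _ _ hi1 hi2
  rw [hx] at hρ0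
  simp only at hρ0
  rw [(φ[q]).left_inv (hsrc _ ht₀J hi4)] at hρ0
  have hρ' := hρ.comp_affine (-t₀) one_ne_zero
  set I : Set ℝ := {t | -t₀ + 1 * t ∈ Ioo (-ε) ε} with hI
  have ht₀I : t₀ ∈ I := by
    simp only [hI, one_mul]
    change -t₀ + t₀ ∈ Ioo (-ε) ε
    rw [neg_add_cancel]
    exact ⟨by linarith, hε⟩
  have hbI : b ∈ I := by
    change -t₀ + 1 * b ∈ Ioo (-ε) ε
    have := hltb t₀ ht₀J
    constructor <;> linarith
  have hinit : γ t₀ = ρ (-t₀ + 1 * t₀) := by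
    rw [one_mul, neg_add_cancel, hρ0]
  have hderiv : deriv x t₀ = deriv (fun s => φ[q] (ρ (-t₀ + 1 * s))) t₀ := by
    simp only [one_mul]
    rw [deriv_comp_const_add (f := fun s => φ[q] (ρ s)), neg_add_cancel, hρ1]
  have hev := h.eventuallyEq hρ' ht₀J ht₀I (hsrc _ ht₀J hi4) hinit hderiv
  have hEq := h.eqOn_of_eventuallyEq hρ' ht₀J ht₀I hev
  obtain ⟨γ', hγ', hE1, -⟩ := h.exists_union hρ' ⟨t₀, ht₀J, ht₀I⟩ hEq
  refine ⟨γ', _, hγ', subset_union_left, hE1.symm, fun hcon => hbJ ?_⟩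
  rw [← hcon]
  exact Or.inr hbI

end Spacetime
end

noncomputable section
set_option maxSynthPendingDepth 3
namespace Spacetime
variable {n : ℕ} {M : Type*} [TopologicalSpace M] [ChartedSpace (Model n) M]
  [IsManifold 𝓘(ℝ, Model n) ∞ M]

/-! ### Reparametrisation of causal curves -/

theorem FutureCausal.smul {𝔤 : Spacetime n M} {x : M} {v : TSp n x} (h : 𝔤.FutureCausal x v)
    {c : ℝ} (hc : 0 < c) : 𝔤.FutureCausal x (c • v) := by
  refine ⟨smul_ne_zero hc.ne' h.1, ?_, ?_⟩
  · have : 𝔤.g x (c • v) (c • v) = c * (c * 𝔤.g x v v) := by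
      simp only [map_smul, smul_apply, smul_eq_mul]
    rw [this]
    exact mul_nonpos_of_nonneg_of_nonpos hc.le
      (mul_nonpos_of_nonneg_of_nonpos hc.le h.2.1)
  · have : 𝔤.g x (𝔤.timeField x) (c • v) = c * 𝔤.g x (𝔤.timeField x) v := by
      simp only [map_smul, smul_eq_mul]
    rw [this]
    exact mul_neg_of_pos_of_neg hc h.2.2

theorem CausalSegment.comp {𝔤 : Spacetime n M} {c : ℝ → M} {θ θ' : ℝ → ℝ} {a b : ℝ}
    (h : 𝔤.CausalSegment c (θ a) (θ b)) (hab : a < b) (hθ : ContDiff ℝ 1 θ)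
    (hd : ∀ t, HasDerivAt θ (θ' t) t) (hpos : ∀ t, 0 < θ' t) :
    𝔤.CausalSegment (fun t => c (θ t)) a b := by
  have hmono : StrictMono θ := strictMono_of_deriv_pos fun t => by rw [(hd t).deriv]; exact hpos t
  have hmaps : MapsTo θ (Icc a b) (Icc (θ a) (θ b)) := fun t ht =>
    ⟨hmono.monotone ht.1, hmono.monotone ht.2⟩
  refine ⟨hab, h.2.1.comp hθ.contMDiff.contMDiffOn hmaps, fun t ht => ?_⟩
  have hu : UniqueMDiffWithinAt 𝓘(ℝ, ℝ) (Icc a b) t :=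
    (uniqueDiffOn_Icc hab t ht).uniqueMDiffWithinAt
  have hm : HasMFDerivWithinAt 𝓘(ℝ, ℝ) 𝓘(ℝ, ℝ) θ (Icc a b) t _ :=
    (hd t).hasFDerivAt.hasMFDerivAt.hasMFDerivWithinAt
  have hc := ((h.2.1 _ (hmaps ht)).mdifferentiableWithinAt (by simp)).hasMFDerivWithinAt
  have h2 := (hc.comp t hm hmaps).mfderivWithin hu
  have h3 : mfderivWithin 𝓘(ℝ, ℝ) 𝓘(ℝ, Model n) (fun t => c (θ t)) (Icc a b) t (1 : ℝ) =
      θ' t • (mfderivWithin 𝓘(ℝ, ℝ) 𝓘(ℝ, Model n) c (Icc (θ a) (θ b)) (θ t) (1 : ℝ) :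
        TSp n (c (θ t))) := by
    have h4 := DFunLike.congr_fun h2 (1 : ℝ)
    refine h4.trans ?_
    have h5 : ∀ L : ℝ →L[ℝ] Model n, L (θ' t) = θ' t • L 1 := fun L => by
      rw [← map_smul]; simp
    refine Eq.trans ?_ (h5 _)
    exact congrArg (mfderivWithin 𝓘(ℝ, ℝ) 𝓘(ℝ, Model n) c (Icc (θ a) (θ b)) (θ t))
      (one_mul (θ' t))
  rw [h3]
  exact (h.2.2 _ (hmaps ht)).smul (hpos t)

theorem CausalSegment.shift {𝔤 : Spacetime n M} {c : ℝ → M} {a b : ℝ}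
    (h : 𝔤.CausalSegment c a b) (k : ℝ) :
    𝔤.CausalSegment (fun t => c (k + t)) (a - k) (b - k) :=
  CausalSegment.comp (θ := fun t => k + t) (θ' := fun _ => 1) (by simpa using h)
    (by linarith [h.1]) (by fun_prop) (fun t => (hasDerivAt_id t).const_add k) fun _ => one_pos

theorem IsGeodesic.causalSegment {𝔤 : Spacetime n M} {γ : ℝ → M} {J : Set ℝ}
    (h : 𝔤.IsGeodesic γ J) (hc : ∀ t ∈ J, 𝔤.FutureCausal (γ t) (velocity n γ t)) {a b : ℝ}
    (ha : a ∈ J) (hb : b ∈ J) (hab : a < b) : 𝔤.CausalSegment γ a b := by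
  have hsub : Icc a b ⊆ J := h.2.1.out ha hb
  refine ⟨hab, (h.2.2.2.1.mono hsub).of_le (by simp), fun t ht => ?_⟩
  rw [mfderivWithin_eq_mfderiv (uniqueDiffOn_Icc hab t ht).uniqueMDiffWithinAt
    (h.mdifferentiableAt (hsub ht))]
  exact hc t (hsub ht)

/-- A limit at the upper end would allow an extension, against maximality. The lower end is treated
by reversing the geodesic and taking `σ = -1`. The parametrisation by the line is what the
definition of a Cauchy surface asks for. -/
theorem IsGeodesic.exists_inextendible [T2Space M] {𝔤 : Spacetime n M} {γ : ℝ → M} {J : Set ℝ}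
    (h : 𝔤.IsGeodesic γ J) (hc : ∀ t ∈ J, 𝔤.FutureCausal (γ t) (velocity n γ t))
    (hmax : ∀ (γ' : ℝ → M) (J' : Set ℝ), 𝔤.IsGeodesic γ' J' → J ⊆ J' → EqOn γ γ' J → J' = J) :
    ∃ θ : ℝ → ℝ, StrictMono θ ∧ range θ = J ∧ 𝔤.InextendibleCausalCurve (fun t => γ (θ t)) := by
  obtain ⟨θ, θ', hθ, hd, hpos, hran⟩ := exists_smooth_param h.1 h.2.1 h.2.2.1
  have hmono : StrictMono θ := strictMono_of_deriv_pos fun t => by rw [(hd t).deriv]; exact hpos t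
  have hmem : ∀ t, θ t ∈ J := fun t => hran ▸ mem_range_self t
  have hseg : ∀ a b, a < b → 𝔤.CausalSegment (fun t => γ (θ t)) a b := fun a b hab =>
    CausalSegment.comp (h.causalSegment hc (hmem a) (hmem b) (hmono hab)) hab
      (hθ.of_le (by simp)) hd hpos
  refine ⟨θ, hmono, hran, fun t => ⟨1, one_pos, hseg _ _ (by linarith), hseg _ _ (by linarith)⟩,
    ?_, ?_⟩
  · rintro ⟨q, hq⟩
    obtain ⟨γ', J', h1, h2, h3, h4⟩ := h.exists_extension (σ := 1) (by simp)
      (fun t ht => by rw [one_smul]; exact hc t ht) (q := q) (fun W hW => by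
        obtain ⟨T, hT⟩ := eventually_atTop.1 (hq.eventually hW)
        refine ⟨θ T, hmem T, fun t ht hle => ?_⟩
        rw [← hran] at ht
        obtain ⟨s, rfl⟩ := ht
        exact hT s (hmono.le_iff_le.1 hle))
    exact h4 (hmax γ' J' h1 h2 h3)
  · rintro ⟨q, hq⟩
    have hr := h.comp_affine 0 (c := -1) (by norm_num)
    obtain ⟨γ', J', h1, h2, h3, h4⟩ := hr.exists_extension (σ := -1) (by simp)
      (fun t ht => by
        rw [vel_comp_affine (h.mdifferentiableAt ht), smul_smul, neg_mul_neg, one_mul, one_smul]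
        exact hc _ ht) (q := q) (fun W hW => by
        obtain ⟨T, hT⟩ := eventually_atBot.1 (hq.eventually hW)
        refine ⟨-θ T, by simpa using hmem T, fun t ht hle => ?_⟩
        have ht' : 0 + -1 * t ∈ range θ := hran ▸ ht
        obtain ⟨s, hs⟩ := ht'
        rw [← hs]
        exact hT s (hmono.le_iff_le.1 (by linarith)))
    refine h4 ?_
    have hback := hmax _ _ (h1.comp_affine 0 (c := -1) (by norm_num))
      (fun t ht => h2 (by simpa using ht)) (fun t ht => by
        have := h3 (x := 0 + -1 * t) (by simpa using ht)
        simpa using this)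
    ext t
    have := Set.ext_iff.1 hback (-t)
    simpa using this

theorem FutureNull.futureCausal {𝔤 : Spacetime n M} {x : M} {v : TSp n x}
    (h : 𝔤.FutureNull x v) : 𝔤.FutureCausal x v := ⟨h.1, h.2.1.le, h.2.2⟩

theorem FutureTimelike.futureCausal {𝔤 : Spacetime n M} {x : M} {v : TSp n x}
    (h : 𝔤.FutureTimelike x v) : 𝔤.FutureCausal x v :=
  ⟨fun h0 => by have := h.1; rw [h0] at this; simp at this, h.1.le, h.2⟩

theorem IsMaximalFutureNullGeodesic.causalLE {𝔤 : Spacetime n M} {γ : ℝ → M} {J : Set ℝ}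
    (h : 𝔤.IsMaximalFutureNullGeodesic γ J) {a b : ℝ} (ha : a ∈ J) (hb : b ∈ J) (hab : a ≤ b) :
    𝔤.CausalLE (γ a) (γ b) := by
  rcases hab.eq_or_lt with rfl | hab
  · exact Relation.ReflTransGen.refl
  · exact (h.1.causalSegment (fun t ht => (h.2.1 t ht).futureCausal) ha hb hab).causalLE

theorem IsMaximalFutureNullGeodesic.exists_mem_cauchySurface [T2Space M] {𝔤 : Spacetime n M}
    {γ : ℝ → M} {J : Set ℝ} (h : 𝔤.IsMaximalFutureNullGeodesic γ J) {S : Set M}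
    (hS : 𝔤.IsCauchySurface S) : ∃ s ∈ J, γ s ∈ S := by
  obtain ⟨θ, -, hran, hin⟩ :=
    h.1.exists_inextendible (fun t ht => (h.2.1 t ht).futureCausal) h.2.2
  obtain ⟨t, ht, -⟩ := hS _ hin
  exact ⟨θ t, hran ▸ mem_range_self t, ht⟩

theorem InextendibleCausalCurve.shift {𝔤 : Spacetime n M} {c : ℝ → M}
    (h : 𝔤.InextendibleCausalCurve c) (k : ℝ) :
    𝔤.InextendibleCausalCurve (fun t => c (k + t)) := by
  refine ⟨fun t => ?_, ?_, ?_⟩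
  · obtain ⟨ε, hε, h1, h2⟩ := h.1 (k + t)
    refine ⟨ε, hε, ?_, ?_⟩
    · convert h1.shift k using 1 <;> ring
    · convert h2.shift k using 1 <;> ring
  · rintro ⟨q, hq⟩
    refine h.2.1 ⟨q, ?_⟩
    have := hq.comp (tendsto_atTop_add_const_left atTop (-k) tendsto_id)
    simpa [Function.comp_def] using this
  · rintro ⟨q, hq⟩
    refine h.2.2 ⟨q, ?_⟩
    have := hq.comp (tendsto_atBot_add_const_left atBot (-k) tendsto_id)
    simpa [Function.comp_def] using this

/-- The maximal geodesic in the direction of the time field remains future timelike and has no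
endpoints. -/
theorem exists_inextendible_through [T2Space M] (𝔤 : Spacetime n M) (p : M) :
    ∃ c : ℝ → M, 𝔤.InextendibleCausalCurve c ∧ c 0 = p := by
  obtain ⟨γ, J, hγ, h0, hp, hv, hmax⟩ := 𝔤.exists_maximal_geodesic p (𝔤.timeVec p)
  have hft : 𝔤.FutureTimelike (γ 0) (vel n γ 0) := by
    rw [hv, hp]
    exact ⟨𝔤.timelike_timeField p, 𝔤.timelike_timeField p⟩
  obtain ⟨θ, -, hran, hin⟩ := hγ.exists_inextendible
    (fun t ht => (hγ.futureTimelike h0 ht hft).futureCausal) hmax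
  obtain ⟨s, hs⟩ : (0 : ℝ) ∈ range θ := hran ▸ h0
  refine ⟨_, hin.shift s, ?_⟩
  simp [hs, hp]

/-! ### Acausality of Cauchy surfaces -/

/-- The restriction of `c` to `[0, ∞)` is a future-inextendible piecewise `C¹` causal curve. -/
def IsFutureRay (𝔤 : Spacetime n M) (c : ℝ → M) : Prop :=
  (∀ t, 0 ≤ t → ∃ ε > 0, 𝔤.CausalSegment c t (t + ε)) ∧
    (∀ t, 0 < t → ∃ ε > 0, 𝔤.CausalSegment c (t - ε) t) ∧ ¬ ∃ q, Tendsto c atTop (𝓝 q)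

theorem InextendibleCausalCurve.isFutureRay {𝔤 : Spacetime n M} {c : ℝ → M}
    (h : 𝔤.InextendibleCausalCurve c) : 𝔤.IsFutureRay c :=
  ⟨fun t _ => let ⟨ε, hε, h1⟩ := h.1 t; ⟨ε, hε, h1.2⟩,
    fun t _ => let ⟨ε, hε, h1⟩ := h.1 t; ⟨ε, hε, h1.1⟩, h.2.1⟩

theorem IsFutureRay.exists_prepend {𝔤 : Spacetime n M} {c σ : ℝ → M} {a b : ℝ}
    (h : 𝔤.IsFutureRay c) (hσ : 𝔤.CausalSegment σ a b) (hb : σ b = c 0) :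
    ∃ c' : ℝ → M, 𝔤.IsFutureRay c' ∧ c' 0 = σ a ∧ ∀ t, 0 ≤ t → c' (t + (b - a)) = c t := by
  set k := b - a with hk
  have hk0 : 0 < k := sub_pos.2 hσ.1
  set c' : ℝ → M := fun t => if t ≤ k then σ (a + t) else c (-k + t) with hc'
  have e1 : ∀ t, t ≤ k → c' t = σ (a + t) := fun t ht => if_pos ht
  have e2 : ∀ t, k ≤ t → c' t = c (-k + t) := fun t ht => by
    rcases ht.eq_or_lt with rfl | ht
    · rw [e1 _ le_rfl, hk]
      simp [hb]
    · exact if_neg ht.not_ge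
  have hσ' : 𝔤.CausalSegment (fun t => σ (a + t)) 0 k := by
    have := hσ.shift a
    rwa [sub_self] at this
  refine ⟨c', ⟨fun t ht => ?_, fun t ht => ?_, ?_⟩, ?_, fun t ht => ?_⟩
  · rcases lt_or_ge t k with htk | htk
    · refine ⟨k - t, sub_pos.2 htk, ?_⟩
      rw [add_sub_cancel]
      exact (hσ'.mono ht le_rfl htk).congr fun s hs => e1 s hs.2
    · obtain ⟨ε, hε, h1⟩ := h.1 (-k + t) (by linarith)
      refine ⟨ε, hε, ?_⟩
      have h2 := h1.shift (-k)
      have h3 : 𝔤.CausalSegment (fun s => c (-k + s)) t (t + ε) := by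
        convert h2 using 1 <;> ring
      exact h3.congr fun s hs => e2 s (htk.trans hs.1)
  · rcases le_or_gt t k with htk | htk
    · refine ⟨t, ht, ?_⟩
      rw [sub_self]
      exact (hσ'.mono le_rfl htk ht).congr fun s hs => e1 s (hs.2.trans htk)
    · obtain ⟨ε, hε, h1⟩ := h.2.1 (-k + t) (by linarith)
      refine ⟨min ε (t - k), lt_min hε (sub_pos.2 htk), ?_⟩
      have h2 := h1.shift (-k)
      have h3 : 𝔤.CausalSegment (fun s => c (-k + s)) (t - ε) t := by
        convert h2 using 1 <;> ring
      have := min_le_left ε (t - k)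
      have := min_le_right ε (t - k)
      have := lt_min hε (sub_pos.2 htk)
      exact (h3.mono (by linarith) le_rfl (by linarith)).congr fun s hs =>
        e2 s (by linarith [hs.1])
  · rintro ⟨q, hq⟩
    refine h.2.2 ⟨q, ?_⟩
    have h1 := hq.comp (tendsto_atTop_add_const_left atTop k tendsto_id)
    refine h1.congr' ?_
    filter_upwards [eventually_ge_atTop 0] with t ht
    simp only [Function.comp_apply, id]
    rw [e2 _ (by linarith)]
    simp
  · rw [e1 0 hk0.le, add_zero]
  · rw [e2 _ (by linarith)]
    congr 1
    ring

theorem IsFutureRay.exists_inextendible {𝔤 : Spacetime n M} {c d : ℝ → M}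
    (h : 𝔤.IsFutureRay c) (hd : 𝔤.InextendibleCausalCurve d) (h0 : d 0 = c 0) :
    ∃ e : ℝ → M, 𝔤.InextendibleCausalCurve e ∧ ∀ t, 0 ≤ t → e t = c t := by
  set e : ℝ → M := fun t => if t ≤ 0 then d t else c t with he
  have e1 : ∀ t, t ≤ 0 → e t = d t := fun t ht => if_pos ht
  have e2 : ∀ t, 0 ≤ t → e t = c t := fun t ht => by
    rcases ht.eq_or_lt with rfl | ht
    · rw [e1 _ le_rfl, h0]
    · exact if_neg ht.not_ge
  have hl : ∀ t, ∃ ε > 0, 𝔤.CausalSegment e (t - ε) t := fun t => by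
    rcases le_or_gt t 0 with ht | ht
    · obtain ⟨ε, hε, h1, -⟩ := hd.1 t
      exact ⟨ε, hε, h1.congr fun s hs => e1 s (hs.2.trans ht)⟩
    · obtain ⟨ε, hε, h1⟩ := h.2.1 t ht
      have := min_le_left ε t
      have := min_le_right ε t
      have := lt_min hε ht
      exact ⟨min ε t, this, (h1.mono (by linarith) le_rfl (by linarith)).congr fun s hs =>
        e2 s (by linarith [hs.1])⟩
  have hr : ∀ t, ∃ ε > 0, 𝔤.CausalSegment e t (t + ε) := fun t => by
    rcases lt_or_ge t 0 with ht | ht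
    · obtain ⟨ε, hε, -, h1⟩ := hd.1 t
      have := min_le_left ε (-t)
      have := min_le_right ε (-t)
      have := lt_min hε (neg_pos.2 ht)
      exact ⟨min ε (-t), this, (h1.mono le_rfl (by linarith) (by linarith)).congr fun s hs =>
        e1 s (by linarith [hs.2])⟩
    · obtain ⟨ε, hε, h1⟩ := h.1 t ht
      exact ⟨ε, hε, h1.congr fun s hs => e2 s (ht.trans hs.1)⟩
  refine ⟨e, ⟨fun t => ?_, ?_, ?_⟩, e2⟩
  · obtain ⟨ε, hε, h1⟩ := hl t
    obtain ⟨δ, hδ, h2⟩ := hr t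
    have := min_le_left ε δ
    have := min_le_right ε δ
    have := lt_min hε hδ
    exact ⟨min ε δ, this, h1.mono (by linarith) le_rfl (by linarith),
      h2.mono le_rfl (by linarith) (by linarith)⟩
  · rintro ⟨q, hq⟩
    refine h.2.2 ⟨q, hq.congr' ?_⟩
    filter_upwards [eventually_ge_atTop 0] with t ht using e2 t ht
  · rintro ⟨q, hq⟩
    refine hd.2.2 ⟨q, hq.congr' ?_⟩
    filter_upwards [eventually_le_atBot 0] with t ht using e1 t ht

/-- No causal curve joins two points of a Cauchy surface. -/
theorem IsCauchySurface.acausal [T2Space M] {𝔤 : Spacetime n M} {S : Set M}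
    (hS : 𝔤.IsCauchySurface S) {p q : M} (hp : p ∈ S) (hq : q ∈ S) :
    ¬ Relation.TransGen (fun p q => ∃ (c : ℝ → M) (a b : ℝ),
      𝔤.CausalSegment c a b ∧ c a = p ∧ c b = q) p q := by
  intro hpq
  -- The causal chain from `p` to `q` is continued by an inextendible curve beyond `q`, and
  -- afterwards by one before `p`. The result is an inextendible causal curve meeting `S` at the two
  -- parameters `0` and `L`.
  obtain ⟨c, L, hL, hc, hc0, hcL⟩ : ∃ (c : ℝ → M) (L : ℝ), 0 < L ∧ 𝔤.IsFutureRay c ∧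
      c 0 = p ∧ c L = q := by
    clear hp
    induction hpq using Relation.TransGen.head_induction_on with
    | single h =>
      obtain ⟨σ, a, b, hσ, rfl, rfl⟩ := h
      obtain ⟨c, hc, hc0⟩ := 𝔤.exists_inextendible_through (σ b)
      obtain ⟨c', h1, h2, h3⟩ := hc.isFutureRay.exists_prepend hσ hc0.symm
      exact ⟨c', b - a, sub_pos.2 hσ.1, h1, h2, by simpa [hc0] using h3 0 le_rfl⟩
    | head h _ ih =>
      obtain ⟨σ, a, b, hσ, rfl, rfl⟩ := h
      obtain ⟨c, L, hL, hc, hc0, hcL⟩ := ih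
      obtain ⟨c', h1, h2, h3⟩ := hc.exists_prepend hσ hc0.symm
      exact ⟨c', L + (b - a), by linarith [hσ.1], h1, h2, (h3 L hL.le).trans hcL⟩
  obtain ⟨d, hd, hd0⟩ := 𝔤.exists_inextendible_through p
  obtain ⟨e, he, hec⟩ := hc.exists_inextendible hd (hd0.trans hc0.symm)
  have := (hS e he).unique (y₁ := 0) (y₂ := L) (by rw [hec 0 le_rfl, hc0]; exact hp)
    (by rw [hec L hL.le, hcL]; exact hq)
  exact hL.ne this

theorem Chron.transGen_causal {𝔤 : Spacetime n M} {p q : M} (h : 𝔤.Chron p q) :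
    Relation.TransGen (fun p q => ∃ (c : ℝ → M) (a b : ℝ),
      𝔤.CausalSegment c a b ∧ c a = p ∧ c b = q) p q :=
  Relation.TransGen.mono (fun _ _ ⟨c, a, b, h, h'⟩ => ⟨c, a, b, h.causalSegment, h'⟩) _ _ h

theorem IsCauchySurface.not_causalLE_of_mem_chronPast [T2Space M] {𝔤 : Spacetime n M} {S : Set M}
    (hS : 𝔤.IsCauchySurface S) {p q : M} (hp : p ∈ S) (hq : q ∈ 𝔤.chronPast S) :
    ¬ 𝔤.CausalLE p q := by
  obtain ⟨s, hs, hqs⟩ := hq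
  exact fun h => hS.acausal hp hs (hqs.transGen_causal.trans_right h)

end Spacetime
end

/-! ### Null normals of spacelike subspaces. -/

noncomputable section
set_option maxSynthPendingDepth 3

open Module in
/-- The null directions orthogonal to a definite subspace of codimension two. -/
theorem IsLorentzForm.exists_null_pair {V : Type*} [NormedAddCommGroup V] [NormedSpace ℝ V]
    [FiniteDimensional ℝ V] {B : V →L[ℝ] V →L[ℝ] ℝ} (hB : IsLorentzForm B) {T : V}
    (hT : B T T < 0) {W : Submodule ℝ V} (hpos : ∀ w ∈ W, w ≠ 0 → 0 < B w w)
    (hdim : finrank ℝ V ≤ finrank ℝ W + 2) {l : V} (hl0 : l ≠ 0) (hl : B l l = 0)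
    (hlT : 0 < B T l) (hlW : ∀ w ∈ W, B l w = 0) :
    ∃ k : V, k ≠ 0 ∧ B k k = 0 ∧ 0 < B T k ∧ (∀ w ∈ W, B k w = 0) ∧
      LinearIndependent ℝ ![l, k] ∧ ∀ v, B v v = 0 → 0 < B T v → (∀ w ∈ W, B v w = 0) →
        ∃ c : ℝ, 0 < c ∧ (v = c • l ∨ v = c • k) := by
  set A : LinearMap.BilinForm ℝ V := LinearMap.mk₂ ℝ (fun u v => B u v) (by simp) (by simp)
    (by simp) (by simp) with hA
  have hAB : ∀ u v, A u v = B u v := fun u v => rfl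
  have hrefl : A.IsRefl := fun u v h => by rw [hAB, hB.symm]; exact h
  have horth : ∀ v, v ∈ A.orthogonal W ↔ ∀ w ∈ W, B v w = 0 := fun v => by
    rw [LinearMap.BilinForm.mem_orthogonal_iff]
    refine forall₂_congr fun w _ => ?_
    rw [hB.symm v w]
    rfl
  -- Definiteness on `W` makes `W` disjoint from its orthogonal space, hence complementary to it;
  -- the latter has dimension at most two.
  have hcompl : IsCompl W (A.orthogonal W) := by
    rw [LinearMap.BilinForm.isCompl_orthogonal_iff_disjoint hrefl, Submodule.disjoint_def]
    intro w hw hw'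
    by_contra h0
    exact (hpos w hw h0).ne' ((horth w).1 hw' w hw)
  have hfin := Submodule.finrank_add_eq_of_isCompl hcompl
  have hlO : l ∈ A.orthogonal W := (horth l).2 hlW
  obtain ⟨m, hmO, hlm⟩ : ∃ m ∈ A.orthogonal W, B l m ≠ 0 := by
    by_contra! hcon
    refine hl0 (hB.eq_zero_of_forall fun v => ?_)
    obtain ⟨w, hw, o, ho, rfl⟩ := Submodule.mem_sup.1
      (hcompl.sup_eq_top ▸ Submodule.mem_top : v ∈ W ⊔ A.orthogonal W)
    rw [map_add, hlW w hw, hcon o ho, add_zero]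
  -- The coefficient solves `B m m - 2 a * B l m = 0`, so that `m - a • l` is null; it still pairs
  -- nontrivially with `l`.
  set k₀ := m - (B m m / (2 * B l m)) • l with hk₀
  have hk₀O : k₀ ∈ A.orthogonal W := sub_mem hmO (Submodule.smul_mem _ _ hlO)
  have hlk₀ : B l k₀ = B l m := by simp [hk₀, hl]
  have hk₀k₀ : B k₀ k₀ = 0 := by
    simp only [hk₀, map_sub, map_smul, sub_apply, smul_apply, smul_eq_mul, hl, hB.symm m l]
    field_simp
    ring
  have hk₀0 : k₀ ≠ 0 := fun h => hlm (by rw [← hlk₀, h, map_zero])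
  have hTk₀ := hB.apply_ne_zero hT hk₀0 hk₀k₀.le
  obtain ⟨k, hkO, hkk, hlk, hTk⟩ : ∃ k ∈ A.orthogonal W, B k k = 0 ∧ B l k ≠ 0 ∧ 0 < B T k := by
    rcases hTk₀.lt_or_gt with h | h
    · exact ⟨-k₀, neg_mem hk₀O, by simp [hk₀k₀], by simpa [hlk₀] using hlm, by simpa using h⟩
    · exact ⟨k₀, hk₀O, hk₀k₀, by rwa [hlk₀], h⟩
  have hk0 : k ≠ 0 := fun h => hlk (by rw [h, map_zero])
  have hind : LinearIndependent ℝ ![l, k] := by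
    rw [LinearIndependent.pair_iff]
    intro a b hab
    have hb : b = 0 := by
      have := congrArg (B l) hab
      simpa [hl, hlk] using this
    subst hb
    simpa [hl0] using hab
  refine ⟨k, hk0, hkk, hTk, (horth k).1 hkO, hind, fun v hvv hTv hvW => ?_⟩
  have hspan : Submodule.span ℝ (range ![l, k]) = A.orthogonal W := by
    refine Submodule.eq_of_le_of_finrank_le ?_ ?_
    · rw [Submodule.span_le]
      rintro _ ⟨i, rfl⟩
      fin_cases i
      · exact hlO
      · exact hkO
    · rw [finrank_span_eq_card hind, Fintype.card_fin]
      omega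
  have hv : v ∈ Submodule.span ℝ (range ![l, k]) := hspan ▸ (horth v).2 hvW
  rw [Matrix.range_cons, Matrix.range_cons, Matrix.range_empty, union_empty, singleton_union,
    Submodule.mem_span_pair] at hv
  obtain ⟨a, b, rfl⟩ := hv
  simp only [map_add, map_smul, add_apply, smul_apply, smul_eq_mul, hl, hkk, hB.symm k l] at hvv hTv
  -- In the null basis the square of `a • l + b • k` is `2 a b * B l k`, so a null vector lies on
  -- one of the two axes.
  have hab : a * b = 0 := by
    have : 2 * (a * b) * B l k = 0 := by linear_combination hvv
    simpa [hlk] using this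
  rcases mul_eq_zero.1 hab with rfl | rfl
  · refine ⟨b, ?_, Or.inr (by simp)⟩
    simpa [hTk] using hTv
  · refine ⟨a, ?_, Or.inl (by simp)⟩
    simpa [hlT] using hTv

namespace Spacetime
variable {n : ℕ} {M : Type*} [TopologicalSpace M] [ChartedSpace (Model n) M]
  [IsManifold 𝓘(ℝ, Model n) ∞ M]
local notation "φ[" x₀ "]" => extChartAt (modelWithCornersSelf ℝ (Model n)) x₀

/-! ### Tangent spaces of submanifolds -/

/-- The derivative of a chart, as a map of the model space. -/
def homeoDeriv (n : ℕ) {M : Type*} [TopologicalSpace M] [ChartedSpace (Model n) M]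
    (ψ : OpenPartialHomeomorph M (Model n)) (p : M) : Model n →L[ℝ] Model n :=
  mfderiv 𝓘(ℝ, Model n) 𝓘(ℝ, Model n) ψ p

omit [IsManifold 𝓘(ℝ, Model n) ∞ M] in
theorem hasDerivAt_homeo_comp {ψ : OpenPartialHomeomorph M (Model n)}
    (hψ : ψ ∈ IsManifold.maximalAtlas 𝓘(ℝ, Model n) ∞ M) {c : ℝ → M} {t : ℝ}
    (hc : MDifferentiableAt 𝓘(ℝ, ℝ) 𝓘(ℝ, Model n) c t) (ht : c t ∈ ψ.source) :
    HasDerivAt (fun s => ψ (c s)) (homeoDeriv n ψ (c t) (vel n c t)) t := by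
  have h1 : MDifferentiableAt 𝓘(ℝ, Model n) 𝓘(ℝ, Model n) ψ (c t) :=
    (contMDiffAt_of_mem_maximalAtlas hψ ht).mdifferentiableAt (by simp)
  have h2 : HasFDerivAt (fun s => ψ (c s)) (homeoDeriv n ψ (c t) ∘L
      (mfderiv 𝓘(ℝ, ℝ) 𝓘(ℝ, Model n) c t : ℝ →L[ℝ] Model n)) t :=
    (h1.hasMFDerivAt.comp t hc.hasMFDerivAt).hasFDerivAt
  exact h2.hasDerivAt

omit [IsManifold 𝓘(ℝ, Model n) ∞ M] in
-- Only later parameters are constrained, since a generator may leave the horizon towards the past.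
-- The one-sided derivative already determines the velocity.
theorem homeoDeriv_vel_apply_eq_zero {ψ : OpenPartialHomeomorph M (Model n)}
    (hψ : ψ ∈ IsManifold.maximalAtlas 𝓘(ℝ, Model n) ∞ M) {c : ℝ → M} {t : ℝ}
    (hc : MDifferentiableAt 𝓘(ℝ, ℝ) 𝓘(ℝ, Model n) c t) (ht : c t ∈ ψ.source) {i : Fin (n + 2)}
    (h0 : ψ (c t) i = 0) (h : ∀ᶠ s in 𝓝[>] t, ψ (c s) i = 0) :
    homeoDeriv n ψ (c t) (vel n c t) i = 0 := by
  have h1 : HasDerivAt (fun s => ψ (c s) i) (homeoDeriv n ψ (c t) (vel n c t) i) t :=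
    (EuclideanSpace.proj i : Model n →L[ℝ] ℝ).hasFDerivAt.comp_hasDerivAt t
      (hasDerivAt_homeo_comp hψ hc ht)
  have h2 : HasDerivWithinAt (fun s => ψ (c s) i) 0 (Ioi t) t :=
    (hasDerivWithinAt_const t (Ioi t) (0 : ℝ)).congr_of_eventuallyEq h h0
  exact (uniqueDiffWithinAt_Ioi t).eq_deriv _ h1.hasDerivWithinAt h2

omit [IsManifold 𝓘(ℝ, Model n) ∞ M] in
-- The curve is a straight line in the chart; its velocity is identified by injectivity of the
-- derivative of the chart.
theorem exists_curve_homeoDeriv {ψ : OpenPartialHomeomorph M (Model n)}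
    (hψ : ψ ∈ IsManifold.maximalAtlas 𝓘(ℝ, Model n) ∞ M) {p : M} (hp : p ∈ ψ.source)
    (v : Model n) :
    ∃ c : ℝ → M, ContMDiffAt 𝓘(ℝ, ℝ) 𝓘(ℝ, Model n) ∞ c 0 ∧ c 0 = p ∧ vel n c 0 = v ∧
      ∀ᶠ t in 𝓝 (0 : ℝ), c t ∈ ψ.source ∧ ψ (c t) = ψ p + t • homeoDeriv n ψ p v := by
  set w := homeoDeriv n ψ p v with hw
  have hline : ContDiff ℝ ∞ fun t : ℝ => ψ p + t • w := by fun_prop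
  have hpt : ψ p ∈ ψ.target := ψ.map_source hp
  have hsymm : ContMDiffAt 𝓘(ℝ, Model n) 𝓘(ℝ, Model n) ∞ ψ.symm (ψ p) :=
    contMDiffAt_symm_of_mem_maximalAtlas hψ hpt
  have h0 : ψ p + (0 : ℝ) • w = ψ p := by simp
  have hc : ContMDiffAt 𝓘(ℝ, ℝ) 𝓘(ℝ, Model n) ∞ (fun t : ℝ => ψ.symm (ψ p + t • w)) 0 :=
    ContMDiffAt.comp (g := ψ.symm) (f := fun t : ℝ => ψ p + t • w) (0 : ℝ)
      (by rw [h0]; exact hsymm) hline.contMDiff.contMDiffAt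
  have hev : ∀ᶠ t in 𝓝 (0 : ℝ), ψ p + t • w ∈ ψ.target :=
    hline.continuous.continuousAt.preimage_mem_nhds
      (by rw [h0]; exact ψ.open_target.mem_nhds hpt)
  have hc0 : ψ.symm (ψ p + (0 : ℝ) • w) = p := by rw [h0, ψ.left_inv hp]
  refine ⟨_, hc, hc0, ?_, hev.mono fun t ht => ⟨ψ.map_target ht, ψ.right_inv ht⟩⟩
  have hmd := hc.mdifferentiableAt (by simp)
  have h1 := hasDerivAt_homeo_comp hψ hmd (by simpa only [hc0] using hp)
  have h2 : HasDerivAt (fun t : ℝ => ψ p + t • w) w 0 := by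
    simpa using ((hasDerivAt_id (0 : ℝ)).smul_const w).const_add (ψ p)
  have h3 := (h2.congr_of_eventuallyEq (hev.mono fun t ht => ψ.right_inv ht)).unique h1
  have hinj : Function.Injective (homeoDeriv n ψ p) := by
    have hψm : MDifferentiableAt 𝓘(ℝ, Model n) 𝓘(ℝ, Model n) ψ p :=
      (contMDiffAt_of_mem_maximalAtlas hψ hp).mdifferentiableAt (by simp)
    have hcomp := (hsymm.mdifferentiableAt (by simp)).hasMFDerivAt.comp p hψm.hasMFDerivAt
    have hid : HasMFDerivAt 𝓘(ℝ, Model n) 𝓘(ℝ, Model n) (ψ.symm ∘ ψ) p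
        (ContinuousLinearMap.id ℝ (TangentSpace 𝓘(ℝ, Model n) p)) := by
      refine (hasMFDerivAt_id p).congr_of_eventuallyEq ?_
      filter_upwards [ψ.open_source.mem_nhds hp] with x hx using ψ.left_inv hx
    have heq := hasMFDerivAt_unique hcomp hid
    refine Function.LeftInverse.injective
      (g := mfderiv 𝓘(ℝ, Model n) 𝓘(ℝ, Model n) ψ.symm (ψ p)) fun x => ?_
    exact DFunLike.congr_fun heq x
  rw [hc0] at h3
  exact hinj h3.symm

omit [IsManifold 𝓘(ℝ, Model n) ∞ M] in
-- Tangency is defined by the existence of a curve; here it becomes a linear condition, with chart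
-- lines as witnesses.
theorem tangentTo_iff {k : ℕ} {S : Set M} {ψ : OpenPartialHomeomorph M (Model n)}
    (hψ : ψ ∈ IsManifold.maximalAtlas 𝓘(ℝ, Model n) ∞ M) {p : M} (hp : p ∈ ψ.source)
    (hS : ∀ q ∈ ψ.source, q ∈ S ↔ ∀ i : Fin (n + 2), i.val < k → ψ q i = 0) (hpS : p ∈ S)
    (v : Model n) :
    TangentTo n S p v ↔ ∀ i : Fin (n + 2), i.val < k → homeoDeriv n ψ p v i = 0 := by
  constructor
  · rintro ⟨c, hc, hcS, rfl, hv⟩ i hi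
    rw [← hv]
    have hmd := hc.mdifferentiableAt (by simp)
    refine homeoDeriv_vel_apply_eq_zero hψ hmd hp ((hS _ hp).1 hpS i hi) ?_
    refine nhdsWithin_le_nhds ?_
    filter_upwards [hcS, hmd.continuousAt.preimage_mem_nhds (ψ.open_source.mem_nhds hp)]
      with t ht ht' using (hS _ ht').1 ht i hi
  · intro h
    obtain ⟨c, hc, hc0, hv, hev⟩ := exists_curve_homeoDeriv hψ hp v
    refine ⟨c, hc, hev.mono fun t ht => (hS _ ht.1).2 fun i hi => ?_, hc0, hv⟩
    rw [ht.2]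
    simp [h i hi, (hS _ hp).1 hpS i hi]

omit [IsManifold 𝓘(ℝ, Model n) ∞ M] in
open Module in
/-- The vectors tangent to a submanifold form a subspace of the right dimension. -/
theorem IsSmoothSubmanifold.exists_tangent {k : ℕ} {S : Set M} (hS : IsSmoothSubmanifold n k S)
    {p : M} (hp : p ∈ S) : ∃ W : Submodule ℝ (Model n), (∀ v : Model n, v ∈ W ↔ TangentTo n S p v) ∧
      finrank ℝ (Model n) ≤ finrank ℝ W + k := by
  obtain ⟨ψ, hψ, hpψ, hψS⟩ := hS p hp
  set L : Model n →ₗ[ℝ] ({i : Fin (n + 2) // i.val < k} → ℝ) :=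
    LinearMap.pi fun i => (EuclideanSpace.proj i.1 : Model n →L[ℝ] ℝ).toLinearMap ∘ₗ (homeoDeriv n ψ p).toLinearMap with hL
  refine ⟨LinearMap.ker L, fun v => ?_, ?_⟩
  · rw [tangentTo_iff hψ hpψ hψS hp, LinearMap.mem_ker, funext_iff]
    exact Subtype.forall (p := fun i : Fin (n + 2) => i.val < k)
      (q := fun i => homeoDeriv n ψ p v i.1 = 0)
  · have h1 := L.finrank_range_add_finrank_ker
    have h2 := Submodule.finrank_le (LinearMap.range L)
    rw [finrank_fintype_fun_eq_card] at h2
    have h3 : Fintype.card {i : Fin (n + 2) // i.val < k} ≤ k := by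
      have := Fintype.card_le_of_injective
        (fun i : {i : Fin (n + 2) // i.val < k} => (⟨i.1.1, i.2⟩ : Fin k))
        (fun i j hij => Subtype.ext (Fin.ext (by simpa using hij)))
      simpa using this
    omega

omit [IsManifold 𝓘(ℝ, Model n) ∞ M] in
/-- A curve that stays in a submanifold for a while has a tangent initial velocity. -/
theorem IsSmoothSubmanifold.tangentTo_vel {k : ℕ} {S : Set M} (hS : IsSmoothSubmanifold n k S)
    {c : ℝ → M} {t : ℝ} (hc : MDifferentiableAt 𝓘(ℝ, ℝ) 𝓘(ℝ, Model n) c t) (ht : c t ∈ S)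
    (h : ∀ᶠ s in 𝓝[>] t, c s ∈ S) : TangentTo n S (c t) (vel n c t) := by
  obtain ⟨ψ, hψ, hpψ, hψS⟩ := hS _ ht
  refine (tangentTo_iff hψ hpψ hψS ht _).2 fun i hi =>
    homeoDeriv_vel_apply_eq_zero hψ hc hpψ ((hψS _ hpψ).1 ht i hi) ?_
  filter_upwards [h, nhdsWithin_le_nhds
    (hc.continuousAt.preimage_mem_nhds (ψ.open_source.mem_nhds hpψ))] with s hs hs'
  exact (hψS _ hs').1 hs i hi

omit [IsManifold 𝓘(ℝ, Model n) ∞ M] in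
theorem TangentTo.mono {S S' : Set M} {p : M} {v : TSp n p} (h : TangentTo n S p v)
    (hS : ∀ᶠ q in 𝓝 p, q ∈ S → q ∈ S') : TangentTo n S' p v := by
  obtain ⟨c, hc, hcS, rfl, hv⟩ := h
  refine ⟨c, hc, ?_, rfl, hv⟩
  filter_upwards [hcS, hc.continuousAt.eventually hS] with t h1 h2 using h2 h1

/-- Being timelike is an open condition on position and velocity, so the curve stays timelike for a
short time. -/
theorem exists_chron_of_futureTimelike {𝔤 : Spacetime n M} {c : ℝ → M}
    (hc : ContMDiffAt 𝓘(ℝ, ℝ) 𝓘(ℝ, Model n) ∞ c 0) (hv : 𝔤.FutureTimelike (c 0) (vel n c 0)) :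
    ∀ᶠ t in 𝓝[>] (0 : ℝ), 𝔤.Chron (c 0) (c t) := by
  have hs := mem_extChartAt_source (I := 𝓘(ℝ, Model n)) (c 0)
  have hx := contDiffAt_chart_comp hc hs
  set x := fun s => φ[c 0] (c s) with hxdef
  have hdc : ContinuousAt (deriv x) 0 :=
    ((hx.fderiv_right (m := ∞) (by simp)).continuousAt).clm_apply continuousAt_const
  have hv' : 𝔤.ChartTimelike (c 0) (x 0) (deriv x 0) := by
    rw [hxdef, deriv_chart (hc.mdifferentiableAt (by simp)) hs]
    exact (futureTimelike_iff_chart _ hs _).1 hv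
  have h1 : ∀ᶠ t in 𝓝 (0 : ℝ), 𝔤.ChartTimelike (c 0) (x t) (deriv x t) :=
    (hx.continuousAt.prodMk hdc).eventually
      (hv'.eventually (mem_extChartAt_target (I := 𝓘(ℝ, Model n)) (c 0)))
  have h2 : ∀ᶠ t in 𝓝 (0 : ℝ), ContDiffAt ℝ 1 x t :=
    (hx.of_le (m := 1) (by simp)).eventually (by simp)
  have h3 : ∀ᶠ t in 𝓝 (0 : ℝ), c t ∈ (φ[c 0]).source :=
    hc.continuousAt.preimage_mem_nhds ((isOpen_extChartAt_source (c 0)).mem_nhds hs)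
  obtain ⟨δ, hδ, hball⟩ := Metric.eventually_nhds_iff.1 (h1.and (h2.and h3))
  filter_upwards [Ioo_mem_nhdsGT hδ] with t ht
  have hmem : ∀ s ∈ Icc 0 t, dist s 0 < δ := fun s hs => by
    rw [Real.dist_0_eq_abs, abs_of_nonneg hs.1]
    exact hs.2.trans_lt ht.2
  refine TimelikeSegment.chron ((timelikeSegment_iff_chart 𝔤 (x₀ := c 0) ht.1
    fun s hs => (hball (hmem s hs)).2.2).2 ⟨fun s hs => ?_, fun s hs => ?_⟩)
  · exact (hball (hmem s hs)).2.1.contDiffWithinAt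
  · have hds : DifferentiableAt ℝ x s := (hball (hmem s hs)).2.1.differentiableAt (by simp)
    rw [hds.derivWithin (uniqueDiffOn_Icc ht.1 s hs)]
    exact (hball (hmem s hs)).1

theorem Achronal.not_futureTimelike_of_tangentTo {𝔤 : Spacetime n M} {H : Set M}
    (hH : 𝔤.Achronal H) {p : M} {v : TSp n p} (hv : TangentTo n H p v) :
    ¬ 𝔤.FutureTimelike p v := by
  obtain ⟨c, hc, hcH, rfl, hv⟩ := hv
  intro hft
  rw [← hv] at hft
  obtain ⟨t, h1, h2⟩ := ((exists_chron_of_futureTimelike hc hft).and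
    (nhdsWithin_le_nhds hcH)).exists
  exact hH _ hcH.self_of_nhds _ h2 h1

/-- A tangent vector of negative square is future timelike up to sign, and a curve in `H` with that
velocity would join chronologically related points of `H`. -/
theorem Achronal.form_nonneg_of_tangentTo {𝔤 : Spacetime n M} {H : Set M}
    (hH : 𝔤.Achronal H) {k : ℕ} (hsub : IsSmoothSubmanifold n k H) {p : M} (hp : p ∈ H)
    {v : Model n} (hv : TangentTo n H p v) : 0 ≤ 𝔤.form p v v := by
  by_contra! hneg
  obtain ⟨W, hW, -⟩ := hsub.exists_tangent hp
  have hne := (𝔤.isLorentzForm_form p).apply_ne_zero (𝔤.form_timeVec p)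
    (v := v) (fun h0 => by rw [h0] at hneg; simp at hneg) hneg.le
  rcases hne.lt_or_gt with h | h
  · exact hH.not_futureTimelike_of_tangentTo hv ⟨hneg, h⟩
  · refine hH.not_futureTimelike_of_tangentTo (v := -v)
      ((hW (-v)).1 (neg_mem ((hW v).2 hv))) ⟨?_, ?_⟩
    · change 𝔤.form p (-v) (-v) < 0
      simpa using hneg
    · change 𝔤.form p (𝔤.timeVec p) (-v) < 0
      simpa using h

/-- The form is positive semidefinite on the tangent space, so a null vector lies in its radical:
the square of `t • l + w` is affine in `t` and cannot be bounded below unless its slope vanishes. -/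
theorem Achronal.form_eq_zero_of_tangentTo {𝔤 : Spacetime n M} {H : Set M}
    (hH : 𝔤.Achronal H) {k : ℕ} (hsub : IsSmoothSubmanifold n k H) {p : M} (hp : p ∈ H)
    {l w : Model n} (hl : TangentTo n H p l) (hll : 𝔤.form p l l = 0) (hw : TangentTo n H p w) :
    𝔤.form p l w = 0 := by
  obtain ⟨W, hW, -⟩ := hsub.exists_tangent hp
  have key : ∀ t : ℝ, 0 ≤ 2 * t * 𝔤.form p l w + 𝔤.form p w w := fun t => by
    have h1 := hH.form_nonneg_of_tangentTo hsub hp (v := t • l + w)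
      ((hW _).1 (add_mem (W.smul_mem t ((hW l).2 hl)) ((hW w).2 hw)))
    simp only [map_add, map_smul, add_apply, smul_apply, smul_eq_mul, hll,
      (𝔤.isLorentzForm_form p).symm w l] at h1
    linarith
  by_contra h0
  -- At this `t` the affine function takes the value `-1`.
  have h1 := key (-(𝔤.form p w w + 1) / (2 * 𝔤.form p l w))
  have h2 : 2 * (-(𝔤.form p w w + 1) / (2 * 𝔤.form p l w)) * 𝔤.form p l w
      = -(𝔤.form p w w + 1) := by
    field_simp
  linarith

end Spacetime
end

noncomputable section
set_option maxSynthPendingDepth 3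

namespace Spacetime
variable {n : ℕ} {M : Type*} [TopologicalSpace M] [ChartedSpace (Model n) M]
  [IsManifold 𝓘(ℝ, Model n) ∞ M]

/-! ### Generators of a horizon -/

theorem IsRulingFrom.mono {𝔤 : Spacetime n M} {H : Set M} {γ : ℝ → M} {J : Set ℝ} {s t : ℝ}
    (h : 𝔤.IsRulingFrom H γ J s) (ht : t ∈ J) (hst : s ≤ t) : 𝔤.IsRulingFrom H γ J t :=
  ⟨h.1, ht, fun r hr htr => h.2.2 r hr (hst.trans htr)⟩

theorem IsRulingFrom.mem {𝔤 : Spacetime n M} {H : Set M} {γ : ℝ → M} {J : Set ℝ} {s : ℝ}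
    (h : 𝔤.IsRulingFrom H γ J s) : γ s ∈ H := h.2.2 s h.2.1 le_rfl

/-- If a geodesic enters a closed horizon between `r` and `s`, it does so at a past endpoint. -/
theorem IsRulingFrom.exists_end {𝔤 : Spacetime n M} {H : Set M} (hcl : IsClosed H) {γ : ℝ → M}
    {J : Set ℝ} {r s : ℝ} (h : 𝔤.IsRulingFrom H γ J s) (hr : r ∈ J)
    (hnot : ¬ 𝔤.IsRulingFrom H γ J r) :
    ∃ t, r < t ∧ t ≤ s ∧ 𝔤.IsRulingFrom H γ J t ∧ ∀ t₁ < t, ¬ 𝔤.IsRulingFrom H γ J t₁ := by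
  set A := {t | 𝔤.IsRulingFrom H γ J t}
  have hlow : ∀ a ∈ A, r < a := fun a ha => lt_of_not_ge fun har => hnot (ha.mono hr har)
  have hbdd : BddBelow A := ⟨r, fun a ha => (hlow a ha).le⟩
  have hne : A.Nonempty := ⟨s, h⟩
  -- The infimum of the parameters from which the geodesic stays in `H`; it is attained because `H`
  -- is closed.
  set t := sInf A
  have hrt : r ≤ t := le_csInf hne fun a ha => (hlow a ha).le
  have hts : t ≤ s := csInf_le hbdd h
  have htJ : t ∈ J := h.1.1.2.1.out hr h.2.1 ⟨hrt, hts⟩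
  have hgt : ∀ q ∈ J, t < q → γ q ∈ H := fun q hq htq => by
    obtain ⟨a, ha, haq⟩ := exists_lt_of_csInf_lt hne htq
    exact ha.2.2 q hq haq.le
  have htH : γ t ∈ H := by
    have hc : Tendsto γ (𝓝[>] t) (𝓝 (γ t)) :=
      (h.1.1.continuousAt htJ).mono_left nhdsWithin_le_nhds
    refine hcl.mem_of_tendsto hc ?_
    filter_upwards [self_mem_nhdsWithin, nhdsWithin_le_nhds (h.1.1.1.mem_nhds htJ)] with q h1 h2
    exact hgt q h2 h1
  have htA : t ∈ A := ⟨h.1, htJ, fun q hq htq => htq.eq_or_lt.elim (fun e => e ▸ htH) (hgt q hq)⟩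
  exact ⟨t, hlow t htA, hts, htA, fun t₁ ht₁ h₁ => (csInf_le hbdd h₁).not_gt ht₁⟩

/-- A generator lies in the horizon from the moment at which it crosses a Cauchy surface to the
future of all the endpoints. -/
theorem IsRulingFrom.of_mem_cauchySurface [T2Space M] {𝔤 : Spacetime n M} {H S : Set M}
    (hcl : IsClosed H) (hS : 𝔤.IsCauchySurface S) (hfut : 𝔤.horizonEnd H ⊆ 𝔤.chronPast S)
    {γ : ℝ → M} {J : Set ℝ} {s t : ℝ} (h : 𝔤.IsRulingFrom H γ J t) (hs : s ∈ J) (hsS : γ s ∈ S) :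
    𝔤.IsRulingFrom H γ J s := by
  by_contra hnot
  -- Otherwise the past endpoint comes after `γ s ∈ S`, although it lies in the chronological past
  -- of `S`.
  obtain ⟨r, hsr, -, hr, hmin⟩ := h.exists_end hcl hs hnot
  exact hS.not_causalLE_of_mem_chronPast hsS (hfut ⟨γ, J, r, hr, rfl, hmin⟩)
    (h.1.causalLE hs hr.2.1 hsr.le)

/-- A point of the horizon in the past of a Cauchy surface precedes a point of the section. -/
theorem IsFutureHorizon.exists_causalLE_inter [T2Space M] {𝔤 : Spacetime n M} {H S : Set M}
    (hH : 𝔤.IsFutureHorizon H) (hS : 𝔤.IsCauchySurface S) {h : M} (hh : h ∈ H)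
    (hhS : h ∈ 𝔤.chronPast S) : ∃ y ∈ S ∩ H, 𝔤.CausalLE h y := by
  obtain ⟨γ, J, t, hγ, rfl⟩ := hH.2.2.2 h hh
  obtain ⟨s, hs, hsS⟩ := hγ.1.exists_mem_cauchySurface hS
  have hts : t ≤ s := le_of_not_gt fun hst =>
    hS.not_causalLE_of_mem_chronPast hsS hhS (hγ.1.causalLE hs hγ.2.1 hst.le)
  exact ⟨γ s, ⟨hsS, hγ.2.2 s hs hts⟩, hγ.1.causalLE hγ.2.1 hs hts⟩

/-- Before its past endpoint, a generator lies in the chronological past of the section. -/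
theorem IsFutureHorizon.mem_chronPast_of_lt_end [T2Space M] {𝔤 : Spacetime n M} {H S : Set M}
    (hH : 𝔤.IsFutureHorizon H) (hS : 𝔤.IsCauchySurface S)
    (hfut : 𝔤.horizonEnd H ⊆ 𝔤.chronPast S) {γ : ℝ → M} {J : Set ℝ} {r t : ℝ}
    (hγ : 𝔤.IsRulingFrom H γ J t) (hmin : ∀ t₁ < t, ¬ 𝔤.IsRulingFrom H γ J t₁) (hr : r ∈ J)
    (hrt : r < t) : γ r ∈ 𝔤.chronPast (S ∩ H) := by
  have hW : 𝔤.chronPast S ∈ 𝓝 (γ t) :=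
    (𝔤.isOpen_chronPast S).mem_nhds (hfut ⟨γ, J, t, hγ, rfl, hmin⟩)
  -- The comparison points `h` are required to lie in the chronological past of `S`, so that their
  -- own generators still have to reach the section.
  obtain ⟨V, hV, hside⟩ := exists_nhds_chron_of_notMem hH.1 hH.2.2.1 hγ.mem hW
  obtain ⟨δ, hδ, hball⟩ := Metric.eventually_nhds_iff.1
    ((hγ.1.1.continuousAt hγ.2.1).eventually hV)
  set r' := max r (t - δ / 2)
  have hr't : r' < t := max_lt hrt (by linarith)
  have hr'J : r' ∈ J := hγ.1.1.2.1.out hr hγ.2.1 ⟨le_max_left _ _, hr't.le⟩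
  -- Minimality of `t` gives a point off `H` at or after `r'`, hence in `V` and before the endpoint.
  obtain ⟨q, hqJ, hr'q, hqH⟩ : ∃ q ∈ J, r' ≤ q ∧ γ q ∉ H := by
    by_contra! hcon
    exact hmin r' hr't ⟨hγ.1, hr'J, hcon⟩
  have hqt : q < t := lt_of_not_ge fun htq => hqH (hγ.2.2 q hqJ htq)
  have hqV : γ q ∈ V := hball (by
    have := le_max_right r (t - δ / 2)
    rw [Real.dist_eq, abs_lt]
    constructor <;> linarith)
  have hrq : 𝔤.CausalLE (γ r) (γ q) := hγ.1.causalLE hr hqJ ((le_max_left _ _).trans hr'q)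
  -- If the point off `H` precedes `h`, then so does `γ r`, and `h` precedes the section. If it
  -- follows `h`, then `h` chronologically precedes the endpoint, against achronality.
  rcases hside _ hqV hqH with ⟨h, hh, hqh⟩ | ⟨h, hh, hhq⟩
  · obtain ⟨y, hy, hhy⟩ := hH.exists_causalLE_inter hS hh.1 hh.2
    exact ⟨y, hy, (hrq.chron_of_chron hqh).of_causalLE hhy⟩
  · exact absurd (hhq.of_causalLE (hγ.1.causalLE hqJ hγ.2.1 hqt.le)) (hH.1 _ hh.1 _ hγ.mem)

/-! ### Null directions tangent to a horizon -/

theorem IsRulingFrom.tangentTo_vel {𝔤 : Spacetime n M} {H U : Set M} (hU : IsOpen U) {k : ℕ}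
    (hsub : IsSmoothSubmanifold n k (H ∩ U)) {γ : ℝ → M} {J : Set ℝ} {s : ℝ}
    (h : 𝔤.IsRulingFrom H γ J s) (hsU : γ s ∈ U) : TangentTo n (H ∩ U) (γ s) (vel n γ s) := by
  refine hsub.tangentTo_vel (h.1.1.mdifferentiableAt h.2.1) ⟨h.mem, hsU⟩ ?_
  filter_upwards [self_mem_nhdsWithin, nhdsWithin_le_nhds (h.1.1.1.mem_nhds h.2.1),
    nhdsWithin_le_nhds ((h.1.1.continuousAt h.2.1).preimage_mem_nhds (hU.mem_nhds hsU))]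
    with t h1 h2 h3 using ⟨h.2.2 t h2 (le_of_lt h1), h3⟩

theorem Achronal.subset {𝔤 : Spacetime n M} {H H' : Set M} (h : 𝔤.Achronal H) (hsub : H' ⊆ H) :
    𝔤.Achronal H' := fun p hp q hq => h p (hsub hp) q (hsub hq)

/-- Two future null vectors tangent to an achronal submanifold at the same point are parallel. -/
theorem Achronal.exists_eq_smul {𝔤 : Spacetime n M} {H : Set M} (hH : 𝔤.Achronal H) {k : ℕ}
    (hsub : IsSmoothSubmanifold n k H) {p : M} (hp : p ∈ H) {v w : Model n}
    (hv : TangentTo n H p v) (hw : TangentTo n H p w) (hv0 : 𝔤.FutureNull p v)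
    (hw0 : 𝔤.FutureNull p w) : ∃ a : ℝ, 0 < a ∧ w = a • v := by
  have hz := hH.form_eq_zero_of_tangentTo hsub hp hv hv0.2.1 hw
  have hTv : 𝔤.form p (𝔤.timeVec p) v < 0 := hv0.2.2
  have hTw : 𝔤.form p (𝔤.timeVec p) w < 0 := hw0.2.2
  have heq : (𝔤.form p (𝔤.timeVec p) w) • v = (𝔤.form p (𝔤.timeVec p) v) • w := by
    by_contra hne
    exact ((𝔤.isLorentzForm_form p).apply_neg_of_ne (𝔤.form_timeVec p) hv0.2.1.le hw0.2.1.le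
      hTv hTw hne).ne hz
  refine ⟨𝔤.form p (𝔤.timeVec p) w / 𝔤.form p (𝔤.timeVec p) v, div_pos_of_neg_of_neg hTw hTv, ?_⟩
  rw [div_eq_inv_mul, mul_smul, heq, smul_smul, inv_mul_cancel₀ hTv.ne, one_smul]

/-- The velocity is a null vector tangent to the smooth achronal part of `H`, hence orthogonal to
all its tangent vectors, in particular to those of the section. -/
theorem IsRulingFrom.form_vel_eq_zero {𝔤 : Spacetime n M} {H U S : Set M} (hach : 𝔤.Achronal H)
    (hU : IsOpen U) {k : ℕ} (hsub : IsSmoothSubmanifold n k (H ∩ U)) {γ : ℝ → M} {J : Set ℝ}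
    {s : ℝ} (h : 𝔤.IsRulingFrom H γ J s) (hsU : γ s ∈ U) {w : Model n}
    (hw : TangentTo n (S ∩ H) (γ s) w) : 𝔤.form (γ s) (vel n γ s) w = 0 := by
  refine (hach.subset inter_subset_left).form_eq_zero_of_tangentTo hsub ⟨h.mem, hsU⟩
    (h.tangentTo_vel hU hsub hsU) (h.1.2.1 s h.2.1).2.1 (hw.mono ?_)
  filter_upwards [hU.mem_nhds hsU] with q hq hqS using ⟨hqS.2, hq⟩

/-! ### Past-directed normal null geodesics -/

theorem pastNull_smul_of_neg {𝔤 : Spacetime n M} {p : M} {v : Model n} (hv : 𝔤.FutureNull p v)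
    {c : ℝ} (hc : c < 0) : 𝔤.PastNull p (c • v : Model n) := by
  refine ⟨smul_ne_zero hc.ne hv.1, ?_, ?_⟩
  · have h : 𝔤.form p v v = 0 := hv.2.1
    change 𝔤.form p (c • v) (c • v) = 0
    simp [h]
  · have h : 𝔤.form p (𝔤.timeVec p) v < 0 := hv.2.2
    change 0 < 𝔤.form p (𝔤.timeVec p) (c • v)
    simpa using mul_pos_of_neg_of_neg hc h

theorem futureNull_neg {𝔤 : Spacetime n M} {p : M} {v : Model n} (hv : 𝔤.PastNull p v) :
    𝔤.FutureNull p (-v : Model n) := by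
  refine ⟨neg_ne_zero.2 hv.1, ?_, ?_⟩
  · have h : 𝔤.form p v v = 0 := hv.2.1
    change 𝔤.form p (-v) (-v) = 0
    simp [h]
  · have h : 0 < 𝔤.form p (𝔤.timeVec p) v := hv.2.2
    change 𝔤.form p (𝔤.timeVec p) (-v) < 0
    simpa using h

theorem IsPastNormalNullGeodesic.causalLE {𝔤 : Spacetime n M} {S : Set M} {γ : ℝ → M}
    {J : Set ℝ} (h : 𝔤.IsPastNormalNullGeodesic S γ J) {a b : ℝ} (ha : a ∈ J) (hb : b ∈ J)
    (hab : a ≤ b) : 𝔤.CausalLE (γ b) (γ a) := by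
  rcases hab.eq_or_lt with rfl | hab
  · exact Relation.ReflTransGen.refl
  have hr := h.1.comp_affine 0 (c := -1) (by norm_num)
  have hseg := hr.causalSegment (fun t ht => FutureNull.futureCausal (by
    have := futureNull_neg (h.2.1 _ ht)
    have hv := vel_comp_affine (h.1.mdifferentiableAt ht)
    rw [neg_one_smul] at hv
    change 𝔤.FutureNull _ (vel n _ t)
    rw [hv]
    exact this)) (a := -b) (b := -a) (by simpa using hb) (by simpa using ha) (by linarith)
  simpa using hseg.causalLE

/-- The reversed generator, starting at the section. -/
theorem IsRulingFrom.isPastNormalNullGeodesic {𝔤 : Spacetime n M} {H U S : Set M}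
    (hach : 𝔤.Achronal H) (hU : IsOpen U) {k : ℕ} (hsub : IsSmoothSubmanifold n k (H ∩ U))
    {γ : ℝ → M} {J : Set ℝ} {s : ℝ} (h : 𝔤.IsRulingFrom H γ J s) (hsS : γ s ∈ S)
    (hsU : γ s ∈ U) :
    𝔤.IsPastNormalNullGeodesic (S ∩ H) (fun t => γ (s + -1 * t)) {t | s + -1 * t ∈ J} := by
  have e : s + -1 * 0 = s := by ring
  have hv : ∀ t, s + -1 * t ∈ J →
      vel n (fun t => γ (s + -1 * t)) t = (-1 : ℝ) • vel n γ (s + -1 * t) := fun t ht =>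
    vel_comp_affine (h.1.1.mdifferentiableAt ht)
  have horth : ∀ w : Model n, TangentTo n (S ∩ H) (γ s) w →
      𝔤.form (γ s) ((-1 : ℝ) • vel n γ s) w = 0 := fun w hw => by
    rw [map_smul, smul_apply, h.form_vel_eq_zero hach hU hsub hsU hw, smul_zero]
  refine ⟨h.1.1.comp_affine s (by norm_num), fun t ht => ?_, ?_, ?_, fun w hw => ?_⟩
  · change 𝔤.PastNull _ (vel n _ t)
    rw [hv t ht]
    exact pastNull_smul_of_neg (h.1.2.1 _ ht) (by norm_num)
  · change s + -1 * 0 ∈ J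
    rw [e]
    exact h.2.1
  · change γ (s + -1 * 0) ∈ S ∩ H
    rw [e]
    exact ⟨hsS, h.mem⟩
  · change 𝔤.form (γ (s + -1 * 0)) (vel n (fun t => γ (s + -1 * t)) 0) w = 0
    change TangentTo n (S ∩ H) (γ (s + -1 * 0)) w at hw
    rw [hv 0 (by rw [e]; exact h.2.1)]
    rw [e] at hw ⊢
    exact horth w hw

theorem horizonEnd_subset {𝔤 : Spacetime n M} {H : Set M} : 𝔤.horizonEnd H ⊆ H := by
  rintro _ ⟨γ, J, t, h, rfl, -⟩
  exact h.mem

/-! ### The endpoints of a horizon as cut points -/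

/-- Between the endpoint and its crossing with `S` the generator lies in the achronal set `H`, so it
avoids the chronological past of the section; before the endpoint it lies in that past. -/
theorem horizonEnd_subset_wavefrontCutPoints [T2Space M] {𝔤 : Spacetime n M} {H S U : Set M}
    (hH : 𝔤.IsFutureHorizon H) (hS : 𝔤.IsCauchySurface S)
    (hfut : 𝔤.horizonEnd H ⊆ 𝔤.chronPast S) (hU : IsOpen U) (hSU : S ∩ H ⊆ U) {k : ℕ}
    (hsub : IsSmoothSubmanifold n k (H ∩ U)) :
    𝔤.horizonEnd H ⊆ 𝔤.wavefrontCutPoints H (S ∩ H) := by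
  rintro _ ⟨γ, J, t₀, hγ, rfl, hmin⟩
  obtain ⟨s, hs, hsS⟩ := hγ.1.exists_mem_cauchySurface hS
  have hts : t₀ ≤ s := le_of_not_gt fun hst =>
    hS.not_causalLE_of_mem_chronPast hsS (hfut ⟨γ, J, t₀, hγ, rfl, hmin⟩)
      (hγ.1.causalLE hs hγ.2.1 hst.le)
  have hγs := hγ.mono hs hts
  have e : s + -1 * (s - t₀) = t₀ := by ring
  refine ⟨_, _, ⟨hγs.isPastNormalNullGeodesic hH.1 hU hsub hsS (hSU ⟨hsS, hγs.mem⟩), s - t₀,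
    by simpa only [mem_ofPred_eq, e] using hγ.2.1, sub_nonneg.2 hts, by simp only [e],
    fun t ht h0 hle => ?_, fun t ht hlt => ?_⟩, γ, J, ⟨t₀, hγ⟩, s, 1, one_pos, fun t ht => ?_⟩
  · rintro ⟨y, hy, hlt⟩
    exact hH.1 _ (hγ.2.2 _ ht (by linarith)) _ hy.2 hlt
  · exact hH.mem_chronPast_of_lt_end hS hfut hγ hmin ht (by linarith)
  · have e' : s - 1 * t = s + -1 * t := by ring
    rw [e']
    exact ⟨ht, rfl⟩

/-- A past endpoint strictly after the cut parameter of the generator would put the cut point into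
the chronological past of the section. If instead the generator stayed in `H` beyond the cut point,
achronality would be violated just beyond it. -/
theorem wavefrontCutPoints_subset_horizonEnd [T2Space M] {𝔤 : Spacetime n M} {H S : Set M}
    (hH : 𝔤.IsFutureHorizon H) (hS : 𝔤.IsCauchySurface S)
    (hfut : 𝔤.horizonEnd H ⊆ 𝔤.chronPast S) :
    𝔤.wavefrontCutPoints H (S ∩ H) ⊆ 𝔤.horizonEnd H := by
  rintro _ ⟨γ, J, ⟨hγ, t₀, ht₀, h0, rfl, hbefore, hafter⟩, η, K, ⟨t₂, hη⟩, s, c, hc, hrun⟩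
  obtain ⟨hsK, hs⟩ := hrun 0 hγ.2.2.1
  rw [mul_zero, sub_zero] at hsK hs
  have hηs : 𝔤.IsRulingFrom H η K s := hη.of_mem_cauchySurface hH.2.1 hS hfut hsK
    (hs ▸ hγ.2.2.2.1.1)
  obtain ⟨hrK, hr⟩ := hrun t₀ ht₀
  have hrul : 𝔤.IsRulingFrom H η K (s - c * t₀) := by
    by_contra hnot
    obtain ⟨t₁, hlt, -, h1, hmin⟩ := hηs.exists_end hH.2.1 hrK hnot
    refine hbefore t₀ ht₀ h0 le_rfl ?_
    rw [hr]
    exact hH.mem_chronPast_of_lt_end hS hfut h1 hmin hrK hlt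
  refine ⟨η, K, s - c * t₀, hrul, hr.symm, fun t₁ ht₁ h₁ => ?_⟩
  -- The parameter set is open, so the geodesic continues a little beyond the cut point while still
  -- inside the part assumed to lie in `H`.
  have hev : ∀ᶠ t in 𝓝[>] t₀, s - c * t ∈ Ioi t₁ := by
    refine nhdsWithin_le_nhds ?_
    have hcont : ContinuousAt (fun t => s - c * t) t₀ := by fun_prop
    exact hcont.preimage_mem_nhds (Ioi_mem_nhds ht₁)
  have hJ : ∀ᶠ t in 𝓝[>] t₀, t ∈ J := nhdsWithin_le_nhds (hγ.1.1.mem_nhds ht₀)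
  obtain ⟨t, ⟨h2, h4⟩, h3⟩ := ((hev.and hJ).and self_mem_nhdsWithin).exists
  obtain ⟨y, hy, hlt⟩ := hafter t h4 h3
  obtain ⟨htK, hteq⟩ := hrun t h4
  exact hH.1 _ (hteq ▸ h₁.2.2 _ htK (le_of_lt h2)) _ hy.2 hlt

/-- Normal null geodesics whose initial velocity is opposite to that of a generator run along it. -/
theorem IsRulingFrom.alongWavefront [T2Space M] {𝔤 : Spacetime n M} {H : Set M} {η γ : ℝ → M}
    {K J : Set ℝ} {s c : ℝ} (hη : 𝔤.IsRulingFrom H η K s) (hγ : 𝔤.IsGeodesic γ J) (h0 : 0 ∈ J)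
    (hp : γ 0 = η s) (hc : 0 < c) (hv : vel n γ 0 = (-c) • vel n η s) :
    𝔤.AlongWavefront H γ J := by
  have e : s + -c * 0 = s := by ring
  have hη' := hη.1.1.comp_affine s (c := -c) (neg_ne_zero.2 hc.ne')
  have hmem0 : s + -c * 0 ∈ K := by rw [e]; exact hη.2.1
  have heq : EqOn γ (fun t => η (s + -c * t)) (J ∩ {t | s + -c * t ∈ K}) := by
    refine hγ.eqOn hη' h0 hmem0 ?_ ?_
    · simp only [e, hp]
    · rw [vel_comp_affine (hη.1.1.mdifferentiableAt hmem0), e, hv]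
  have hinv : ∀ t, s + -c * (s / c + -c⁻¹ * t) = t := fun t => by field_simp; ring
  have hinv' : ∀ t, s / c + -c⁻¹ * (s + -c * t) = t := fun t => by field_simp; ring
  have hσ := hγ.comp_affine (s / c) (c := -c⁻¹) (neg_ne_zero.2 (inv_ne_zero hc.ne'))
  -- The inversely reparametrised `γ` is glued to `η`. By maximality of `η` nothing is added to `K`,
  -- so all parameters of `γ` correspond to parameters of `η`.
  obtain ⟨ρ, hρ, hρη, -⟩ := hη.1.1.exists_union hσ
    ⟨s, hη.2.1, by
      change s / c + -c⁻¹ * s ∈ J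
      have := hinv' 0
      rw [e] at this
      rwa [this]⟩
    (fun t ht => by
      have := heq (x := s / c + -c⁻¹ * t) ⟨ht.2, by
        change s + -c * (s / c + -c⁻¹ * t) ∈ K
        rw [hinv]
        exact ht.1⟩
      simp only [hinv] at this
      exact this.symm)
  have hK := hη.1.2.2 ρ _ hρ subset_union_left hρη.symm
  have hsubK : ∀ t ∈ J, s + -c * t ∈ K := fun t ht => by
    rw [← hK]
    refine Or.inr ?_
    change s / c + -c⁻¹ * (s + -c * t) ∈ J
    rwa [hinv']
  refine ⟨η, K, ⟨s, hη⟩, s, c, hc, fun t ht => ?_⟩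
  have e' : s - c * t = s + -c * t := by ring
  rw [e']
  exact ⟨hsubK t ht, heq ⟨ht, hsubK t ht⟩⟩

/-- An achronal hypersurface contains a past-directed null geodesic segment if it contains the
endpoints. -/
theorem IsPastNormalNullGeodesic.mem_of_mem {𝔤 : Spacetime n M} {H S : Set M}
    (hH : 𝔤.IsFutureHorizon H) {γ : ℝ → M} {J : Set ℝ}
    (hγ : 𝔤.IsPastNormalNullGeodesic (S ∩ H) γ J) {b : ℝ} (hb : b ∈ J) (hbH : γ b ∈ H) :
    Icc 0 b ⊆ γ ⁻¹' H := by
  have hsub : Icc 0 b ⊆ J := hγ.1.2.1.out hγ.2.2.1 hb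
  have hcont : ContinuousOn γ (Icc 0 b) := fun t ht =>
    (hγ.1.continuousAt (hsub ht)).continuousWithinAt
  -- The parameters in `H` form a closed set containing `0`; it suffices to move slightly beyond
  -- each of them.
  refine IsClosed.Icc_subset_of_forall_mem_nhdsWithin ?_ hγ.2.2.2.1.2 fun t ht => ?_
  · rw [inter_comm]
    exact hcont.preimage_isClosed_of_isClosed isClosed_Icc hH.2.1
  · have htJ : t ∈ J := hsub (Ico_subset_Icc_self ht.2)
    obtain ⟨V, hV, hside⟩ := exists_nhds_chron_of_notMem hH.1 hH.2.2.1 ht.1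
      (W := univ) univ_mem
    filter_upwards [nhdsWithin_le_nhds ((hγ.1.continuousAt htJ).preimage_mem_nhds hV),
      Ioo_mem_nhdsGT ht.2.2] with q hqV hq
    have hqJ : q ∈ J := hsub ⟨ht.2.1.trans hq.1.le, hq.2.le⟩
    by_contra hqH
    -- The first case gives `γ b ≤ γ q ≪ h`, the second `h ≪ γ q ≤ γ 0`; both contradict
    -- achronality.
    rcases hside _ hqV hqH with ⟨h, hh, hqh⟩ | ⟨h, hh, hhq⟩
    · exact hH.1 _ hbH _ hh.1 ((hγ.causalLE hqJ hb hq.2.le).chron_of_chron hqh)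
    · exact hH.1 _ hh.1 _ hγ.2.2.2.1.2
        (hhq.of_causalLE (hγ.causalLE hγ.2.2.1 hqJ (ht.2.1.trans hq.1.le)))

/-- A normal null geodesic that reaches a past endpoint of the horizon runs along a generator. -/
theorem IsPastNormalNullGeodesic.alongWavefront [T2Space M] {𝔤 : Spacetime n M} {H S U : Set M}
    (hH : 𝔤.IsFutureHorizon H) (hS : 𝔤.IsCauchySurface S)
    (hfut : 𝔤.horizonEnd H ⊆ 𝔤.chronPast S) (hU : IsOpen U) (hSU : S ∩ H ⊆ U) {k : ℕ}
    (hsub : IsSmoothSubmanifold n k (H ∩ U)) {γ : ℝ → M} {J : Set ℝ}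
    (hγ : 𝔤.IsPastNormalNullGeodesic (S ∩ H) γ J) {b : ℝ} (hb : b ∈ J) (hb0 : 0 ≤ b)
    (hend : γ b ∈ 𝔤.horizonEnd H) : 𝔤.AlongWavefront H γ J := by
  have hu := hγ.2.2.2.1
  -- A positive length is needed for the segment in `H` to determine a tangent vector at its start.
  have hb0 : 0 < b := hb0.lt_of_ne fun h0 => by
    subst h0
    exact hS.not_causalLE_of_mem_chronPast hu.1 (hfut hend) Relation.ReflTransGen.refl
  have hmem := hγ.mem_of_mem hH hb (horizonEnd_subset hend)
  have hHU : γ 0 ∈ H ∩ U := ⟨hu.2, hSU hu⟩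
  have htan : TangentTo n (H ∩ U) (γ 0) (vel n γ 0) := by
    refine hsub.tangentTo_vel (hγ.1.mdifferentiableAt hγ.2.2.1) hHU ?_
    filter_upwards [Ioo_mem_nhdsGT hb0, nhdsWithin_le_nhds
      ((hγ.1.continuousAt hγ.2.2.1).preimage_mem_nhds (hU.mem_nhds hHU.2))] with t h1 h2
    exact ⟨hmem ⟨h1.1.le, h1.2.le⟩, h2⟩
  obtain ⟨W, hW, -⟩ := hsub.exists_tangent hHU
  obtain ⟨η, K, s, hη, hηs⟩ := hH.2.2.2 _ hu.2
  have htη : TangentTo n (H ∩ U) (γ 0) (vel n η s) := by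
    rw [← hηs]
    exact hη.tangentTo_vel hU hsub (by rw [hηs]; exact hHU.2)
  have hnη : 𝔤.FutureNull (γ 0) (vel n η s) := by
    rw [← hηs]
    exact hη.1.2.1 s hη.2.1
  -- The reversed velocity of `γ` and the velocity of the generator through `γ 0` are future null
  -- and tangent to `H`, hence parallel.
  obtain ⟨a, ha, heq⟩ := (hH.1.subset inter_subset_left).exists_eq_smul hsub hHU htη
    ((hW (-vel n γ 0)).1 (neg_mem ((hW _).2 htan))) hnη (futureNull_neg (hγ.2.1 0 hγ.2.2.1))
  refine hη.alongWavefront hγ.1 hγ.2.2.1 hηs.symm ha ?_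
  rw [neg_smul, ← heq, neg_neg]

/-- The direction `l` is the reversed velocity of some generator through `u`. Any other generator
through `u` has a parallel velocity, since the null direction tangent to the smooth achronal part of
`H` is unique; so `l` does not depend on the choice. -/
theorem exists_null_normals [T2Space M] {𝔤 : Spacetime n M} {H S U : Set M}
    (hH : 𝔤.IsFutureHorizon H) (hSspace : 𝔤.IsSpacelike S) (hS : 𝔤.IsCauchySurface S)
    (hfut : 𝔤.horizonEnd H ⊆ 𝔤.chronPast S) (hcross : IsSmoothSubmanifold n 2 (S ∩ H))
    (hU : IsOpen U) (hSU : S ∩ H ⊆ U) (hsub : IsSmoothSubmanifold n 1 (H ∩ U)) {u : M}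
    (hu : u ∈ S ∩ H) : ∃ l k : TSp n u,
      (𝔤.PastNull u l ∧ 𝔤.OrthogonalTo (S ∩ H) u l) ∧
      (𝔤.PastNull u k ∧ 𝔤.OrthogonalTo (S ∩ H) u k) ∧
      LinearIndependent ℝ ![l, k] ∧
      (∀ v : TSp n u, 𝔤.PastNull u v → 𝔤.OrthogonalTo (S ∩ H) u v →
        ∃ c : ℝ, 0 < c ∧ (v = c • l ∨ v = c • k)) ∧
      (∀ (γ : ℝ → M) (J : Set ℝ), 𝔤.IsPastNormalNullGeodesic (S ∩ H) γ J → γ 0 = u →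
        (𝔤.AlongWavefront H γ J ↔
          ∃ c : ℝ, 0 < c ∧ (velocity n γ 0 : Model n) = c • l)) := by
  obtain ⟨η, K, s, hη, rfl⟩ := hH.2.2.2 u hu.2
  have hHU : η s ∈ H ∩ U := ⟨hu.2, hSU hu⟩
  obtain ⟨W, hW, hdim⟩ := hcross.exists_tangent hu
  set l : Model n := (-1 : ℝ) • vel n η s with hl
  have hnull : 𝔤.PastNull (η s) l := pastNull_smul_of_neg (hη.1.2.1 s hη.2.1) (by norm_num)
  have horth : ∀ w : Model n, TangentTo n (S ∩ H) (η s) w → 𝔤.form (η s) l w = 0 := fun w hw => by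
    rw [hl, map_smul, smul_apply, hη.form_vel_eq_zero hH.1 hU hsub hHU.2 hw, smul_zero]
  obtain ⟨k, hk0, hkk, hTk, hkW, hind, hall⟩ := (𝔤.isLorentzForm_form (η s)).exists_null_pair
    (𝔤.form_timeVec (η s)) (W := W)
    (fun w hw h0 => hSspace _ hu.1 w
      (((hW w).1 hw).mono (Eventually.of_forall fun q hq => hq.1)) h0)
    hdim hnull.1 hnull.2.1 hnull.2.2 (fun w hw => horth w ((hW w).1 hw))
  refine ⟨l, k, ⟨hnull, horth⟩, ⟨⟨hk0, hkk, hTk⟩, fun w hw => hkW w ((hW w).2 hw)⟩, hind,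
    fun v hv hvo => hall v hv.2.1 hv.2.2 fun w hw => hvo w ((hW w).1 hw), fun γ J hγ hγ0 => ?_⟩
  constructor
  · rintro ⟨η', K', ⟨t₂, hη'⟩, s', c, hc, hrun⟩
    obtain ⟨hsK, hs⟩ := hrun 0 hγ.2.2.1
    rw [mul_zero, sub_zero] at hsK hs
    have hpt : η' s' = η s := hs.symm.trans hγ0
    -- The extended geodesic `η'` is known to lie in `H` only from `t₂` on. As its endpoint would
    -- precede `S`, it lies in `H` from `s'` on, which makes its velocity tangent to `H`.
    have hη's : 𝔤.IsRulingFrom H η' K' s' := hη'.of_mem_cauchySurface hH.2.1 hS hfut hsK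
      (hpt ▸ hu.1)
    have htη' : TangentTo n (H ∩ U) (η s) (vel n η' s') := by
      rw [← hpt]
      exact hη's.tangentTo_vel hU hsub (by rw [hpt]; exact hHU.2)
    have hnη' : 𝔤.FutureNull (η s) (vel n η' s') := by
      rw [← hpt]
      exact hη's.1.2.1 s' hη's.2.1
    obtain ⟨a, ha, heq⟩ := (hH.1.subset inter_subset_left).exists_eq_smul hsub hHU
      (hη.tangentTo_vel hU hsub hHU.2) htη' (hη.1.2.1 s hη.2.1) hnη'
    have e : s' + -c * 0 = s' := by ring
    have hvel : vel n γ 0 = (-c) • vel n η' s' := by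
      have h1 : γ =ᶠ[𝓝 0] fun t => η' (s' + -c * t) := by
        filter_upwards [hγ.1.1.mem_nhds hγ.2.2.1] with t ht
        rw [(hrun t ht).2]
        congr 1
        ring
      rw [vel_congr h1, vel_comp_affine (by rw [e]; exact hη's.1.1.mdifferentiableAt hsK), e]
    refine ⟨c * a, mul_pos hc ha, ?_⟩
    change vel n γ 0 = (c * a) • l
    rw [hvel, heq, hl, smul_smul, smul_smul]
    congr 1
    ring
  · rintro ⟨c, hc, hv⟩
    refine hη.alongWavefront hγ.1 hγ.2.2.1 hγ0 hc ?_
    change vel n γ 0 = c • l at hv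
    rw [hv, hl, smul_smul]
    congr 1
    ring

end Spacetime
end

/-! ### Past endpoints and the two families of null cut points. -/

theorem lemma2p7 {n : ℕ} {M : Type*} [TopologicalSpace M] [T2Space M]
    [SecondCountableTopology M] [ChartedSpace (Model n) M] [IsManifold 𝓘(ℝ, Model n) ∞ M]
    (𝔤 : Spacetime n M) (hgh : 𝔤.GloballyHyperbolic)
    (H : Set M) (hH : 𝔤.IsFutureHorizon H) (hHconn : IsConnected H)
    (S : Set M) (hS : Spacetime.IsSmoothSubmanifold n 1 S) (hSspace : 𝔤.IsSpacelike S)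
    (hScauchy : 𝔤.IsCauchySurface S) (hSfuture : 𝔤.horizonEnd H ⊆ 𝔤.chronPast S)
    (hcross : Spacetime.IsSmoothSubmanifold n 2 (S ∩ H)) (hcompact : IsCompact (S ∩ H))
    (hconn : IsConnected (S ∩ H))
    (hsmooth : ∃ U : Set M, IsOpen U ∧ S ∩ H ⊆ U ∧ Spacetime.IsSmoothSubmanifold n 1 (H ∩ U)) :
    𝔤.horizonEnd H = 𝔤.wavefrontCutPoints H (S ∩ H) ∧
    𝔤.horizonEnd H ⊆ 𝔤.pastNullCutLocus (S ∩ H) ∧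
    𝔤.pastNullCutLocus (S ∩ H) \ 𝔤.horizonEnd H = 𝔤.otherCutPoints H (S ∩ H) ∧
    ∀ u ∈ S ∩ H, ∃ l k : TSp n u,
      (𝔤.PastNull u l ∧ 𝔤.OrthogonalTo (S ∩ H) u l) ∧
      (𝔤.PastNull u k ∧ 𝔤.OrthogonalTo (S ∩ H) u k) ∧
      LinearIndependent ℝ ![l, k] ∧
      (∀ v : TSp n u, 𝔤.PastNull u v → 𝔤.OrthogonalTo (S ∩ H) u v →
        ∃ c : ℝ, 0 < c ∧ (v = c • l ∨ v = c • k)) ∧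
      (∀ (γ : ℝ → M) (J : Set ℝ), 𝔤.IsPastNormalNullGeodesic (S ∩ H) γ J → γ 0 = u →
        (𝔤.AlongWavefront H γ J ↔
          ∃ c : ℝ, 0 < c ∧ (Spacetime.velocity n γ 0 : Model n) = c • l)) := by
  obtain ⟨U, hU, hSU, hsub⟩ := hsmooth
  have hsubset := Spacetime.horizonEnd_subset_wavefrontCutPoints hH hScauchy hSfuture hU hSU hsub
  have heq : 𝔤.horizonEnd H = 𝔤.wavefrontCutPoints H (S ∩ H) := Subset.antisymm hsubset
    (Spacetime.wavefrontCutPoints_subset_horizonEnd hH hScauchy hSfuture)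
  refine ⟨heq, fun p hp => ?_, Subset.antisymm ?_ ?_, fun u hu =>
    Spacetime.exists_null_normals hH hSspace hScauchy hSfuture hcross hU hSU hsub hu⟩
  · obtain ⟨γ, J, hγ, -⟩ := hsubset hp
    exact ⟨γ, J, hγ⟩
  · rintro p ⟨⟨γ, J, hγ⟩, hp⟩
    exact ⟨γ, J, hγ, fun hw => hp (heq ▸ ⟨γ, J, hγ, hw⟩)⟩
  -- A point could conceivably be a cut point along geodesics of both families. This is excluded
  -- because any normal null geodesic reaching a past endpoint runs along a generator.
  · rintro p ⟨γ, J, hγ, hw⟩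
    refine ⟨⟨γ, J, hγ⟩, fun hp => hw ?_⟩
    obtain ⟨h1, t₀, ht₀, h0, rfl, -⟩ := hγ
    exact h1.alongWavefront hH hScauchy hSfuture hU hSU hsub ht₀ h0 hp
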